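/- **Setting.** Let $x=(x_1,x_2)$, $x_2=(x_2',x_2'')$, with values in $\mathbb R^{n}\times\mathbb R^{m}\times\mathbb R^{l}$; let $\mathcal X_2=\mathcal X_2'\times\mathcal X_2''$, $D_1\subseteq\mathcal X_1\subseteq\mathbb R^n$, $D_2\subseteq\mathcal X_2$, and write $x'=(x_1,x_2')$. For parameters $\beta,\gamma,\theta=1/\tau$ and $\varepsilon>0$ consider the hybrid system $$\mathcal H_1:\quad \dot x\in\begin{pmatrix}I&0\\0&\tfrac1\varepsilon I\end{pmatrix}F(x),\ x\in C:=\mathcal X_1\times\mathcal X_2;\qquad x^+\in G(x),\ x\in D:=D_1\times D_2,$$ where $F=F_{\beta,\gamma,\theta}$, $G=G_{\beta,\gamma,\theta}$ are set-valued and $G(x)=G_1(x')\times G_2'(x)\subseteq C$ for $x\in D$. Solutions are hybrid arcs on hybrid time domains (locally absolutely continuous in $t$). $\|\cdot\|_S$ is the Euclidean distance to $S$. A class $\mathcal K$ function is continuous and strictly increasing on $[0,\infty)$ with value $0$ at $0$; it is of class $\mathcal K_\infty$ if it is also unbounded. Let $\mathcal A\subseteq\mathcal X_1$ be nonempty and compact,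 and let $\bar\beta,\bar\gamma,\bar\theta>0$. "For all parameters" means $\beta\in(0,\bar\beta]$, $\gamma\in(0,\bar\gamma]$, $\theta\in(0,\bar\theta]$. A set $S$ is *SGPAS as $(\varepsilon_1,\dots,\varepsilon_k)\to0$* for a parametrized hybrid system if for all $\Delta>\delta>0$ there is $\varepsilon_1^*>0$ such that for each $\varepsilon_1\in(0,\varepsilon_1^*)$ there is $\varepsilon_2^*>0$ such that for each $\varepsilon_2\in(0,\varepsilon_2^*)$ … for each $\varepsilon_k\in(0,\varepsilon_k^*)$: (i) for each $R\ge\delta$ there is $r>0$ with $\|\phi(s,i)\|_S\le r\Rightarrow\|\phi(t,j)\|_S\le R$ whenever $s+i\le t+j$, for every solution $\phi$; (ii) for all $\Delta\ge R\ge r\ge\delta$ there is $T\ge0$ with $\|\phi(s,i)\|_S\le R\Rightarrow\|\phi(t,j)\|_S\le r$ whenever $t+j\ge T+s+i$, for every solution $\phi$. **Assumptions.** 1. *(Regularity.)* $C$ and $D$ are closed. For all parameters, $F$ is outer semicontinuous and locally bounded relative to $C$ with nonempty convex values on $C$, and every maximal solution of $\mathcal H_1$ is complete, for every $\varepsilon>0$.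 For all $(\beta,\gamma,\theta)\in[0,\bar\beta]\times[0,\bar\gamma]\times[0,\bar\theta]$, $G$ is outer semicontinuous and locally bounded relative to $D$ with nonempty values on $D$. The dependence on the parameters is regular up to the limit values, uniformly in $x_2''$: the projection $D'$ of $D$ to the $x'$-space is closed; $(\beta,\gamma,\theta,x')\mapsto G_1(x')$ is jointly outer semicontinuous and locally bounded relative to $[0,\bar\beta]\times[0,\bar\gamma]\times[0,\bar\theta]\times D'$; and for each $\gamma\in(0,\bar\gamma],\theta\in(0,\bar\theta]$ the map $(\beta,x')\mapsto\{f_1:(f_1,f_2)\in F(x',x_2''),\ x_2''\in\mathcal X_2''\}$ is jointly outer semicontinuous and locally bounded relative to $[0,\bar\beta]\times\mathcal X_1\times\mathcal X_2'$. 2. *(Steady states.)* For all parameters and all $x_1\in\mathcal X_1$, $\{x_2\in\mathcal X_2: (f_1,0)\in F(x_1,x_2)\text{ for some }f_1\}=H(x_1):=H_1(x_1)\times\mathcal X_2''$, a nonempty subset of $\mathcal X_2$ that does not depend on the parameters; $H_1$ is outer semicontinuous and locally bounded on $\mathcal X_1$. 3. *(Boundary layer.)* For every $\rho>0$ put $\mathcal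 X_1^\rho=\{x_1\in\mathcal X_1:\|x_1\|_{\mathcal A}\le\rho\}$ and $M_\rho=\{x: x_1\in\mathcal X_1^\rho,\ x_2\in H(x_1)\}$. For each $\gamma,\theta$ in the range, $M_\rho$ is SGPAS as $\beta\to0$ for $\dot x\in\begin{pmatrix}0&0\\0&I\end{pmatrix}F(x)$, $x\in\mathcal X_1^\rho\times\mathcal X_2$ (no jumps). There are $\underline\alpha_2\in\mathcal K_\infty$ and $\overline\alpha_2,\hat\alpha_\beta\in\mathcal K$ such that for every $\Delta>0$ there are a $C^1$ function $V_2$ and $\alpha_2,\alpha_\beta\in\mathcal K$ with the following properties. For $x\in\mathcal X_1^\rho\times\mathcal X_2$: $\underline\alpha_2(\|x\|_{M_\rho})\le V_2(x)\le\overline\alpha_2(\|x\|_{M_\rho})$. For all parameters, $x\in\mathcal X_1^\rho\times\mathcal X_2$ with $\|x\|_{M_\rho}\le\Delta$, and $(f_1,f_2)\in F(x)$: $\langle\nabla V_2(x),(0,f_2)\rangle\le-\alpha_2(\|x\|_{M_\rho})$ if $\|x\|_{M_\rho}\ge\alpha_\beta(\beta)$, and $\langle\nabla V_2(x),(0,f_2)\rangle\le\hat\alpha_\beta(\beta)$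 if $\|x\|_{M_\rho}\le\alpha_\beta(\beta)$. Moreover $\nabla V_2=0$ on $M_\rho$, and for each compact $K\subseteq\mathcal X_1^\rho\times\mathcal X_2'$ the function $|V_2|+\|\nabla_{x_1}V_2\|$ is bounded on $K\times\mathcal X_2''$. 4. *(Regular jumps.)* There is a function $\underline\sigma>0$ on $(0,\infty)$ such that for every $\Delta>0$ there is $N^*$ such that for all parameters and all $\varepsilon>0$ there is $T^*$ for which every solution $\phi$ of $\mathcal H_1$ with $\|\phi(0,0)\|_{\mathcal A\times\mathcal X_2}\le\Delta$ has at most $N^*$ jumps preceded by an interval of flow shorter than $\underline\sigma(\tau)$, all of them at times $t\le T^*$. 5. *(Reduced system.)* Let $F_r(x_1)=\overline{\mathrm{co}}\{f_1:(f_1,f_2)\in F(x_1,x_2),x_2\in H(x_1)\}$ and $G_r(x_1)=\{g_1:(g_1,g_2)\in G(x_1,x_2),\ x_2\in H(x_1),\ (x_1,x_2)\in D\}$. For each $\beta\in(0,\bar\beta],\theta\in(0,\bar\theta]$ the set $\mathcal A$ is SGPAS as $\gamma\to0$ for $\dot x_1\in F_r(x_1)$, $x_1\in\mathcal X_1$;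 $x_1^+\in G_r(x_1)$, $x_1\in D_1$. There are $\underline\alpha_1\in\mathcal K_\infty$, $\overline\alpha_1,\hat\alpha_\gamma\in\mathcal K$ and a function $\hat\sigma>0$ on $(0,\infty)$ such that for every $\Delta>0$ there are a $C^1$ function $V_1$ and $\alpha_1,\alpha_\gamma\in\mathcal K$ with $\underline\alpha_1(\|x_1\|_{\mathcal A})\le V_1(x_1)\le\overline\alpha_1(\|x_1\|_{\mathcal A})$ on $\mathcal X_1$ and, for $\beta\in[0,\bar\beta]$, $\gamma\in(0,\bar\gamma]$, $\theta\in(0,\bar\theta]$ and $x_1\in\mathcal X_1$ with $\alpha_\gamma(\gamma)\le\|x_1\|_{\mathcal A}\le\Delta$: $\langle\nabla V_1(x_1),f\rangle\le-\hat\sigma(\tau)\hat\alpha_\gamma(\gamma)\alpha_1(\|x_1\|_{\mathcal A})$ for $f\in F_r(x_1)$, and, if $x_1\in D_1$, $V_1(g)-V_1(x_1)\le-\hat\alpha_\gamma(\gamma)\alpha_1(\|x_1\|_{\mathcal A})$ for $g\in G_r(x_1)$. 6. *(Invariance under jumps.)* $M_{\mathcal A}=\{(x_1,x_2):x_1\in\mathcal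 A,\ x_2\in H(x_1)\}$ satisfies $G(M_{\mathcal A}\cap D)\subseteq M_{\mathcal A}$ for all $(\beta,\gamma,\theta)\in[0,\bar\beta]\times[0,\bar\gamma]\times[0,\bar\theta]$. **Theorem.** Under assumptions 1–6 (no compactness of $\mathcal X_2'$ is assumed), $M_{\mathcal A}$ is SGPAS as $(\gamma,\tfrac1\tau,\varepsilon,\beta)\to0$ for $\mathcal H_1$. -/

import Mathlib

open Set Filter Topology MeasureTheory

namespace SingPert

noncomputable section

/-! ### Comparison functions -/

/-- Class `𝒦` on `[0, ∞)`: continuous, strictly increasing, zero at zero. -/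
structure IsClassK (α : ℝ → ℝ) : Prop where
  continuousOn : ContinuousOn α (Ici 0)
  strictMonoOn : StrictMonoOn α (Ici 0)
  map_zero : α 0 = 0

/-- Class `𝒦∞`: class `𝒦` and unbounded, so that the inverse is defined on all of `[0, ∞)`. -/
structure IsClassKInfty (α : ℝ → ℝ) : Prop extends IsClassK α where
  tendsto_atTop : Tendsto α atTop atTop

/-! ### Set-valued mappings -/

/-- `Φ` is outer semicontinuous relative to `S`. -/
def OuterSemicontOn {X Y : Type*} [TopologicalSpace X] [TopologicalSpace Y]
    (Φ : X → Set Y) (S : Set X) : Prop :=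
  ∀ x ∈ S, ∀ y : Y, ∀ (u : ℕ → X) (v : ℕ → Y), (∀ n, u n ∈ S ∧ v n ∈ Φ (u n)) →
    Tendsto u atTop (𝓝 x) → Tendsto v atTop (𝓝 y) → y ∈ Φ x

/-- `Φ` is locally bounded relative to `S`. -/
def LocallyBoundedOn {X Y : Type*} [TopologicalSpace X] [PseudoMetricSpace Y]
    (Φ : X → Set Y) (S : Set X) : Prop :=
  ∀ x ∈ S, ∃ U ∈ 𝓝 x, Bornology.IsBounded (⋃ x' ∈ U ∩ S, Φ x')

/-! ### Hybrid systems and their solutions -/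

/-- The data of a hybrid system: `ẋ ∈ flowMap x` on `flowSet`, `x⁺ ∈ jumpMap x` on `jumpSet`. -/
structure HybridSystem (E : Type*) where
  flowSet : Set E
  flowMap : E → Set E
  jumpSet : Set E
  jumpMap : E → Set E

/-- Compact hybrid time domain: `⋃_{j ≤ J} [t_j, t_{j+1}] × {j}` with `0 = t_0 ≤ t_1 ≤ ⋯`. -/
def IsCompactHybridTimeDomain (S : Set (ℝ × ℕ)) : Prop :=
  ∃ (J : ℕ) (t : ℕ → ℝ), t 0 = 0 ∧ Monotone t ∧
    S = {p | p.2 ≤ J ∧ t p.2 ≤ p.1 ∧ p.1 ≤ t (p.2 + 1)}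

/-- Hybrid time domain: every truncation at one of its points is a compact hybrid time domain. -/
def IsHybridTimeDomain (S : Set (ℝ × ℕ)) : Prop :=
  ∀ q ∈ S, IsCompactHybridTimeDomain (S ∩ {p | p.1 ≤ q.1 ∧ p.2 ≤ q.2})

section Hybrid

variable {E : Type*} [NormedAddCommGroup E] [NormedSpace ℝ E]

/-- `φ`, with domain `S`, is a solution of the hybrid system `ℋ`.
Values of `φ` outside `S` carry no meaning. -/
structure IsSolution (ℋ : HybridSystem E) (S : Set (ℝ × ℕ)) (φ : ℝ → ℕ → E) : Prop where
  isHybridTimeDomain : IsHybridTimeDomain S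
  zero_mem : ((0 : ℝ), 0) ∈ S
  init : φ 0 0 ∈ closure ℋ.flowSet ∪ ℋ.jumpSet
  absCont : ∀ (j : ℕ) (a b : ℝ), a ≤ b → (a, j) ∈ S → (b, j) ∈ S →
    AbsolutelyContinuousOnInterval (fun t => φ t j) a b
  flow_mem : ∀ (j : ℕ) (a b : ℝ), (a, j) ∈ S → (b, j) ∈ S →
    ∀ t ∈ Ioo a b, φ t j ∈ ℋ.flowSet
  flow : ∀ (j : ℕ) (a b : ℝ), (a, j) ∈ S → (b, j) ∈ S →
    ∀ᵐ t : ℝ, t ∈ Ioo a b → ∃ v ∈ ℋ.flowMap (φ t j), HasDerivAt (fun s => φ s j) v t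
  jump : ∀ (j : ℕ) (t : ℝ), (t, j) ∈ S → (t, j + 1) ∈ S →
    φ t j ∈ ℋ.jumpSet ∧ φ t (j + 1) ∈ ℋ.jumpMap (φ t j)

/-- A solution is maximal if it cannot be extended to a solution with a larger domain. -/
def IsMaximalSolution (ℋ : HybridSystem E) (S : Set (ℝ × ℕ)) (φ : ℝ → ℕ → E) : Prop :=
  IsSolution ℋ S φ ∧ ¬ ∃ (S' : Set (ℝ × ℕ)) (φ' : ℝ → ℕ → E),
    IsSolution ℋ S' φ' ∧ S ⊂ S' ∧ ∀ p ∈ S, φ' p.1 p.2 = φ p.1 p.2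

/-- Completeness of the solutions: every maximal solution has an unbounded domain. -/
def SolutionsComplete (ℋ : HybridSystem E) : Prop :=
  ∀ S φ, IsMaximalSolution ℋ S φ → ∀ M : ℝ, ∃ p ∈ S, M ≤ p.1 + (p.2 : ℝ)

/-- Semi-global stability of `A`, down to the radius `δ`. -/
def SemiGlobalStable (δ : ℝ) (ℋ : HybridSystem E) (A : Set E) : Prop :=
  ∀ R, δ ≤ R → ∃ r > 0, ∀ S φ, IsSolution ℋ S φ →
    ∀ p ∈ S, ∀ q ∈ S, p.1 + (p.2 : ℝ) ≤ q.1 + (q.2 : ℝ) →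
      Metric.infDist (φ p.1 p.2) A ≤ r → Metric.infDist (φ q.1 q.2) A ≤ R

/-- Practical attractivity of `A`, from the radius `Δ` down to the radius `δ`. -/
def PracticallyAttractive (δ Δ : ℝ) (ℋ : HybridSystem E) (A : Set E) : Prop :=
  ∀ R r, R ≤ Δ → r ≤ R → δ ≤ r → ∃ T : ℝ, 0 ≤ T ∧ ∀ S φ, IsSolution ℋ S φ →
    ∀ p ∈ S, ∀ q ∈ S, T + (p.1 + (p.2 : ℝ)) ≤ q.1 + (q.2 : ℝ) →
      Metric.infDist (φ p.1 p.2) A ≤ R → Metric.infDist (φ q.1 q.2) A ≤ r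

end Hybrid

/-- `∃ ε₁* > 0, ∀ ε₁ ∈ (0, ε₁*), ∃ ε₂* > 0, ∀ ε₂ ∈ (0, ε₂*), …, P (ε₁, …, ε_k)`. -/
def SuccessivelySmall : (k : ℕ) → ((Fin k → ℝ) → Prop) → Prop
  | 0, P => P Fin.elim0
  | k + 1, P => ∃ e > 0, ∀ x, 0 < x → x < e →
      SuccessivelySmall k (fun p => P (Fin.cons x p))

/-- `A` is semi-globally practically asymptotically stable as `(ε₁, …, ε_k) → 0` for the
parametrized hybrid system `ℋ`. -/
def SGPAS {E : Type*} [NormedAddCommGroup E] [NormedSpace ℝ E] (k : ℕ)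
    (ℋ : (Fin k → ℝ) → HybridSystem E) (A : Set E) : Prop :=
  ∀ δ Δ, 0 < δ → δ < Δ → SuccessivelySmall k
    (fun p => SemiGlobalStable δ (ℋ p) A ∧ PracticallyAttractive δ Δ (ℋ p) A)

/-! ### The singularly perturbed system -/

/-- The space `ℝⁿ` of slow states. -/
abbrev Slow (n : ℕ) : Type := EuclideanSpace ℝ (Fin n)

/-- The space of fast states `x₂ = (x₂', x₂'')`, with the Euclidean norm. -/
abbrev Fast (m l : ℕ) : Type := WithLp 2 (EuclideanSpace ℝ (Fin m) × EuclideanSpace ℝ (Fin l))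

/-- The space of states `x = (x₁, x₂)`, with the Euclidean norm. -/
abbrev State (n m l : ℕ) : Type := WithLp 2 (Slow n × Fast m l)

/-- The pair `(x₁, x₂')` of the slow state and the bounded part of the fast state. -/
def boundedPart {n m l : ℕ} (x : State n m l) : Slow n × EuclideanSpace ℝ (Fin m) :=
  (x.fst, x.snd.fst)

/-- Data of the parametrized system. The maps depend on `β`, `γ` and `θ = 1 / τ`, in this order.
The jump map is given in the decomposed form `G x = G₁ (x₁, x₂') × G₂' x`. -/
structure SPSystem (n m l : ℕ) where
  X₁ : Set (Slow n)
  X₂' : Set (EuclideanSpace ℝ (Fin m))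
  X₂'' : Set (EuclideanSpace ℝ (Fin l))
  D₁ : Set (Slow n)
  D₂ : Set (Fast m l)
  F : ℝ → ℝ → ℝ → State n m l → Set (State n m l)
  G₁ : ℝ → ℝ → ℝ → Slow n × EuclideanSpace ℝ (Fin m) →
    Set (Slow n × EuclideanSpace ℝ (Fin m))
  G₂' : ℝ → ℝ → ℝ → State n m l → Set (EuclideanSpace ℝ (Fin l))

namespace SPSystem

variable {n m l : ℕ} (Sys : SPSystem n m l)

/-- `X₂ = X₂' × X₂''`. -/
def X₂ : Set (Fast m l) := {x₂ | x₂.fst ∈ Sys.X₂' ∧ x₂.snd ∈ Sys.X₂''}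

/-- The flow set `X₁ × X₂`. -/
def C : Set (State n m l) := {x | x.fst ∈ Sys.X₁ ∧ x.snd ∈ Sys.X₂}

/-- The jump set `D₁ × D₂`. -/
def D : Set (State n m l) := {x | x.fst ∈ Sys.D₁ ∧ x.snd ∈ Sys.D₂}

/-- The projection of the jump set to the components `(x₁, x₂')`. -/
def D' : Set (Slow n × EuclideanSpace ℝ (Fin m)) := boundedPart '' Sys.D

/-- The jump map `G x = G₁ (x₁, x₂') × G₂' x`. -/
def G (β γ θ : ℝ) (x : State n m l) : Set (State n m l) :=
  {g | boundedPart g ∈ Sys.G₁ β γ θ (boundedPart x) ∧ g.snd.snd ∈ Sys.G₂' β γ θ x}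

/-- The system `ℋ₁`: flow map `diag(I, ε⁻¹ I) F`, jump map `G`. -/
def full (β γ θ ε : ℝ) : HybridSystem (State n m l) where
  flowSet := Sys.C
  flowMap x := {v | ∃ f ∈ Sys.F β γ θ x, v = WithLp.toLp 2 (f.fst, ε⁻¹ • f.snd)}
  jumpSet := Sys.D
  jumpMap := Sys.G β γ θ

/-- The equilibria of the fast dynamics: `{x₂ ∈ X₂ | 0 ∈ F₂ (x₁, x₂)}`. -/
def equilibria (β γ θ : ℝ) (x₁ : Slow n) : Set (Fast m l) :=
  {x₂ | x₂ ∈ Sys.X₂ ∧ ∃ f ∈ Sys.F β γ θ (WithLp.toLp 2 (x₁, x₂)), f.snd = 0}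

/-- `H x₁ = H₁ x₁ × X₂''`. -/
def H (H₁ : Slow n → Set (EuclideanSpace ℝ (Fin m))) (x₁ : Slow n) : Set (Fast m l) :=
  {x₂ | x₂.fst ∈ H₁ x₁ ∧ x₂.snd ∈ Sys.X₂''}

variable (A : Set (Slow n)) (H₁ : Slow n → Set (EuclideanSpace ℝ (Fin m)))

/-- The set `(A + ρ𝔹) ∩ X₁`, for a compact set `A`. -/
def tube (ρ : ℝ) : Set (Slow n) := {x₁ | x₁ ∈ Sys.X₁ ∧ Metric.infDist x₁ A ≤ ρ}

/-- The boundary layer manifold `M_ρ`. -/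
def manifold (ρ : ℝ) : Set (State n m l) :=
  {x | x.fst ∈ Sys.tube A ρ ∧ x.snd ∈ Sys.H H₁ x.fst}

/-- The restricted attractor `M_A = {(x₁, x₂) | x₁ ∈ A, x₂ ∈ H x₁}`. -/
def attractor : Set (State n m l) := {x | x.fst ∈ A ∧ x.snd ∈ Sys.H H₁ x.fst}

/-- The boundary layer system: `x₁` is frozen in `(A + ρ𝔹) ∩ X₁`, and there are no jumps. -/
def boundaryLayer (ρ β γ θ : ℝ) : HybridSystem (State n m l) where
  flowSet := {x | x.fst ∈ Sys.tube A ρ ∧ x.snd ∈ Sys.X₂}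
  flowMap x := {v | ∃ f ∈ Sys.F β γ θ x, v = WithLp.toLp 2 (0, f.snd)}
  jumpSet := ∅
  jumpMap _ := ∅

/-- The reduced flow map: closed convex hull of `{f₁ | (f₁, f₂) ∈ F (x₁, x₂), x₂ ∈ H x₁}`. -/
def Fr (β γ θ : ℝ) (x₁ : Slow n) : Set (Slow n) :=
  closedConvexHull ℝ {f₁ | ∃ x₂ ∈ Sys.H H₁ x₁,
    ∃ f ∈ Sys.F β γ θ (WithLp.toLp 2 (x₁, x₂)), f₁ = f.fst}

/-- The reduced jump map `{g₁ | (g₁, g₂) ∈ G (x₁, x₂), x₂ ∈ H x₁}`; the map `G` is evaluated on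
its domain `D₁ × D₂` only. -/
def Gr (β γ θ : ℝ) (x₁ : Slow n) : Set (Slow n) :=
  {g₁ | ∃ x₂ ∈ Sys.H H₁ x₁, WithLp.toLp 2 (x₁, x₂) ∈ Sys.D ∧
    ∃ g ∈ Sys.G β γ θ (WithLp.toLp 2 (x₁, x₂)), g₁ = g.fst}

/-- The reduced system. -/
def reduced (β γ θ : ℝ) : HybridSystem (Slow n) where
  flowSet := Sys.X₁
  flowMap := Sys.Fr H₁ β γ θ
  jumpSet := Sys.D₁
  jumpMap := Sys.Gr H₁ β γ θ

/-- The slow velocities at `(x₁, x₂')`, for all values of `x₂''`, as a mapping of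
`(β, (x₁, x₂'))`. -/
def slowVelocities (γ θ : ℝ) (p : ℝ × (Slow n × EuclideanSpace ℝ (Fin m))) : Set (Slow n) :=
  {f₁ | ∃ x : State n m l, x ∈ Sys.C ∧ boundedPart x = p.2 ∧ ∃ f ∈ Sys.F p.1 γ θ x, f₁ = f.fst}

/-! ### The standing assumptions -/

/-- Basic regularity of the hybrid system for all parameters in the given box, for the jump map
also at the limit values `0` of the parameters; completeness of the solutions. The last three
fields are the regularity in the parameters: it is joint with the state, includes the limit values,
and concerns the components `(x₁, x₂')` only, with no restriction on how `x₂''` moves. -/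
structure BasicAssumptions (β₀ γ₀ θ₀ : ℝ) : Prop where
  isClosed_flowSet : IsClosed Sys.C
  isClosed_jumpSet : IsClosed Sys.D
  D₁_subset : Sys.D₁ ⊆ Sys.X₁
  D₂_subset : Sys.D₂ ⊆ Sys.X₂
  flowMap : ∀ β ∈ Ioc 0 β₀, ∀ γ ∈ Ioc 0 γ₀, ∀ θ ∈ Ioc 0 θ₀,
    OuterSemicontOn (Sys.F β γ θ) Sys.C ∧ LocallyBoundedOn (Sys.F β γ θ) Sys.C ∧
      ∀ x ∈ Sys.C, (Sys.F β γ θ x).Nonempty ∧ Convex ℝ (Sys.F β γ θ x)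
  jumpMap : ∀ β ∈ Icc 0 β₀, ∀ γ ∈ Icc 0 γ₀, ∀ θ ∈ Icc 0 θ₀,
    OuterSemicontOn (Sys.G β γ θ) Sys.D ∧ LocallyBoundedOn (Sys.G β γ θ) Sys.D ∧
      ∀ x ∈ Sys.D, (Sys.G β γ θ x).Nonempty ∧ Sys.G β γ θ x ⊆ Sys.C
  complete : ∀ β ∈ Ioc 0 β₀, ∀ γ ∈ Ioc 0 γ₀, ∀ θ ∈ Ioc 0 θ₀, ∀ ε > 0,
    SolutionsComplete (Sys.full β γ θ ε)
  slowVelocities_regular : ∀ γ ∈ Ioc 0 γ₀, ∀ θ ∈ Ioc 0 θ₀,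
    OuterSemicontOn (Sys.slowVelocities γ θ) (Icc 0 β₀ ×ˢ (Sys.X₁ ×ˢ Sys.X₂')) ∧
    LocallyBoundedOn (Sys.slowVelocities γ θ) (Icc 0 β₀ ×ˢ (Sys.X₁ ×ˢ Sys.X₂'))
  isClosed_D' : IsClosed Sys.D'
  G₁_regular :
    OuterSemicontOn (fun p : (ℝ × ℝ × ℝ) × (Slow n × EuclideanSpace ℝ (Fin m)) =>
      Sys.G₁ p.1.1 p.1.2.1 p.1.2.2 p.2) ((Icc 0 β₀ ×ˢ (Icc 0 γ₀ ×ˢ Icc 0 θ₀)) ×ˢ Sys.D') ∧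
    LocallyBoundedOn (fun p : (ℝ × ℝ × ℝ) × (Slow n × EuclideanSpace ℝ (Fin m)) =>
      Sys.G₁ p.1.1 p.1.2.1 p.1.2.2 p.2) ((Icc 0 β₀ ×ˢ (Icc 0 γ₀ ×ˢ Icc 0 θ₀)) ×ˢ Sys.D')

/-- The steady-state mapping: the fast equilibria at `x₁ ∈ X₁` form the set
`H x₁ = H₁ x₁ × X₂''`, a non-empty subset of `X₂`, and `H₁` is outer semicontinuous and locally
bounded on `X₁`. -/
structure SteadyStateAssumptions (β₀ γ₀ θ₀ : ℝ) : Prop where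
  equilibria_eq : ∀ β ∈ Ioc 0 β₀, ∀ γ ∈ Ioc 0 γ₀, ∀ θ ∈ Ioc 0 θ₀, ∀ x₁ ∈ Sys.X₁,
    Sys.equilibria β γ θ x₁ = Sys.H H₁ x₁
  nonempty : ∀ x₁ ∈ Sys.X₁, (Sys.H H₁ x₁).Nonempty
  subset : ∀ x₁ ∈ Sys.X₁, Sys.H H₁ x₁ ⊆ Sys.X₂
  outerSemicont : OuterSemicontOn H₁ Sys.X₁
  locallyBounded : LocallyBoundedOn H₁ Sys.X₁

/-- For every `ρ > 0` the manifold `M_ρ` is SGPAS as `β → 0` for the boundary layer system, and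
for every `Δ > 0` there is a Lyapunov function on the points of the flow set at distance at most `Δ`
from `M_ρ`. -/
def BoundaryLayerAssumption (β₀ γ₀ θ₀ : ℝ) : Prop :=
  ∀ ρ > 0,
    (∀ γ ∈ Ioc 0 γ₀, ∀ θ ∈ Ioc 0 θ₀,
      SGPAS 1 (fun p => Sys.boundaryLayer A ρ (p 0) γ θ) (Sys.manifold A H₁ ρ)) ∧
    ∃ (αlo αup αβhat : ℝ → ℝ), IsClassKInfty αlo ∧ IsClassK αup ∧ IsClassK αβhat ∧
      ∀ Δ > 0, ∃ (V : State n m l → ℝ) (α αβ : ℝ → ℝ),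
        ContDiff ℝ 1 V ∧ IsClassK α ∧ IsClassK αβ ∧
        (∀ x : State n m l, x.fst ∈ Sys.tube A ρ → x.snd ∈ Sys.X₂ →
          αlo (Metric.infDist x (Sys.manifold A H₁ ρ)) ≤ V x ∧
          V x ≤ αup (Metric.infDist x (Sys.manifold A H₁ ρ))) ∧
        (∀ β ∈ Ioc 0 β₀, ∀ γ ∈ Ioc 0 γ₀, ∀ θ ∈ Ioc 0 θ₀,
          ∀ x : State n m l, x.fst ∈ Sys.tube A ρ → x.snd ∈ Sys.X₂ →
          Metric.infDist x (Sys.manifold A H₁ ρ) ≤ Δ → ∀ f ∈ Sys.F β γ θ x,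
          (αβ β ≤ Metric.infDist x (Sys.manifold A H₁ ρ) →
            inner ℝ (gradient V x) (WithLp.toLp 2 (0, f.snd))
              ≤ -α (Metric.infDist x (Sys.manifold A H₁ ρ))) ∧
          (Metric.infDist x (Sys.manifold A H₁ ρ) ≤ αβ β →
            inner ℝ (gradient V x) (WithLp.toLp 2 (0, f.snd)) ≤ αβhat β)) ∧
        (∀ x ∈ Sys.manifold A H₁ ρ, gradient V x = 0) ∧
        (∀ K : Set (Slow n × EuclideanSpace ℝ (Fin m)), IsCompact K →
          K ⊆ Sys.tube A ρ ×ˢ Sys.X₂' → ∃ M > 0, ∀ x : State n m l, boundedPart x ∈ K →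
            x.snd.snd ∈ Sys.X₂'' → |V x| + ‖(gradient V x).fst‖ ≤ M)

/-- The set `A` is SGPAS as `γ → 0` for the reduced system, and for every `Δ > 0` there is a
Lyapunov function on the points at distance at most `Δ` from `A`. The inequalities include the
limit value `β = 0`. -/
def ReducedAssumption (β₀ γ₀ θ₀ : ℝ) : Prop :=
  (∀ β ∈ Ioc 0 β₀, ∀ θ ∈ Ioc 0 θ₀, SGPAS 1 (fun p => Sys.reduced H₁ β (p 0) θ) A) ∧
  ∃ (αlo αup αγhat σhat : ℝ → ℝ), IsClassKInfty αlo ∧ IsClassK αup ∧ IsClassK αγhat ∧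
    (∀ τ > 0, 0 < σhat τ) ∧
    ∀ Δ > 0, ∃ (V : Slow n → ℝ) (α αγ : ℝ → ℝ),
      ContDiff ℝ 1 V ∧ IsClassK α ∧ IsClassK αγ ∧
      (∀ x₁ ∈ Sys.X₁, αlo (Metric.infDist x₁ A) ≤ V x₁ ∧ V x₁ ≤ αup (Metric.infDist x₁ A)) ∧
      ∀ β ∈ Icc 0 β₀, ∀ γ ∈ Ioc 0 γ₀, ∀ θ ∈ Ioc 0 θ₀,
        ∀ x₁ ∈ Sys.X₁, αγ γ ≤ Metric.infDist x₁ A → Metric.infDist x₁ A ≤ Δ →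
          (∀ f₁ ∈ Sys.Fr H₁ β γ θ x₁,
            inner ℝ (gradient V x₁) f₁ ≤ -(σhat θ⁻¹ * αγhat γ * α (Metric.infDist x₁ A))) ∧
          (x₁ ∈ Sys.D₁ → ∀ g₁ ∈ Sys.Gr H₁ β γ θ x₁,
            V g₁ - V x₁ ≤ -(αγhat γ * α (Metric.infDist x₁ A)))

/-- The `s`-irregular jumps of a hybrid arc with domain `S`: the levels `j` at which a jump from
level `j` to level `j + 1` occurs after an interval of flow shorter than `s`. -/
def irregularJumps (S : Set (ℝ × ℕ)) (s : ℝ) : Set ℕ :=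
  {j | (∃ t, (t, j) ∈ S ∧ (t, j + 1) ∈ S) ∧
    sSup {d | ∃ t t', (t, j) ∈ S ∧ (t', j) ∈ S ∧ d = |t - t'|} < s}

/-- Almost all jumps are `σ(τ)`-regular: for initial conditions within `Δ` of `A × X₂` there are at
most `N` irregular jumps, all of them up to a time `T`, which may depend on the parameters. -/
def JumpRegularityAssumption (β₀ γ₀ θ₀ : ℝ) : Prop :=
  ∃ σ : ℝ → ℝ, (∀ τ > 0, 0 < σ τ) ∧ ∀ Δ > 0, ∃ N : ℕ,
    ∀ β ∈ Ioc 0 β₀, ∀ γ ∈ Ioc 0 γ₀, ∀ θ ∈ Ioc 0 θ₀, ∀ ε > 0, ∃ T : ℝ,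
      ∀ S φ, IsSolution (Sys.full β γ θ ε) S φ →
        Metric.infDist (φ 0 0) {x : State n m l | x.fst ∈ A ∧ x.snd ∈ Sys.X₂} ≤ Δ →
        (irregularJumps S (σ θ⁻¹)).encard ≤ N ∧
        ∀ j ∈ irregularJumps S (σ θ⁻¹), ∀ t, (t, j) ∈ S → t ≤ T

/-- The jumps keep the restricted attractor invariant: `G(M_A) ⊆ M_A`. -/
def JumpInvarianceAssumption (β₀ γ₀ θ₀ : ℝ) : Prop :=
  ∀ β ∈ Icc 0 β₀, ∀ γ ∈ Icc 0 γ₀, ∀ θ ∈ Icc 0 θ₀,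
    ∀ x ∈ Sys.attractor A H₁ ∩ Sys.D, Sys.G β γ θ x ⊆ Sys.attractor A H₁

end SPSystem

end

end SingPert

open SingPert

/-! Split a solution at its short levels, the intervals of flow shorter than `σ(τ)` that are
followed by a jump. On an arc without short levels two Lyapunov functions act on two time scales.
For small `ε` the fast function `V₂` decreases so quickly that `x₂` settles near the steady states
within a time `κ ≤ σ(τ)`. From then on, for small `β` and by outer semicontinuity, the slow function
`V₁` decreases as along the reduced system. Its decrease at a jump does not vanish with `ε`, hence
outweighs its increase of at most `O(κ)` during the transient that the jump causes.

A solution has a bounded number of short levels, so the bounds on its arcs can be chained. The jumps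
in between map bounded sets to bounded sets, and points near `M_𝒜` to points near `M_𝒜`, since
`G(M_𝒜) ⊆ M_𝒜` and `G` is outer semicontinuous up to the limit values of the parameters. As the
regularity of the data is uniform in `x₂''`, compactness is needed in `(x₁, x₂')` only, where it
follows from the local boundedness of `H₁`. -/

namespace SingPert

/-! ### Absolutely continuous functions -/

section AbsolutelyContinuous

variable {X Y : Type*} [PseudoMetricSpace X] [PseudoMetricSpace Y] {a b c d : ℝ}

theorem absolutelyContinuousOnInterval_of_le_of_le {x : ℝ → X}
    (hx : AbsolutelyContinuousOnInterval x a b) (hac : a ≤ c) (hcd : c ≤ d) (hdb : d ≤ b) :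
    AbsolutelyContinuousOnInterval x c d :=
  hx.mono <| uIcc_subset_uIcc (mem_uIcc_of_le hac (hcd.trans hdb))
    (mem_uIcc_of_le (hac.trans hcd) hdb)

theorem absolutelyContinuousOnInterval_congr {x y : ℝ → X}
    (hx : AbsolutelyContinuousOnInterval x a b) (hxy : EqOn x y (uIcc a b)) :
    AbsolutelyContinuousOnInterval y a b := by
  rw [absolutelyContinuousOnInterval_iff] at hx ⊢
  intro ε hε
  obtain ⟨δ, hδ, h⟩ := hx ε hε
  refine ⟨δ, hδ, fun I hI hlt => ?_⟩
  have := h I hI hlt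
  rwa [Finset.sum_congr rfl fun i hi => by rw [hxy (hI.1 i hi).1, hxy (hI.1 i hi).2]] at this

theorem absolutelyContinuousOnInterval_comp_add_right {x : ℝ → X}
    (hx : AbsolutelyContinuousOnInterval x (a + c) (b + c)) :
    AbsolutelyContinuousOnInterval (fun t => x (t + c)) a b := by
  rw [absolutelyContinuousOnInterval_iff] at hx ⊢
  intro ε hε
  obtain ⟨δ, hδ, h⟩ := hx ε hε
  refine ⟨δ, hδ, fun I hI hlt =>
    h (I.1, fun i => ((I.2 i).1 + c, (I.2 i).2 + c)) ⟨fun i hi => ?_, fun i hi k hk hik => ?_⟩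
      (by simpa only [dist_add_right] using hlt)⟩
  · simpa only [mem_uIcc, add_le_add_iff_right] using hI.1 i hi
  · have hdisj : Disjoint (uIoc (I.2 i).1 (I.2 i).2) (uIoc (I.2 k).1 (I.2 k).2) :=
      hI.2 hi hk hik
    rw [disjoint_left] at hdisj
    rw [Function.onFun, disjoint_left]
    intro r hri hrk
    refine hdisj (a := r - c) ?_ ?_
    · simpa only [mem_uIoc, lt_sub_iff_add_lt, sub_le_iff_le_add] using hri
    · simpa only [mem_uIoc, lt_sub_iff_add_lt, sub_le_iff_le_add] using hrk

theorem absolutelyContinuousOnInterval_comp_lipschitzOnWith {f : X → Y} {K : NNReal} {s : Set X}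
    {x : ℝ → X} (hf : LipschitzOnWith K f s) (hx : AbsolutelyContinuousOnInterval x a b)
    (hs : ∀ t ∈ uIcc a b, x t ∈ s) : AbsolutelyContinuousOnInterval (fun t => f (x t)) a b := by
  open AbsolutelyContinuousOnInterval in
  have hlim : Tendsto (fun I : ℕ × (ℕ → ℝ × ℝ) =>
      (K : ℝ) * ∑ i ∈ Finset.range I.1, dist (x (I.2 i).1) (x (I.2 i).2))
      (totalLengthFilter ⊓ 𝓟 (disjWithin a b)) (𝓝 0) := by
    simpa only [mul_zero] using Tendsto.const_mul (K : ℝ) hx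
  refine squeeze_zero' (Eventually.of_forall fun I => Finset.sum_nonneg fun i _ => dist_nonneg)
    (eventually_inf_principal.2 <| Eventually.of_forall fun I hI => ?_) hlim
  rw [Finset.mul_sum]
  exact Finset.sum_le_sum fun i hi =>
    hf.dist_le_mul _ (hs _ (hI.1 i hi).1) _ (hs _ (hI.1 i hi).2)

theorem absolutelyContinuousOnInterval_comp_contDiff {E F : Type*} [NormedAddCommGroup E]
    [NormedSpace ℝ E] [NormedAddCommGroup F] [NormedSpace ℝ F] {V : E → F} (hV : ContDiff ℝ 1 V)
    {x : ℝ → E} (hx : AbsolutelyContinuousOnInterval x a b) :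
    AbsolutelyContinuousOnInterval (fun t => V (x t)) a b := by
  obtain ⟨K, hK⟩ := LocallyLipschitzOn.exists_lipschitzOnWith_of_compact
    (isCompact_uIcc.image_of_continuousOn hx.continuousOn) hV.locallyLipschitz.locallyLipschitzOn
  exact absolutelyContinuousOnInterval_comp_lipschitzOnWith hK hx fun t => mem_image_of_mem x

end AbsolutelyContinuous

/-! ### Differential inequalities -/

section DifferentialInequalities

variable {v : ℝ → ℝ} {a b c ℓ : ℝ}

theorem sub_le_mul_of_ae_hasDerivAt_le (hab : a ≤ b) (hv : AbsolutelyContinuousOnInterval v a b)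
    (h : ∀ᵐ t : ℝ, t ∈ Ioo a b → ∃ d, HasDerivAt v d t ∧ d ≤ c) : v b - v a ≤ c * (b - a) := by
  have hmono : ∫ t in a..b, deriv v t ≤ ∫ _ in a..b, c := by
    refine intervalIntegral.integral_mono_ae_restrict hab hv.intervalIntegrable_deriv
      intervalIntegrable_const ?_
    rw [EventuallyLE, ← Measure.restrict_congr_set Ioo_ae_eq_Icc,
      ae_restrict_iff' measurableSet_Ioo]
    filter_upwards [h] with t ht hmem
    obtain ⟨d, hd, hdc⟩ := ht hmem
    exact hd.deriv.trans_le hdc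
  rw [← hv.integral_deriv_eq_sub]
  simpa only [intervalIntegral.integral_const, smul_eq_mul, mul_comm] using hmono

theorem le_max_of_ae_decreasing_above (hab : a ≤ b) (hc : 0 ≤ c)
    (hv : AbsolutelyContinuousOnInterval v a b)
    (h : ∀ᵐ t : ℝ, t ∈ Ioo a b → ℓ < v t → ∃ d, HasDerivAt v d t ∧ d ≤ -c) :
    v b ≤ max (v a - c * (b - a)) ℓ := by
  have hcont : ContinuousOn v (Icc a b) := uIcc_of_le hab ▸ hv.continuousOn
  by_cases hne : ∃ t ∈ Icc a b, v t ≤ ℓ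
  · have hcpt : IsCompact (Icc a b ∩ v ⁻¹' Iic ℓ) := isCompact_Icc.of_isClosed_subset
      (hcont.preimage_isClosed_of_isClosed isClosed_Icc isClosed_Iic) inter_subset_left
    obtain ⟨s, ⟨hs, hsℓ⟩, hmax⟩ := hcpt.exists_isGreatest hne
    have habove : ∀ t ∈ Ioo s b, ℓ < v t := fun t ht => by
      by_contra! hle
      exact (hmax ⟨⟨hs.1.trans ht.1.le, ht.2.le⟩, hle⟩).not_gt ht.1
    have hsub : v b - v s ≤ -c * (b - s) := sub_le_mul_of_ae_hasDerivAt_le hs.2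
      (absolutelyContinuousOnInterval_of_le_of_le hv hs.1 hs.2 le_rfl) <| by
        filter_upwards [h] with t ht hmem
        exact ht ⟨hs.1.trans_lt hmem.1, hmem.2⟩ (habove t hmem)
    have hdec : 0 ≤ c * (b - s) := mul_nonneg hc (sub_nonneg.2 hs.2)
    have hvs : v s ≤ ℓ := hsℓ
    exact le_max_of_le_right (by linarith)
  · push Not at hne
    have hsub : v b - v a ≤ -c * (b - a) := sub_le_mul_of_ae_hasDerivAt_le hab hv <| by
      filter_upwards [h] with t ht hmem
      exact ht hmem (hne t (Ioo_subset_Icc_self hmem))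
    exact le_max_of_le_left (by linarith)

theorem neg_of_neg_of_nonpos_before {f : ℝ → ℝ} (hf : ContinuousOn f (Icc a b)) (ha : f a < 0)
    (h : ∀ t ∈ Icc a b, (∀ s ∈ Icc a t, f s ≤ 0) → f t < 0) : ∀ t ∈ Icc a b, f t < 0 := by
  by_contra! ⟨t, ht, hft⟩
  have hzero : ∀ r ∈ Icc a b, 0 ≤ f r → ∃ s ∈ Icc a r, f s = 0 := fun r hr hfr =>
    intermediate_value_Icc hr.1 (hf.mono (Icc_subset_Icc_right hr.2)) ⟨ha.le, hfr⟩
  have hcpt : IsCompact (Icc a b ∩ f ⁻¹' {0}) := isCompact_Icc.of_isClosed_subset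
    (hf.preimage_isClosed_of_isClosed isClosed_Icc isClosed_singleton) inter_subset_left
  obtain ⟨s₀, hs₀, hfs₀⟩ := hzero t ht hft
  obtain ⟨s, ⟨hs, hfs⟩, hmin⟩ := hcpt.exists_isLeast ⟨s₀, ⟨hs₀.1, hs₀.2.trans ht.2⟩, hfs₀⟩
  refine (h s hs fun r hr => ?_).ne hfs
  by_contra! hpos
  obtain ⟨q, hq, hfq⟩ := hzero r ⟨hr.1, hr.2.trans hs.2⟩ hpos.le
  have hrs : r = s := hr.2.antisymm <| (hmin ⟨⟨hq.1, hq.2.trans (hr.2.trans hs.2)⟩, hfq⟩).trans hq.2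
  exact hpos.ne' (hrs ▸ hfs)

end DifferentialInequalities

/-! ### Two time scales -/

/-- Constants for a slow variable `v₁` and a fast variable `v₂` that start below `b₁` and `b₂`.
In the region `v₁ ≤ b₁ + ν`, `v₂ ≤ W` the variable `v₂` decreases at rate `c₂` above the level `ℓ₂`,
so that it falls below `ℓ₂` within time `κ`; `v₁` grows at rate at most `L`, and decreases at
rate `c` above the level `ℓ₁` once `v₂ ≤ ℓ₂`. The slack `ν` exceeds `(c + L) κ`, which is the most
that `v₁` can lose on the nominal decrease while `v₂` settles. -/
structure TwoScaleBounds where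
  (L c c₂ κ ℓ₁ ℓ₂ b₁ ν b₂ W : ℝ)
  L_nonneg : 0 ≤ L
  c_nonneg : 0 ≤ c
  c₂_nonneg : 0 ≤ c₂
  κ_nonneg : 0 ≤ κ
  delay_lt : (c + L) * κ < ν
  ℓ₁_le : ℓ₁ ≤ b₁
  ℓ₂_le : ℓ₂ ≤ b₂
  b₂_lt : b₂ < W
  settle : b₂ - c₂ * κ ≤ ℓ₂

namespace TwoScaleBounds

/-- The differential inequalities of the slow variable `v₁` and the fast variable `v₂` at time
`t`. -/
def DecayAt (P : TwoScaleBounds) (v₁ v₂ : ℝ → ℝ) (t : ℝ) : Prop :=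
  ∃ d₁ d₂, HasDerivAt v₁ d₁ t ∧ HasDerivAt v₂ d₂ t ∧ d₁ ≤ P.L ∧ (P.ℓ₂ < v₂ t → d₂ ≤ -P.c₂) ∧
    (v₂ t ≤ P.ℓ₂ → P.ℓ₁ < v₁ t → d₁ ≤ -P.c)

variable (P : TwoScaleBounds) {v₁ v₂ : ℝ → ℝ} {a b w : ℝ}

theorem delay_nonneg : 0 ≤ (P.c + P.L) * P.κ :=
  mul_nonneg (add_nonneg P.c_nonneg P.L_nonneg) P.κ_nonneg

theorem fast_le_max (hab : a ≤ b) (h₂ : AbsolutelyContinuousOnInterval v₂ a b)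
    (hv₂ : v₂ a ≤ P.b₂) (h : ∀ᵐ t : ℝ, t ∈ Ioo a b → P.DecayAt v₁ v₂ t) :
    v₂ b ≤ max (P.b₂ - P.c₂ * (b - a)) P.ℓ₂ := by
  refine (le_max_of_ae_decreasing_above (ℓ := P.ℓ₂) hab P.c₂_nonneg h₂ ?_).trans
    (max_le_max_right _ (sub_le_sub_right hv₂ _))
  filter_upwards [h] with t ht hmem hlt
  obtain ⟨_, d₂, -, hd₂, -, hfast, -⟩ := ht hmem
  exact ⟨d₂, hd₂, hfast hlt⟩

theorem fast_le (hab : a ≤ b) (h₂ : AbsolutelyContinuousOnInterval v₂ a b) (hv₂ : v₂ a ≤ P.b₂)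
    (h : ∀ᵐ t : ℝ, t ∈ Ioo a b → P.DecayAt v₁ v₂ t) : v₂ b ≤ P.b₂ :=
  (P.fast_le_max hab h₂ hv₂ h).trans <|
    max_le (sub_le_self _ (mul_nonneg P.c₂_nonneg (sub_nonneg.2 hab))) P.ℓ₂_le

theorem fast_le_level (hab : a + P.κ ≤ b) (h₂ : AbsolutelyContinuousOnInterval v₂ a b)
    (hv₂ : v₂ a ≤ P.b₂) (h : ∀ᵐ t : ℝ, t ∈ Ioo a b → P.DecayAt v₁ v₂ t) : v₂ b ≤ P.ℓ₂ := by
  have hsettled : P.c₂ * P.κ ≤ P.c₂ * (b - a) :=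
    mul_le_mul_of_nonneg_left (by linarith) P.c₂_nonneg
  exact (P.fast_le_max (by linarith [P.κ_nonneg]) h₂ hv₂ h).trans
    (max_le (by linarith [P.settle]) le_rfl)

theorem slow_le_add (hab : a ≤ b) (h₁ : AbsolutelyContinuousOnInterval v₁ a b)
    (hv₁ : v₁ a ≤ w) (h : ∀ᵐ t : ℝ, t ∈ Ioo a b → P.DecayAt v₁ v₂ t) :
    v₁ b ≤ w + P.L * (b - a) := by
  have hsub : v₁ b - v₁ a ≤ P.L * (b - a) := sub_le_mul_of_ae_hasDerivAt_le hab h₁ <| by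
    filter_upwards [h] with t ht hmem
    obtain ⟨d₁, _, hd₁, -, hL, -, -⟩ := ht hmem
    exact ⟨d₁, hd₁, hL⟩
  linarith

theorem slow_le_max (hab : a ≤ b) (h₁ : AbsolutelyContinuousOnInterval v₁ a b)
    (h₂ : AbsolutelyContinuousOnInterval v₂ a b) (hv₁ : v₁ a ≤ w) (hv₂ : v₂ a ≤ P.b₂)
    (h : ∀ᵐ t : ℝ, t ∈ Ioo a b → P.DecayAt v₁ v₂ t) :
    v₁ b ≤ max (w - P.c * (b - a)) P.ℓ₁ + (P.c + P.L) * P.κ := by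
  have hκ := P.κ_nonneg
  rcases le_total b (a + P.κ) with hbκ | hκb
  · have hgrow := P.slow_le_add (v₂ := v₂) hab h₁ hv₁ h
    have hrate : (P.c + P.L) * (b - a) ≤ (P.c + P.L) * P.κ :=
      mul_le_mul_of_nonneg_left (by linarith) (add_nonneg P.c_nonneg P.L_nonneg)
    linarith [le_max_left (w - P.c * (b - a)) P.ℓ₁]
  · have haκ : a ≤ a + P.κ := by linarith
    have hgrow : v₁ (a + P.κ) ≤ w + P.L * (a + P.κ - a) := by
      refine P.slow_le_add (v₂ := v₂) haκ
        (absolutelyContinuousOnInterval_of_le_of_le h₁ le_rfl haκ hκb) hv₁ ?_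
      filter_upwards [h] with t ht hmem using ht ⟨hmem.1, hmem.2.trans_le hκb⟩
    have hsettled : ∀ t ∈ Ioo (a + P.κ) b, v₂ t ≤ P.ℓ₂ := fun t ht => by
      refine P.fast_le_level (v₁ := v₁) ht.1.le
        (absolutelyContinuousOnInterval_of_le_of_le h₂ le_rfl (haκ.trans ht.1.le) ht.2.le) hv₂ ?_
      filter_upwards [h] with s hs hmem using hs ⟨hmem.1, hmem.2.trans ht.2⟩
    have hdecay : v₁ b ≤ max (v₁ (a + P.κ) - P.c * (b - (a + P.κ))) P.ℓ₁ := by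
      refine le_max_of_ae_decreasing_above hκb P.c_nonneg
        (absolutelyContinuousOnInterval_of_le_of_le h₁ haκ hκb le_rfl) ?_
      filter_upwards [h] with t ht hmem hlt
      obtain ⟨d₁, _, hd₁, -, -, -, hslow⟩ := ht ⟨haκ.trans_lt hmem.1, hmem.2⟩
      exact ⟨d₁, hd₁, hslow (hsettled t hmem) hlt⟩
    rw [← max_add_add_right]
    exact hdecay.trans (max_le_max (by linarith) (by linarith [P.delay_nonneg]))

/-- The region in which the inequalities are required is not left, by a continuity argument. -/
theorem bounds_of_ae_decayAt (hab : a ≤ b) (h₁ : AbsolutelyContinuousOnInterval v₁ a b)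
    (h₂ : AbsolutelyContinuousOnInterval v₂ a b) (hw : w ≤ P.b₁) (hv₁ : v₁ a ≤ w)
    (hv₂ : v₂ a ≤ P.b₂)
    (h : ∀ᵐ t : ℝ, t ∈ Ioo a b → v₁ t ≤ P.b₁ + P.ν → v₂ t ≤ P.W → P.DecayAt v₁ v₂ t) :
    v₂ b ≤ P.b₂ ∧ (a + P.κ ≤ b → v₂ b ≤ P.ℓ₂) ∧
      v₁ b ≤ max (w - P.c * (b - a)) P.ℓ₁ + (P.c + P.L) * P.κ := by
  have hregion : ∀ t ∈ Icc a b, max (v₁ t - (P.b₁ + P.ν)) (v₂ t - P.W) < 0 := by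
    have hcont₁ : ContinuousOn v₁ (Icc a b) := uIcc_of_le hab ▸ h₁.continuousOn
    have hcont₂ : ContinuousOn v₂ (Icc a b) := uIcc_of_le hab ▸ h₂.continuousOn
    refine neg_of_neg_of_nonpos_before
      ((hcont₁.sub continuousOn_const).sup (hcont₂.sub continuousOn_const))
      (max_lt (by linarith [P.delay_nonneg, P.delay_lt]) (by linarith [P.b₂_lt]))
      fun t ht hbefore => ?_
    have hdecay : ∀ᵐ s : ℝ, s ∈ Ioo a t → P.DecayAt v₁ v₂ s := by
      filter_upwards [h] with s hs hmem
      obtain ⟨hs₁, hs₂⟩ := max_le_iff.1 (hbefore s (Ioo_subset_Icc_self hmem))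
      exact hs ⟨hmem.1, hmem.2.trans_le ht.2⟩ (sub_nonpos.1 hs₁) (sub_nonpos.1 hs₂)
    have h₂' := absolutelyContinuousOnInterval_of_le_of_le h₂ le_rfl ht.1 ht.2
    have hslow := P.slow_le_max ht.1
      (absolutelyContinuousOnInterval_of_le_of_le h₁ le_rfl ht.1 ht.2) h₂' hv₁ hv₂ hdecay
    have hnominal : max (w - P.c * (t - a)) P.ℓ₁ ≤ P.b₁ :=
      max_le (by linarith [mul_nonneg P.c_nonneg (sub_nonneg.2 ht.1)]) P.ℓ₁_le
    exact max_lt (by linarith [P.delay_lt])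
      (by linarith [P.fast_le ht.1 h₂' hv₂ hdecay, P.b₂_lt])
  have hdecay : ∀ᵐ t : ℝ, t ∈ Ioo a b → P.DecayAt v₁ v₂ t := by
    filter_upwards [h] with t ht hmem
    obtain ⟨ht₁, ht₂⟩ := max_lt_iff.1 (hregion t (Ioo_subset_Icc_self hmem))
    exact ht hmem (sub_nonpos.1 ht₁.le) (sub_nonpos.1 ht₂.le)
  exact ⟨P.fast_le hab h₂ hv₂ hdecay, fun hκ => P.fast_le_level hκ h₂ hv₂ hdecay,
    P.slow_le_max hab h₁ h₂ hv₁ hv₂ hdecay⟩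

end TwoScaleBounds

/-! ### Set-valued mappings on compact sets -/

section SetValued

variable {X Y : Type*} [PseudoMetricSpace X] [PseudoMetricSpace Y] {Φ : X → Set Y} {S K : Set X}

theorem LocallyBoundedOn.isBounded_iUnion (h : LocallyBoundedOn Φ S) (hK : IsCompact K)
    (hKS : K ⊆ S) : Bornology.IsBounded (⋃ x ∈ K, Φ x) := by
  suffices h' : Bornology.IsBounded (⋃ x ∈ K ∩ K, Φ x) by rwa [inter_self] at h'
  refine hK.induction_on (p := fun s => Bornology.IsBounded (⋃ x ∈ s ∩ K, Φ x)) ?_ ?_ ?_ ?_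
  · simp only [empty_inter, biUnion_empty, Bornology.isBounded_empty]
  · exact fun s t hst ht => ht.subset (biUnion_subset_biUnion_left (inter_subset_inter_left _ hst))
  · intro s t hs ht
    rw [union_inter_distrib_right, biUnion_union]
    exact hs.union ht
  · intro x hx
    obtain ⟨U, hU, hbdd⟩ := h x (hKS hx)
    exact ⟨U, mem_nhdsWithin_of_mem_nhds hU,
      hbdd.subset (biUnion_subset_biUnion_left (inter_subset_inter_right _ hKS))⟩

theorem isCompact_graph [ProperSpace Y] (hosc : OuterSemicontOn Φ S) (hbdd : LocallyBoundedOn Φ S)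
    (hK : IsCompact K) (hKS : K ⊆ S) : IsCompact {p : X × Y | p.1 ∈ K ∧ p.2 ∈ Φ p.1} := by
  refine IsSeqCompact.isCompact fun u hu => ?_
  obtain ⟨x, hx, f, hf, hfx⟩ := hK.isSeqCompact fun n => (hu n).1
  obtain ⟨y, -, g, hg, hgy⟩ := tendsto_subseq_of_bounded (hbdd.isBounded_iUnion hK hKS)
    (x := fun n => (u (f n)).2) fun n => mem_biUnion (hu (f n)).1 (hu (f n)).2
  have hfgx : Tendsto (fun n => (u (f (g n))).1) atTop (𝓝 x) := hfx.comp hg.tendsto_atTop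
  exact ⟨(x, y), ⟨hx, hosc x (hKS hx) y _ _
    (fun n => ⟨hKS (hu (f (g n))).1, (hu (f (g n))).2⟩) hfgx hgy⟩,
    f ∘ g, hf.comp hg, hfgx.prodMk_nhds hgy⟩

theorem exists_pos_forall_of_isCompact (hK : IsCompact K) {f g : X → ℝ} (hf : Continuous f)
    (hg : Continuous g) (hlt : ∀ x ∈ K, f x ≤ 0 → g x < 0) :
    ∃ η > 0, ∀ x ∈ K, f x ≤ η → g x < 0 := by
  rcases (K ∩ g ⁻¹' Ici 0).eq_empty_or_nonempty with hempty | hne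
  · refine ⟨1, one_pos, fun x hx _ => ?_⟩
    by_contra! hle
    exact hempty.subset ⟨hx, hle⟩
  · obtain ⟨x₀, ⟨hx₀, hgx₀⟩, hmin⟩ :=
      (hK.inter_right (isClosed_Ici.preimage hg)).exists_isMinOn hne hf.continuousOn
    have hpos : 0 < f x₀ := not_le.1 fun hle => (hlt x₀ hx₀ hle).not_ge hgx₀
    refine ⟨f x₀ / 2, half_pos hpos, fun x hx hfx => ?_⟩
    by_contra! hle
    linarith [isMinOn_iff.1 hmin x ⟨hx, hle⟩]

theorem exists_pos_forall_of_outerSemicontOn [ProperSpace Y] (hosc : OuterSemicontOn Φ S)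
    (hbdd : LocallyBoundedOn Φ S) (hK : IsCompact K) (hKS : K ⊆ S) {f : X → ℝ}
    (hf : Continuous f) {h : X × Y → ℝ} (hh : Continuous h)
    (hlt : ∀ x ∈ K, f x ≤ 0 → ∀ y ∈ Φ x, h (x, y) < 0) :
    ∃ η > 0, ∀ x ∈ K, f x ≤ η → ∀ y ∈ Φ x, h (x, y) < 0 := by
  obtain ⟨η, hη, hsmall⟩ := exists_pos_forall_of_isCompact
    (isCompact_graph hosc hbdd hK hKS) (hf.comp continuous_fst) hh
    fun p hp hfp => hlt p.1 hp.1 hfp p.2 hp.2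
  exact ⟨η, hη, fun x hx hfx y hy => hsmall (x, y) ⟨hx, hy⟩ hfx⟩

end SetValued

/-! ### Comparison functions -/

namespace IsClassK

variable {α : ℝ → ℝ} {s t : ℝ}

theorem pos (h : IsClassK α) (hs : 0 < s) : 0 < α s :=
  h.map_zero ▸ h.strictMonoOn self_mem_Ici hs.le hs

theorem le_iff (h : IsClassK α) (hs : 0 ≤ s) (ht : 0 ≤ t) : α s ≤ α t ↔ s ≤ t :=
  h.strictMonoOn.le_iff_le hs ht

theorem nonneg (h : IsClassK α) (hs : 0 ≤ s) : 0 ≤ α s :=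
  h.map_zero ▸ (h.le_iff le_rfl hs).2 hs

theorem exists_forall_le (h : IsClassK α) {c : ℝ} (hc : 0 < c) :
    ∃ s > 0, ∀ t, 0 ≤ t → t ≤ s → α t ≤ c := by
  have hlim : Tendsto α (𝓝[≥] 0) (𝓝 0) := by
    simpa only [ContinuousWithinAt, h.map_zero] using h.continuousOn 0 self_mem_Ici
  obtain ⟨s, hs, hsub⟩ := mem_nhdsGE_iff_exists_Icc_subset.1 (hlim.eventually (Iic_mem_nhds hc))
  exact ⟨s, hs, fun t ht hts => hsub ⟨ht, hts⟩⟩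

end IsClassK

theorem IsClassKInfty.exists_le {α : ℝ → ℝ} (h : IsClassKInfty α) (c : ℝ) :
    ∃ s > 0, c ≤ α s := by
  obtain ⟨s, hcs, hs⟩ :=
    ((h.tendsto_atTop.eventually_ge_atTop c).and (eventually_gt_atTop 0)).exists
  exact ⟨s, hs, hcs⟩

/-! ### Successively small parameters -/

theorem successivelySmall_succ {k : ℕ} {P : (Fin (k + 1) → ℝ) → Prop} :
    SuccessivelySmall (k + 1) P ↔
      ∀ᶠ x in 𝓝[>] (0 : ℝ), SuccessivelySmall k fun p => P (Fin.cons x p) := by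
  rw [Filter.Eventually, mem_nhdsGT_iff_exists_Ioo_subset]
  exact ⟨fun ⟨e, he, h⟩ => ⟨e, he, fun x hx => h x hx.1 hx.2⟩,
    fun ⟨e, he, h⟩ => ⟨e, he, fun x hx hxe => h ⟨hx, hxe⟩⟩⟩

/-- The property `Q γ θ ε β` holds for successively small `γ`, `θ`, `ε`, `β`: the curried,
filter-based form of `SuccessivelySmall 4`. -/
def EventuallySmall (Q : ℝ → ℝ → ℝ → ℝ → Prop) : Prop :=
  ∀ᶠ γ in 𝓝[>] (0 : ℝ), ∀ᶠ θ in 𝓝[>] (0 : ℝ), ∀ᶠ ε in 𝓝[>] (0 : ℝ), ∀ᶠ β in 𝓝[>] (0 : ℝ),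
    Q γ θ ε β

theorem successivelySmall_four {P : (Fin 4 → ℝ) → Prop} :
    SuccessivelySmall 4 P ↔ EventuallySmall fun γ θ ε β => P ![γ, θ, ε, β] := by
  change SuccessivelySmall (0 + 1 + 1 + 1 + 1) P ↔ _
  simp only [successivelySmall_succ]
  rfl

namespace EventuallySmall

variable {Q Q' : ℝ → ℝ → ℝ → ℝ → Prop}

theorem mono (h : EventuallySmall Q) (hQ : ∀ γ θ ε β, Q γ θ ε β → Q' γ θ ε β) :
    EventuallySmall Q' :=
  Filter.Eventually.mono h fun γ hγ => hγ.mono fun θ hθ => hθ.mono fun ε hε =>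
    hε.mono fun β => hQ γ θ ε β

theorem and (h : EventuallySmall Q) (h' : EventuallySmall Q') :
    EventuallySmall fun γ θ ε β => Q γ θ ε β ∧ Q' γ θ ε β := by
  unfold EventuallySmall
  filter_upwards [h, h'] with γ hγ hγ'
  filter_upwards [hγ, hγ'] with θ hθ hθ'
  filter_upwards [hθ, hθ'] with ε hε hε'
  exact hε.and hε'

end EventuallySmall

theorem eventuallySmall_mem_Ioc {β₀ γ₀ θ₀ : ℝ} (hβ₀ : 0 < β₀) (hγ₀ : 0 < γ₀) (hθ₀ : 0 < θ₀) :
    EventuallySmall fun γ θ ε β => γ ∈ Ioc 0 γ₀ ∧ θ ∈ Ioc 0 θ₀ ∧ 0 < ε ∧ β ∈ Ioc 0 β₀ := by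
  unfold EventuallySmall
  filter_upwards [Ioc_mem_nhdsGT hγ₀] with γ hγ
  filter_upwards [Ioc_mem_nhdsGT hθ₀] with θ hθ
  filter_upwards [self_mem_nhdsWithin] with ε hε
  filter_upwards [Ioc_mem_nhdsGT hβ₀] with β hβ using ⟨hγ, hθ, hε, hβ⟩

/-! ### Hybrid time domains -/

/-- No level of `S` extends beyond the time of a jump out of it. A hybrid time domain may violate
this, since the truncations at a point `q` only see the points `p ≤ q` in the product order: for
example `{0} × ℕ ∪ [0, 1] × {0}` is one. -/
def IsNonbranching (S : Set (ℝ × ℕ)) : Prop :=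
  ∀ ⦃t t' : ℝ⦄ ⦃j : ℕ⦄, (t, j) ∈ S → (t, j + 1) ∈ S → (t', j) ∈ S → t' ≤ t

namespace IsHybridTimeDomain

variable {S S' : Set (ℝ × ℕ)} {a b t t' : ℝ} {i j k : ℕ}

theorem exists_times (h : IsHybridTimeDomain S) (hak : (a, k) ∈ S) :
    ∃ t : ℕ → ℝ, t 0 = 0 ∧ Monotone t ∧ t (k + 1) = a ∧
      ∀ s j, ((s, j) ∈ S ∧ s ≤ a ∧ j ≤ k) ↔ (j ≤ k ∧ t j ≤ s ∧ s ≤ t (j + 1)) := by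
  obtain ⟨J, t, hzero, hmono, heq⟩ := h _ hak
  have hiff : ∀ s j, ((s, j) ∈ S ∧ s ≤ a ∧ j ≤ k) ↔ (j ≤ J ∧ t j ≤ s ∧ s ≤ t (j + 1)) :=
    fun s j => Set.ext_iff.1 heq (s, j)
  obtain ⟨hkJ, -, hat⟩ := (hiff a k).1 ⟨hak, le_rfl, le_rfl⟩
  obtain ⟨-, hta, hJk⟩ := (hiff (t (J + 1)) J).2 ⟨le_rfl, hmono (Nat.le_succ J), le_rfl⟩
  obtain rfl : J = k := hJk.antisymm hkJ
  exact ⟨t, hzero, hmono, hta.antisymm hat, hiff⟩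

theorem mem_of_mem_Icc (h : IsHybridTimeDomain S) (ha : (a, j) ∈ S) (hb : (b, j) ∈ S)
    (ht : t ∈ Icc a b) : (t, j) ∈ S := by
  obtain ⟨s, -, -, hsb, hiff⟩ := h.exists_times hb
  obtain ⟨-, hsa, -⟩ := (hiff a j).1 ⟨ha, ht.1.trans ht.2, le_rfl⟩
  exact ((hiff t j).2 ⟨le_rfl, hsa.trans ht.1, hsb ▸ ht.2⟩).1

theorem exists_jump (h : IsHybridTimeDomain S) (hak : (a, k) ∈ S) (hik : i < k) :
    ∃ t ≤ a, (t, i) ∈ S ∧ (t, i + 1) ∈ S := by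
  obtain ⟨t, -, hmono, hta, hiff⟩ := h.exists_times hak
  exact ⟨t (i + 1), hta ▸ hmono (by omega),
    ((hiff _ i).2 ⟨hik.le, hmono (Nat.le_succ i), le_rfl⟩).1,
    ((hiff _ (i + 1)).2 ⟨hik, le_rfl, hmono (Nat.le_succ _)⟩).1⟩

theorem mem_of_subset (h : IsHybridTimeDomain S) (h' : IsHybridTimeDomain S') (hSS' : S ⊆ S')
    (hak : (a, k) ∈ S) (htj : (t, j) ∈ S') (hta : t ≤ a) (hjk : j ≤ k) : (t, j) ∈ S := by
  obtain ⟨s, hs0, hmono, hsa, hiff⟩ := h.exists_times hak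
  obtain ⟨s', hs0', -, hsa', hiff'⟩ := h'.exists_times (hSS' hak)
  have hmem : ∀ i ≤ k, ∀ r, s i ≤ r → r ≤ s (i + 1) → s' i ≤ r ∧ r ≤ s' (i + 1) := by
    intro i hi r hr hr'
    obtain ⟨hrS, hra, -⟩ := (hiff r i).2 ⟨hi, hr, hr'⟩
    exact ((hiff' r i).1 ⟨hSS' hrS, hra, hi⟩).2
  have hle : ∀ i ≤ k, s i ≤ s' i := by
    rintro (_ | i) hi
    · rw [hs0, hs0']
    · exact (hmem i (by omega) _ (hmono (Nat.le_succ i)) le_rfl).2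
  have hge : ∀ i ≤ k + 1, s' i ≤ s i := by
    intro i hi
    rcases hi.eq_or_lt with rfl | hi
    · rw [hsa, hsa']
    · exact (hmem i (by omega) _ le_rfl (hmono (Nat.le_succ i))).1
  obtain ⟨-, hst, hts⟩ := (hiff' t j).1 ⟨htj, hta, hjk⟩
  exact ((hiff t j).2 ⟨hjk, (hle j hjk).trans hst, hts.trans (hge _ (by omega))⟩).1

theorem le_of_branching (h : IsHybridTimeDomain S) (hj : (t, j) ∈ S) (hj' : (t, j + 1) ∈ S)
    (ht' : (t', j) ∈ S) (htt' : t < t') (hjk : j < k) (hak : (a, k) ∈ S) : a ≤ t := by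
  by_contra! hta
  obtain ⟨s, -, -, -, hiff⟩ := h.exists_times hak
  obtain ⟨-, hst, -⟩ := (hiff t (j + 1)).1 ⟨hj', hta.le, hjk⟩
  have hmin : (min a t', j) ∈ S :=
    h.mem_of_mem_Icc hj ht' ⟨le_min hta.le htt'.le, min_le_right _ _⟩
  obtain ⟨-, -, hmins⟩ := (hiff _ j).1 ⟨hmin, min_le_left _ _, hjk.le⟩
  exact (hmins.trans hst).not_gt (lt_min hta htt')

theorem eq_of_branching (h : IsHybridTimeDomain S) (hj : (t, j) ∈ S) (hj' : (t, j + 1) ∈ S)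
    (ht' : (t', j) ∈ S) (htt' : t < t') (hjk : j < k) (hak : (a, k) ∈ S) : a = t := by
  have hat := h.le_of_branching hj hj' ht' htt' hjk hak
  obtain ⟨s, hsa, hs, hs'⟩ := h.exists_jump hak hjk
  exact hat.antisymm <| (h.le_of_branching hs hs' ht' ((hsa.trans hat).trans_lt htt')
    (Nat.lt_succ_self j) hj').trans hsa

theorem le_of_lt_branching (h : IsHybridTimeDomain S) (hj : (t, j) ∈ S) (ht' : (t', j) ∈ S)
    (htt' : t < t') (hij : i < j) (hai : (a, i) ∈ S) : a ≤ t := by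
  by_contra! hta
  obtain ⟨s, hst, hs, hs'⟩ := h.exists_jump hj hij
  exact htt'.not_ge ((h.le_of_branching hs hs' hai (hst.trans_lt hta) hij ht').trans hst)

/-- If a level `j` branches, all other levels stay below its jump time. -/
theorem exists_level_ge_of_branching (h : IsHybridTimeDomain S)
    (hunb : ∀ M : ℝ, ∃ p ∈ S, M ≤ p.1 + (p.2 : ℝ)) (hk : ∀ p ∈ S, p.2 ≤ k) (hj : (t, j) ∈ S)
    (hj' : (t, j + 1) ∈ S) (ht' : (t', j) ∈ S) (htt' : t < t') (M : ℝ) :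
    ∃ a, (a, j) ∈ S ∧ M ≤ a := by
  obtain ⟨⟨a, i⟩, hai, hM⟩ := hunb (max M (t + 1) + k)
  have hik : (i : ℝ) ≤ k := by exact_mod_cast hk _ hai
  have hMa : max M (t + 1) ≤ a := by linarith
  have hta : t < a := by linarith [le_max_right M (t + 1)]
  rcases lt_trichotomy i j with hij | rfl | hji
  · exact absurd (h.le_of_lt_branching hj ht' htt' hij hai) hta.not_ge
  · exact ⟨a, hai, (le_max_left _ _).trans hMa⟩
  · exact absurd (h.le_of_branching hj hj' ht' htt' hji hai) hta.not_ge

variable {σ T : ℝ}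

/-- The length of an unbounded level is a supremum with the junk value `0`. -/
theorem mem_irregularJumps_of_unbounded (hσ : 0 < σ) (hj : (t, j) ∈ S) (hj' : (t, j + 1) ∈ S)
    (hlevel : ∀ M : ℝ, ∃ a, (a, j) ∈ S ∧ M ≤ a) : j ∈ SPSystem.irregularJumps S σ := by
  refine ⟨⟨t, hj, hj'⟩, ?_⟩
  rw [Real.sSup_of_not_bddAbove]
  · exact hσ
  · rintro ⟨B, hB⟩
    obtain ⟨a, ha, hBa⟩ := hlevel (t + B + 1)
    linarith [hB ⟨a, t, ha, hj, rfl⟩, le_abs_self (a - t)]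

theorem mem_irregularJumps_of_branching (h : IsHybridTimeDomain S) (hσ : 0 < σ)
    (hj : (t, j) ∈ S) (hj' : (t, j + 1) ∈ S) (ht' : (t', j) ∈ S) (htt' : t < t') (hji : j < i)
    (hik : i < k) (hak : (a, k) ∈ S) : i ∈ SPSystem.irregularJumps S σ := by
  obtain ⟨s, -, hs, hs'⟩ := h.exists_jump hak hik
  refine ⟨⟨s, hs, hs'⟩, lt_of_le_of_lt (csSup_le ⟨_, s, s, hs, hs, rfl⟩ ?_) hσ⟩
  rintro _ ⟨r, r', hr, hr', rfl⟩
  rw [h.eq_of_branching hj hj' ht' htt' hji hr, h.eq_of_branching hj hj' ht' htt' hji hr',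
    sub_self, abs_zero]

/-- Beyond a branching level either infinitely many jumps happen at once, or the branching level
itself is unbounded. -/
theorem isNonbranching (h : IsHybridTimeDomain S)
    (hunb : ∀ M : ℝ, ∃ p ∈ S, M ≤ p.1 + (p.2 : ℝ)) (hσ : 0 < σ)
    (hfin : (SPSystem.irregularJumps S σ).Finite)
    (hT : ∀ j ∈ SPSystem.irregularJumps S σ, ∀ t, (t, j) ∈ S → t ≤ T) : IsNonbranching S := by
  intro t t' j hj hj' ht'
  by_contra! htt'
  by_cases hlevels : ∃ k : ℕ, ∀ p ∈ S, p.2 ≤ k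
  · obtain ⟨k, hk⟩ := hlevels
    have hlevel := h.exists_level_ge_of_branching hunb hk hj hj' ht' htt'
    obtain ⟨a, ha, hTa⟩ := hlevel (T + 1)
    linarith [hT j (mem_irregularJumps_of_unbounded hσ hj hj' hlevel) a ha]
  · push Not at hlevels
    refine ((Ioi_infinite j).mono fun i hi => ?_) hfin
    obtain ⟨⟨a, k⟩, hak, hik⟩ := hlevels i
    exact h.mem_irregularJumps_of_branching hσ hj hj' ht' htt' hi hik hak

theorem le_of_add_le (h : IsHybridTimeDomain S) (hS : IsNonbranching S) {p q : ℝ × ℕ}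
    (hp : p ∈ S) (hq : q ∈ S) (hpq : p.1 + (p.2 : ℝ) ≤ q.1 + (q.2 : ℝ)) : p ≤ q := by
  obtain ⟨a, i⟩ := p
  obtain ⟨b, k⟩ := q
  rcases lt_trichotomy i k with hik | rfl | hki
  · obtain ⟨t, htb, hi, hi'⟩ := h.exists_jump hq hik
    exact ⟨(hS hi hi' hp).trans htb, hik.le⟩
  · exact ⟨le_of_add_le_add_right hpq, le_rfl⟩
  · obtain ⟨t, hta, hk, hk'⟩ := h.exists_jump hp hki
    have hlt : (k : ℝ) < i := by exact_mod_cast hki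
    linarith [(hS hk hk' hq).trans hta]

end IsHybridTimeDomain

/-! ### Solutions of hybrid systems -/

section Extension

variable {E : Type*}

/-- The hybrid arc `y`, given as a pair of a domain and a function, extends the hybrid arc `x`. -/
def ArcExtends (x y : Set (ℝ × ℕ) × (ℝ → ℕ → E)) : Prop :=
  x.1 ⊆ y.1 ∧ ∀ p ∈ x.1, y.2 p.1 p.2 = x.2 p.1 p.2

theorem ArcExtends.trans {x y z : Set (ℝ × ℕ) × (ℝ → ℕ → E)} (hxy : ArcExtends x y)
    (hyz : ArcExtends y z) : ArcExtends x z :=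
  ⟨hxy.1.trans hyz.1, fun p hp => (hyz.2 p (hxy.1 hp)).trans (hxy.2 p hp)⟩

theorem exists_forall_arcExtends_sUnion {c : Set (Set (ℝ × ℕ) × (ℝ → ℕ → E))}
    (hne : c.Nonempty) (hc : IsChain ArcExtends c) :
    ∃ φ, ∀ x ∈ c, ArcExtends x (⋃₀ (Prod.fst '' c), φ) := by
  classical
  obtain ⟨x₀, -⟩ := hne
  have hagree : ∀ x ∈ c, ∀ y ∈ c, ∀ p ∈ x.1, p ∈ y.1 → x.2 p.1 p.2 = y.2 p.1 p.2 := by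
    intro x hx y hy p hpx hpy
    rcases eq_or_ne x y with rfl | hxy
    · rfl
    · exact (hc hx hy hxy).elim (fun hxy => (hxy.2 p hpx).symm) fun hyx => hyx.2 p hpy
  refine ⟨fun t j => if h : ∃ x ∈ c, (t, j) ∈ x.1 then h.choose.2 t j else x₀.2 t j,
    fun x hx => ⟨subset_sUnion_of_mem (mem_image_of_mem _ hx), fun p hp => ?_⟩⟩
  have hex : ∃ x ∈ c, (p.1, p.2) ∈ x.1 := ⟨x, hx, hp⟩
  simp only [dif_pos hex]
  exact hagree _ hex.choose_spec.1 x hx p hex.choose_spec.2 hp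

end Extension

section Solutions

variable {E : Type*} [NormedAddCommGroup E] [NormedSpace ℝ E] {ℋ : HybridSystem E}
  {S : Set (ℝ × ℕ)} {φ ψ : ℝ → ℕ → E} {s σ a : ℝ} {j k : ℕ}

theorem IsSolution.congr (h : IsSolution ℋ S φ) (hψ : ∀ p ∈ S, ψ p.1 p.2 = φ p.1 p.2) :
    IsSolution ℋ S ψ := by
  have hlevel : ∀ {a b : ℝ} {j : ℕ}, (a, j) ∈ S → (b, j) ∈ S → ∀ t ∈ Icc a b, ψ t j = φ t j :=
    fun ha hb t ht => hψ _ (h.isHybridTimeDomain.mem_of_mem_Icc ha hb ht)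
  refine ⟨h.isHybridTimeDomain, h.zero_mem, hψ _ h.zero_mem ▸ h.init, fun j a b hab ha hb => ?_,
    fun j a b ha hb t ht => ?_, fun j a b ha hb => ?_, fun j t hj hj' => ?_⟩
  · refine absolutelyContinuousOnInterval_congr (h.absCont j a b hab ha hb) ?_
    rw [uIcc_of_le hab]
    exact fun t ht => (hlevel ha hb t ht).symm
  · rw [hlevel ha hb t (Ioo_subset_Icc_self ht)]
    exact h.flow_mem j a b ha hb t ht
  · filter_upwards [h.flow j a b ha hb] with t ht hmem
    obtain ⟨v, hv, hderiv⟩ := ht hmem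
    refine ⟨v, by rwa [hlevel ha hb t (Ioo_subset_Icc_self hmem)],
      hderiv.congr_of_eventuallyEq ?_⟩
    filter_upwards [Ioo_mem_nhds hmem.1 hmem.2] with s hs
    exact hlevel ha hb s (Ioo_subset_Icc_self hs)
  · rw [hψ _ hj, hψ _ hj']
    exact h.jump j t hj hj'

theorem IsHybridTimeDomain.sUnion {c : Set (Set (ℝ × ℕ))} (hc : IsChain (· ⊆ ·) c)
    (h : ∀ S ∈ c, IsHybridTimeDomain S) : IsHybridTimeDomain (⋃₀ c) := by
  rintro q ⟨S, hS, hq⟩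
  suffices ⋃₀ c ∩ {p | p.1 ≤ q.1 ∧ p.2 ≤ q.2} = S ∩ {p | p.1 ≤ q.1 ∧ p.2 ≤ q.2} by
    rw [this]
    exact h S hS q hq
  ext p
  refine ⟨fun ⟨⟨S', hS', hp⟩, hpq⟩ => ⟨?_, hpq⟩, fun ⟨hp, hpq⟩ => ⟨⟨S, hS, hp⟩, hpq⟩⟩
  rcases hc.total hS hS' with hSS' | hSS'
  · exact (h S hS).mem_of_subset (h S' hS') hSS' hq hp hpq.1 hpq.2
  · exact hSS' hp

theorem IsSolution.sUnion {c : Set (Set (ℝ × ℕ))} (hne : c.Nonempty) (hc : IsChain (· ⊆ ·) c)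
    (h : ∀ S ∈ c, IsSolution ℋ S φ) : IsSolution ℋ (⋃₀ c) φ := by
  have hcommon : ∀ {p q : ℝ × ℕ}, p ∈ ⋃₀ c → q ∈ ⋃₀ c → ∃ S ∈ c, p ∈ S ∧ q ∈ S := by
    rintro p q ⟨S, hS, hp⟩ ⟨S', hS', hq⟩
    rcases hc.total hS hS' with hSS' | hSS'
    · exact ⟨S', hS', hSS' hp, hq⟩
    · exact ⟨S, hS, hp, hSS' hq⟩
  obtain ⟨S₀, hS₀⟩ := hne
  refine ⟨.sUnion hc fun S hS => (h S hS).isHybridTimeDomain, ⟨S₀, hS₀, (h S₀ hS₀).zero_mem⟩,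
    (h S₀ hS₀).init, fun j a b hab ha hb => ?_, fun j a b ha hb => ?_, fun j a b ha hb => ?_,
    fun j t hj hj' => ?_⟩
  · obtain ⟨S, hS, ha, hb⟩ := hcommon ha hb
    exact (h S hS).absCont j a b hab ha hb
  · obtain ⟨S, hS, ha, hb⟩ := hcommon ha hb
    exact (h S hS).flow_mem j a b ha hb
  · obtain ⟨S, hS, ha, hb⟩ := hcommon ha hb
    exact (h S hS).flow j a b ha hb
  · obtain ⟨S, hS, hj, hj'⟩ := hcommon hj hj'
    exact (h S hS).jump j t hj hj'

theorem exists_isSolution_arcExtends_of_isChain {c : Set (Set (ℝ × ℕ) × (ℝ → ℕ → E))}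
    (hne : c.Nonempty) (hc : IsChain ArcExtends c) (h : ∀ x ∈ c, IsSolution ℋ x.1 x.2) :
    ∃ y : Set (ℝ × ℕ) × (ℝ → ℕ → E), IsSolution ℋ y.1 y.2 ∧ ∀ x ∈ c, ArcExtends x y := by
  obtain ⟨φ, hφ⟩ := exists_forall_arcExtends_sUnion hne hc
  refine ⟨(⋃₀ (Prod.fst '' c), φ), .sUnion (hne.image _) ?_ ?_, hφ⟩
  · exact hc.image_of_map_rel _ _ _ fun _ _ hxy => hxy.1
  · rintro _ ⟨x, hx, rfl⟩
    exact (h x hx).congr (hφ x hx).2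

theorem IsSolution.exists_maximal (h : IsSolution ℋ S φ) :
    ∃ S' φ', IsMaximalSolution ℋ S' φ' ∧ S ⊆ S' := by
  let α := {x : Set (ℝ × ℕ) × (ℝ → ℕ → E) // IsSolution ℋ x.1 x.2 ∧ ArcExtends (S, φ) x}
  have hchain : ∀ c : Set α, IsChain (fun x y => ArcExtends x.1 y.1) c →
      ∃ y : α, ∀ x ∈ c, ArcExtends x.1 y.1 := by
    intro c hc
    rcases c.eq_empty_or_nonempty with rfl | ⟨x, hx⟩
    · exact ⟨⟨(S, φ), h, subset_rfl, fun _ _ => rfl⟩, by simp⟩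
    · obtain ⟨y, hy, hub⟩ := exists_isSolution_arcExtends_of_isChain (ℋ := ℋ)
        (Nonempty.image Subtype.val ⟨x, hx⟩)
        (hc.image_of_map_rel _ ArcExtends _ fun _ _ hxy => hxy)
        (by rintro _ ⟨x, -, rfl⟩; exact x.2.1)
      exact ⟨⟨y, hy, x.2.2.trans (hub _ (mem_image_of_mem _ hx))⟩,
        fun x hx => hub _ (mem_image_of_mem _ hx)⟩
  obtain ⟨⟨⟨S', φ'⟩, hsol', hext'⟩, hmax⟩ :=
    exists_maximal_of_chains_bounded hchain fun {_ _ _} => ArcExtends.trans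
  refine ⟨S', φ', ⟨hsol', ?_⟩, hext'.1⟩
  rintro ⟨S'', φ'', hsol'', hss, hagree⟩
  have hext'' : ArcExtends (S', φ') (S'', φ'') := ⟨hss.1, hagree⟩
  exact hss.2 (hmax ⟨(S'', φ''), hsol'', hext'.trans hext''⟩ hext'').1

theorem IsSolution.mem_closure_union (h : IsSolution ℋ S φ)
    (hG : ∀ x ∈ ℋ.jumpSet, ℋ.jumpMap x ⊆ ℋ.flowSet) (hs : (s, j) ∈ S) :
    φ s j ∈ closure ℋ.flowSet ∪ ℋ.jumpSet := by
  obtain ⟨t, ht0, hmono, hts, hiff⟩ := h.isHybridTimeDomain.exists_times hs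
  have hle : t j ≤ s := hts ▸ hmono (Nat.le_succ j)
  have hmem : (t j, j) ∈ S := ((hiff _ j).2 ⟨le_rfl, le_rfl, hmono (Nat.le_succ j)⟩).1
  rcases hle.eq_or_lt with heq | hlt
  · rcases j with _ | j
    · rw [← heq, ht0]
      exact h.init
    · have hmem' : (t (j + 1), j) ∈ S :=
        ((hiff _ j).2 ⟨Nat.le_succ j, hmono (Nat.le_succ j), le_rfl⟩).1
      obtain ⟨hjump, hmap⟩ := h.jump j _ hmem' hmem
      rw [← heq]
      exact .inl (subset_closure (hG _ hjump hmap))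
  · have hcont : ContinuousWithinAt (fun r => φ r j) (Ioo (t j) s) s :=
      ((h.absCont j _ _ hle hmem hs).continuousOn s right_mem_uIcc).mono
        (uIcc_of_le hle ▸ Ioo_subset_Icc_self)
    refine .inl (hcont.mem_closure ?_ fun r hr => h.flow_mem j _ _ hmem hs r hr)
    rw [closure_Ioo hlt.ne]
    exact right_mem_Icc.2 hle

theorem IsSolution.isNonbranching (h : IsSolution ℋ S φ) (hcomplete : SolutionsComplete ℋ)
    (hσ : 0 < σ) (hreg : ∀ S φ, IsSolution ℋ S φ → ∃ T, (SPSystem.irregularJumps S σ).Finite ∧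
      ∀ j ∈ SPSystem.irregularJumps S σ, ∀ t, (t, j) ∈ S → t ≤ T) : IsNonbranching S := by
  obtain ⟨S', φ', hmax, hSS'⟩ := h.exists_maximal
  obtain ⟨T, hfin, hT⟩ := hreg S' φ' hmax.1
  have hS' := hmax.1.isHybridTimeDomain.isNonbranching (hcomplete S' φ' hmax) hσ hfin hT
  exact fun t t' j hj hj' ht' => hS' (hSS' hj) (hSS' hj') (hSS' ht')

/-- The hybrid times elapsed after `(a, k)` in the hybrid time domain `S`. -/
def shiftDomain (S : Set (ℝ × ℕ)) (a : ℝ) (k : ℕ) : Set (ℝ × ℕ) :=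
  {p | 0 ≤ p.1 ∧ (p.1 + a, p.2 + k) ∈ S}

theorem IsHybridTimeDomain.shift (h : IsHybridTimeDomain S) (hak : (a, k) ∈ S) :
    IsHybridTimeDomain (shiftDomain S a k) := by
  rintro ⟨b, i⟩ ⟨hb, hq⟩
  dsimp only at hb hq
  obtain ⟨t, -, hmono, -, hiff⟩ := h.exists_times hq
  obtain ⟨-, hta, hat⟩ := (hiff a k).1 ⟨hak, by linarith, by omega⟩
  refine ⟨i, fun l => max 0 (t (l + k) - a), by simpa using hta,
    fun l l' hl => max_le_max le_rfl (sub_le_sub_right (hmono (by omega)) a), ?_⟩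
  ext ⟨s, l⟩
  have hsucc : l + 1 + k = l + k + 1 := by ring
  have hle : a ≤ t (l + k + 1) := hat.trans (hmono (by omega))
  have hmem := hiff (s + a) (l + k)
  simp only [shiftDomain, mem_inter_iff, mem_ofPred_eq, hsucc, max_le_iff,
    max_eq_right (sub_nonneg.2 hle), sub_le_iff_le_add, le_sub_iff_add_le] at hmem ⊢
  constructor
  · rintro ⟨⟨hs, hS⟩, hsb, hli⟩
    exact ⟨hli, ⟨hs, (hmem.1 ⟨hS, by linarith, by omega⟩).2.1⟩,
      (hmem.1 ⟨hS, by linarith, by omega⟩).2.2⟩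
  · rintro ⟨hli, ⟨hs, hts⟩, hst⟩
    obtain ⟨hS, hsb, -⟩ := hmem.2 ⟨by omega, hts, hst⟩
    exact ⟨⟨hs, hS⟩, by linarith, hli⟩

theorem IsSolution.shift (h : IsSolution ℋ S φ)
    (hG : ∀ x ∈ ℋ.jumpSet, ℋ.jumpMap x ⊆ ℋ.flowSet) (hak : (a, k) ∈ S) :
    IsSolution ℋ (shiftDomain S a k) (fun s j => φ (s + a) (j + k)) where
  isHybridTimeDomain := h.isHybridTimeDomain.shift hak
  zero_mem := ⟨le_rfl, by simpa using hak⟩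
  init := by simpa using h.mem_closure_union hG hak
  absCont j b c hbc hb hc := absolutelyContinuousOnInterval_comp_add_right
    (x := fun s => φ s (j + k)) (h.absCont (j + k) _ _ (by linarith) hb.2 hc.2)
  flow_mem j b c hb hc t ht :=
    h.flow_mem (j + k) _ _ hb.2 hc.2 (t + a) ⟨by linarith [ht.1], by linarith [ht.2]⟩
  flow j b c hb hc := by
    filter_upwards [(measurePreserving_add_right volume a).quasiMeasurePreserving.ae
      (h.flow (j + k) _ _ hb.2 hc.2)] with t ht hmem
    obtain ⟨v, hv, hderiv⟩ := ht ⟨by linarith [hmem.1], by linarith [hmem.2]⟩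
    exact ⟨v, hv, hderiv.comp_add_const t a⟩
  jump j t hj hj' := by
    have hsucc : j + 1 + k = j + k + 1 := by ring
    have hmem := hj'.2
    simp only [hsucc] at hmem ⊢
    exact h.jump (j + k) (t + a) hj.2 hmem

end Solutions

/-! ### Finite arcs -/

section ShortLevels

variable {J j k : ℕ} {t : ℕ → ℝ} {σ : ℝ}

/-- The levels `j < J` of an arc whose interval of flow `[t j, t (j + 1)]` is shorter than `σ`. The
last level `J` of an arc is not followed by a jump and does not count. -/
noncomputable def shortLevels (J : ℕ) (t : ℕ → ℝ) (σ : ℝ) : Finset ℕ :=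
  {j ∈ Finset.range J | t (j + 1) - t j < σ}

theorem mem_shortLevels : j ∈ shortLevels J t σ ↔ j < J ∧ t (j + 1) - t j < σ := by
  simp [shortLevels]

theorem shortLevels_subset (hk : k ≤ J) : shortLevels k t σ ⊆ shortLevels J t σ := fun _ hj =>
  mem_shortLevels.2 ⟨(mem_shortLevels.1 hj).1.trans_le hk, (mem_shortLevels.1 hj).2⟩

theorem exists_mem_shortLevels_of_ne_empty (h : shortLevels J t σ ≠ ∅) :
    ∃ j ∈ shortLevels J t σ, shortLevels j t σ = ∅ := by
  have hne := Finset.nonempty_iff_ne_empty.2 h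
  have hmem := (shortLevels J t σ).min'_mem hne
  refine ⟨_, hmem, Finset.eq_empty_of_forall_notMem fun i hi => ?_⟩
  exact ((shortLevels J t σ).min'_le i (shortLevels_subset (mem_shortLevels.1 hmem).1.le hi)).not_gt
    (mem_shortLevels.1 hi).1

theorem add_mem_shortLevels (hj : j ∈ shortLevels (J - k) (fun i => t (i + k)) σ) :
    j + k ∈ shortLevels J t σ := by
  obtain ⟨hlt, hshort⟩ := mem_shortLevels.1 hj
  rw [add_right_comm] at hshort
  exact mem_shortLevels.2 ⟨by omega, hshort⟩

theorem card_shortLevels_tail_lt (hj : j ∈ shortLevels J t σ) :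
    (shortLevels (J - (j + 1)) (fun i => t (i + (j + 1))) σ).card < (shortLevels J t σ).card := by
  rw [← Finset.card_map (addRightEmbedding (j + 1))]
  refine Finset.card_lt_card (Finset.ssubset_iff_of_subset ?_ |>.2 ⟨j, hj, ?_⟩)
  · exact Finset.map_subset_iff_subset_preimage.2 fun i hi =>
      Finset.mem_preimage.2 (add_mem_shortLevels hi)
  · simp only [Finset.mem_map, addRightEmbedding_apply]
    omega

theorem mul_le_mul_card_shortLevels_add (J : ℕ) (t : ℕ → ℝ)
    (ht : ∀ j < J, t j ≤ t (j + 1)) : σ * J ≤ σ * (shortLevels J t σ).card + (t J - t 0) := by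
  calc σ * J = ∑ _j ∈ Finset.range J, σ := by simp [mul_comm]
    _ ≤ ∑ j ∈ Finset.range J, ((if t (j + 1) - t j < σ then σ else 0) + (t (j + 1) - t j)) := by
      refine Finset.sum_le_sum fun j hj => ?_
      have := ht j (Finset.mem_range.1 hj)
      split_ifs <;> linarith
    _ = σ * (shortLevels J t σ).card + (t J - t 0) := by
      rw [Finset.sum_add_distrib, Finset.sum_range_sub, ← Finset.sum_filter, Finset.sum_const,
        nsmul_eq_mul, mul_comm, shortLevels]

end ShortLevels

section Arcs

variable {E : Type*} [NormedAddCommGroup E] [NormedSpace ℝ E] {ℋ : HybridSystem E}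
  {φ : ℝ → ℕ → E} {S : Set (ℝ × ℕ)} {J i j k : ℕ} {t : ℕ → ℝ} {a σ : ℝ}

/-- A hybrid arc with finitely many levels `0, …, J`, where level `j` is the time interval
`[t j, t (j + 1)]`, that satisfies the flow and jump conditions of `ℋ`. -/
structure IsArc (ℋ : HybridSystem E) (J : ℕ) (t : ℕ → ℝ) (φ : ℝ → ℕ → E) : Prop where
  le : ∀ j ≤ J, t j ≤ t (j + 1)
  absCont : ∀ j ≤ J, AbsolutelyContinuousOnInterval (fun s => φ s j) (t j) (t (j + 1))
  mem : ∀ j ≤ J, ∀ s ∈ Icc (t j) (t (j + 1)), φ s j ∈ closure ℋ.flowSet ∪ ℋ.jumpSet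
  flow : ∀ j ≤ J, ∀ᵐ s : ℝ, s ∈ Ioo (t j) (t (j + 1)) →
    ∃ v ∈ ℋ.flowMap (φ s j), HasDerivAt (fun r => φ r j) v s
  jump : ∀ j < J, φ (t (j + 1)) j ∈ ℋ.jumpSet ∧
    φ (t (j + 1)) (j + 1) ∈ ℋ.jumpMap (φ (t (j + 1)) j)

namespace IsArc

theorem monotone (h : IsArc ℋ J t φ) (hij : i ≤ j) (hj : j ≤ J + 1) : t i ≤ t j := by
  induction j, hij using Nat.le_induction with
  | base => exact le_rfl
  | succ j _ ih => exact (ih (by omega)).trans (h.le j (by omega))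

theorem take (h : IsArc ℋ J t φ) (hk : k ≤ J) : IsArc ℋ k t φ where
  le j hj := h.le j (hj.trans hk)
  absCont j hj := h.absCont j (hj.trans hk)
  mem j hj := h.mem j (hj.trans hk)
  flow j hj := h.flow j (hj.trans hk)
  jump j hj := h.jump j (hj.trans_le hk)

theorem tail (h : IsArc ℋ J t φ) (hk : k ≤ J) :
    IsArc ℋ (J - k) (fun i => t (i + k)) (fun s j => φ s (j + k)) := by
  constructor <;> intro j hj <;> simp only [add_right_comm j 1 k]
  exacts [h.le _ (by omega), h.absCont _ (by omega), h.mem _ (by omega), h.flow _ (by omega),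
    h.jump _ (by omega)]

end IsArc

theorem mem_irregularJumps_of_mem_shortLevels (hS : IsNonbranching S)
    (hmem : ∀ s, ∀ j ≤ k, (s, j) ∈ S ∧ s ≤ t (k + 1) ↔ s ∈ Icc (t j) (t (j + 1)))
    (hmono : Monotone t) (hj : j ∈ shortLevels k t σ) : j ∈ SPSystem.irregularJumps S σ := by
  obtain ⟨hjk, hshort⟩ := mem_shortLevels.1 hj
  have hend : (t (j + 1), j) ∈ S :=
    ((hmem _ j hjk.le).2 ⟨hmono (Nat.le_succ j), le_rfl⟩).1
  have hnext : (t (j + 1), j + 1) ∈ S :=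
    ((hmem _ (j + 1) hjk).2 ⟨le_rfl, hmono (Nat.le_succ _)⟩).1
  have hlevel : ∀ r, (r, j) ∈ S → r ∈ Icc (t j) (t (j + 1)) := fun r hr =>
    (hmem r j hjk.le).1 ⟨hr, (hS hend hnext hr).trans (hmono (by omega))⟩
  refine ⟨⟨_, hend, hnext⟩, lt_of_le_of_lt (csSup_le ⟨_, _, _, hend, hend, rfl⟩ ?_) hshort⟩
  rintro _ ⟨r, r', hr, hr', rfl⟩
  exact abs_sub_le_of_le_of_le (hlevel r hr).1 (hlevel r hr).2 (hlevel r' hr').1 (hlevel r' hr').2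

theorem IsSolution.exists_isArc (h : IsSolution ℋ S φ)
    (hG : ∀ x ∈ ℋ.jumpSet, ℋ.jumpMap x ⊆ ℋ.flowSet) (hS : IsNonbranching S) (hak : (a, k) ∈ S)
    (σ : ℝ) : ∃ t : ℕ → ℝ, t 0 = 0 ∧ t (k + 1) = a ∧ IsArc ℋ k t φ ∧
      (∀ j ≤ k, ∀ s ∈ Icc (t j) (t (j + 1)), (s, j) ∈ S ∧ s ≤ a) ∧
      ∀ j ∈ shortLevels k t σ, j ∈ SPSystem.irregularJumps S σ := by
  obtain ⟨t, ht0, hmono, rfl, hiff⟩ := h.isHybridTimeDomain.exists_times hak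
  have hmem : ∀ s, ∀ j ≤ k, (s, j) ∈ S ∧ s ≤ t (k + 1) ↔ s ∈ Icc (t j) (t (j + 1)) := by
    intro s j hj
    simpa [hj] using hiff s j
  have hleft : ∀ j ≤ k, (t j, j) ∈ S := fun j hj =>
    ((hmem _ j hj).2 ⟨le_rfl, hmono (Nat.le_succ j)⟩).1
  have hright : ∀ j ≤ k, (t (j + 1), j) ∈ S := fun j hj =>
    ((hmem _ j hj).2 ⟨hmono (Nat.le_succ j), le_rfl⟩).1
  refine ⟨t, ht0, rfl, ⟨fun j _ => hmono (Nat.le_succ j), fun j hj => ?_, fun j hj s hs => ?_,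
    fun j hj => ?_, fun j hj => ?_⟩, fun j hj s hs => (hmem s j hj).2 hs,
    fun j => mem_irregularJumps_of_mem_shortLevels hS hmem hmono⟩
  · exact h.absCont j _ _ (hmono (Nat.le_succ j)) (hleft j hj) (hright j hj)
  · exact h.mem_closure_union hG ((hmem s j hj).2 hs).1
  · exact h.flow j _ _ (hleft j hj) (hright j hj)
  · exact h.jump j _ (hright j hj.le) (hleft (j + 1) hj)

end Arcs

/-! ### From arcs to practical stability -/

section Stability

variable {E : Type*} [NormedAddCommGroup E] [NormedSpace ℝ E] {ℋ : HybridSystem E} {A : Set E}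
  {σ r R δ Δ T T₀ : ℝ} {k N : ℕ}

/-- Arcs with at most `k` short levels that start within `r` of `A` end within `R` of `A`. -/
def ArcsBounded (ℋ : HybridSystem E) (A : Set E) (σ : ℝ) (k : ℕ) (r R : ℝ) : Prop :=
  ∀ ⦃J t φ⦄, IsArc ℋ J t φ → (shortLevels J t σ).card ≤ k →
    Metric.infDist (φ (t 0) 0) A ≤ r → Metric.infDist (φ (t (J + 1)) J) A ≤ R

/-- Arcs with at most `k` short levels that start within `R` of `A` come within `r` of `A` if they
continue for a time `T` after their last short level, which ends before `T'`. -/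
def ArcsReach (ℋ : HybridSystem E) (A : Set E) (σ : ℝ) (k : ℕ) (R r T : ℝ) : Prop :=
  ∀ ⦃J t φ⦄, IsArc ℋ J t φ → (shortLevels J t σ).card ≤ k → Metric.infDist (φ (t 0) 0) A ≤ R →
    ∀ T', t 0 ≤ T' → (∀ j ∈ shortLevels J t σ, t (j + 1) ≤ T') → T' + T ≤ t (J + 1) →
      ∃ j ≤ J, ∃ s ∈ Icc (t j) (t (j + 1)), Metric.infDist (φ s j) A ≤ r

/-- Points of the jump set within `r` of `A` are mapped to points within `R` of `A`. -/
def JumpsBounded (ℋ : HybridSystem E) (A : Set E) (r R : ℝ) : Prop :=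
  ∀ x ∈ ℋ.jumpSet, Metric.infDist x A ≤ r → ∀ g ∈ ℋ.jumpMap x, Metric.infDist g A ≤ R

theorem ArcsBounded.infDist_jump_le {r' R' : ℝ} (h : ArcsBounded ℋ A σ 0 r r')
    (hjump : JumpsBounded ℋ A r' R') {J j : ℕ} {t : ℕ → ℝ} {φ : ℝ → ℕ → E} (hφ : IsArc ℋ J t φ)
    (hj : j < J) (hempty : shortLevels j t σ = ∅) (hstart : Metric.infDist (φ (t 0) 0) A ≤ r) :
    Metric.infDist (φ (t (0 + (j + 1))) (0 + (j + 1))) A ≤ R' := by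
  rw [Nat.zero_add]
  exact hjump _ (hφ.jump j hj).1 (h (hφ.take hj.le) (by simp [hempty]) hstart) _ (hφ.jump j hj).2

theorem ArcsBounded.succ {r' R' : ℝ} (hhead : ArcsBounded ℋ A σ 0 r (min R r'))
    (hjump : JumpsBounded ℋ A r' R') (htail : ArcsBounded ℋ A σ k R' R) :
    ArcsBounded ℋ A σ (k + 1) r R := by
  intro J t φ hφ hcard hstart
  by_cases hempty : shortLevels J t σ = ∅
  · exact (hhead hφ (by simp [hempty]) hstart).trans (min_le_left _ _)
  · obtain ⟨j, hj, hj_empty⟩ := exists_mem_shortLevels_of_ne_empty hempty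
    have hjJ := (mem_shortLevels.1 hj).1
    have hend := htail (hφ.tail (k := j + 1) hjJ)
      (by have := card_shortLevels_tail_lt hj; omega)
      (ArcsBounded.infDist_jump_le
        (fun _ _ _ h hc hs => (hhead h hc hs).trans (min_le_right _ _)) hjump hφ hjJ hj_empty
        hstart)
    simpa only [show J - (j + 1) + 1 + (j + 1) = J + 1 by omega,
      show J - (j + 1) + (j + 1) = J by omega] using hend

theorem ArcsReach.succ {r' R' T' : ℝ} (hhead : ArcsReach ℋ A σ 0 R r T)
    (hbound : ArcsBounded ℋ A σ 0 R r') (hjump : JumpsBounded ℋ A r' R')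
    (htail : ArcsReach ℋ A σ k R' r T') : ArcsReach ℋ A σ (k + 1) R r (max T T') := by
  intro J t φ hφ hcard hstart T₁ hT₁ hshort hlate
  by_cases hempty : shortLevels J t σ = ∅
  · exact hhead hφ (by simp [hempty]) hstart T₁ hT₁ hshort
      ((add_le_add_right (le_max_left _ _) _).trans hlate)
  · obtain ⟨j, hj, hj_empty⟩ := exists_mem_shortLevels_of_ne_empty hempty
    have hjJ := (mem_shortLevels.1 hj).1
    obtain ⟨i, hi, s, hs, hsr⟩ := htail (hφ.tail (k := j + 1) hjJ)
      (by have := card_shortLevels_tail_lt hj; omega)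
      (hbound.infDist_jump_le hjump hφ hjJ hj_empty hstart) T₁ (by simpa using hshort j hj)
      (fun i hi => by
        rw [add_right_comm]
        exact hshort _ (add_mem_shortLevels hi))
      (by
        rw [show J - (j + 1) + 1 + (j + 1) = J + 1 by omega]
        exact (add_le_add_right (le_max_right _ _) _).trans hlate)
    rw [add_right_comm] at hs
    exact ⟨i + (j + 1), by omega, s, hs, hsr⟩

/-- The properties of the solutions of `ℋ` that relate them to arcs with few short levels: the jump
map takes values in the flow set, and solutions that start within `Δ` of `A` have at most `N`
`σ`-irregular jumps, all of them up to the time `T₀`. -/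
structure RegularSolutions (ℋ : HybridSystem E) (A : Set E) (σ Δ : ℝ) (N : ℕ) (T₀ : ℝ) : Prop where
  pos : 0 < σ
  jumpMap_subset : ∀ x ∈ ℋ.jumpSet, ℋ.jumpMap x ⊆ ℋ.flowSet
  isNonbranching : ∀ S φ, IsSolution ℋ S φ → IsNonbranching S
  encard_le : ∀ S φ, IsSolution ℋ S φ → Metric.infDist (φ 0 0) A ≤ Δ →
    (SPSystem.irregularJumps S σ).encard ≤ N
  le_time : ∀ S φ, IsSolution ℋ S φ → Metric.infDist (φ 0 0) A ≤ Δ →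
    ∀ j ∈ SPSystem.irregularJumps S σ, ∀ t, (t, j) ∈ S → t ≤ T₀

namespace RegularSolutions

variable {S : Set (ℝ × ℕ)} {φ : ℝ → ℕ → E}

theorem exists_isArc (h : RegularSolutions ℋ A σ Δ N T₀) (hφ : IsSolution ℋ S φ)
    (hstart : Metric.infDist (φ 0 0) A ≤ Δ) {a : ℝ} (hak : (a, k) ∈ S) :
    ∃ t : ℕ → ℝ, t 0 = 0 ∧ t (k + 1) = a ∧ IsArc ℋ k t φ ∧ (shortLevels k t σ).card ≤ N ∧
      (∀ j ∈ shortLevels k t σ, t (j + 1) ≤ T₀) ∧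
      ∀ j ≤ k, ∀ s ∈ Icc (t j) (t (j + 1)), (s, j) ∈ S ∧ s ≤ a := by
  obtain ⟨t, ht0, hta, harc, hmem, hirr⟩ :=
    hφ.exists_isArc h.jumpMap_subset (h.isNonbranching S φ hφ) hak σ
  refine ⟨t, ht0, hta, harc, ?_, fun j hj => ?_, hmem⟩
  · have henc := (encard_le_encard (s := (shortLevels k t σ : Set ℕ)) hirr).trans
      (h.encard_le S φ hφ hstart)
    rw [encard_coe_eq_coe_finsetCard] at henc
    exact_mod_cast henc
  · have hjk := (mem_shortLevels.1 hj).1.le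
    exact h.le_time S φ hφ hstart j (hirr j hj) _
      (hmem j hjk _ (right_mem_Icc.2 (harc.le j hjk))).1

theorem infDist_le (h : RegularSolutions ℋ A σ Δ N T₀) (harcs : ArcsBounded ℋ A σ N r R)
    (hrΔ : r ≤ Δ) (hφ : IsSolution ℋ S φ) {p q : ℝ × ℕ} (hp : p ∈ S) (hq : q ∈ S)
    (hpq : p ≤ q) (hstart : Metric.infDist (φ p.1 p.2) A ≤ r) :
    Metric.infDist (φ q.1 q.2) A ≤ R := by
  have hshift := hφ.shift h.jumpMap_subset hp
  obtain ⟨b, hb⟩ := exists_add_of_le hpq.2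
  have hmem : (q.1 - p.1, b) ∈ shiftDomain S p.1 p.2 :=
    ⟨sub_nonneg.2 hpq.1, by simpa [add_comm b, ← hb] using hq⟩
  have hstart' : Metric.infDist (φ (0 + p.1) (0 + p.2)) A ≤ r := by simpa using hstart
  obtain ⟨t, ht0, hta, harc, hcard, -⟩ := h.exists_isArc hshift (hstart'.trans hrΔ) hmem
  have hend := harcs harc hcard (by rwa [ht0])
  rwa [hta, sub_add_cancel, add_comm b, ← hb] at hend

theorem semiGlobalStable (h : RegularSolutions ℋ A σ Δ N T₀) (harcs : ArcsBounded ℋ A σ N r δ)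
    (hr : 0 < r) (hrΔ : r ≤ Δ) : SemiGlobalStable δ ℋ A := by
  refine fun R hR => ⟨r, hr, fun S φ hφ p hp q hq hpq hstart => ?_⟩
  have hle := hφ.isHybridTimeDomain.le_of_add_le (h.isNonbranching S φ hφ) hp hq hpq
  exact (h.infDist_le harcs hrΔ hφ hp hq hle hstart).trans hR

theorem time_ge (h : RegularSolutions ℋ A σ Δ N T₀) (hφ : IsSolution ℋ S φ)
    (hstart : Metric.infDist (φ 0 0) A ≤ Δ) {q : ℝ × ℕ} (hq : q ∈ S) {X : ℝ}
    (hX : X + (N + X / σ) ≤ q.1 + (q.2 : ℝ)) : X ≤ q.1 := by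
  by_contra! hlt
  obtain ⟨t, ht0, hta, harc, hcard, -⟩ := h.exists_isArc hφ hstart (a := q.1) (k := q.2) hq
  have hjumps := mul_le_mul_card_shortLevels_add (σ := σ) q.2 t fun j hj => harc.le j hj.le
  have hcard' : ((shortLevels q.2 t σ).card : ℝ) ≤ N := by exact_mod_cast hcard
  have hle : (q.2 : ℝ) ≤ N + q.1 / σ := by
    rw [← sub_le_iff_le_add', le_div_iff₀ h.pos]
    have := mul_le_mul_of_nonneg_left hcard' h.pos.le
    linarith [harc.le q.2 le_rfl]
  have := div_lt_div_of_pos_right hlt h.pos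
  linarith

theorem exists_infDist_le (h : RegularSolutions ℋ A σ Δ N T₀) (harcs : ArcsReach ℋ A σ N Δ r T)
    (hφ : IsSolution ℋ S φ) (hstart : Metric.infDist (φ 0 0) A ≤ Δ) {q : ℝ × ℕ} (hq : q ∈ S)
    (hlate : max T₀ 0 + T ≤ q.1) : ∃ p ∈ S, p ≤ q ∧ Metric.infDist (φ p.1 p.2) A ≤ r := by
  obtain ⟨t, ht0, hta, harc, hcard, hshort, hmem⟩ :=
    h.exists_isArc hφ hstart (a := q.1) (k := q.2) hq
  obtain ⟨j, hj, s, hs, hsr⟩ := harcs harc hcard (by rwa [ht0]) (max T₀ 0)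
    (ht0 ▸ le_max_right _ _) (fun j hj => (hshort j hj).trans (le_max_left _ _)) (hta ▸ hlate)
  obtain ⟨hsS, hsq⟩ := hmem j hj s hs
  exact ⟨(s, j), hsS, ⟨hsq, hj⟩, hsr⟩

theorem practicallyAttractive (h : RegularSolutions ℋ A σ Δ N T₀)
    (hbounded : ArcsBounded ℋ A σ N r δ) (hrΔ : r ≤ Δ) (hreach : ArcsReach ℋ A σ N Δ r T)
    (hT : 0 ≤ T) : PracticallyAttractive δ Δ ℋ A := by
  rintro R r' hRΔ - hδr'
  set X := max T₀ 0 + T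
  have hT₁ : 0 ≤ X + (N + X / σ) := by
    have hX : 0 ≤ X := add_nonneg (le_max_right _ _) hT
    exact add_nonneg hX (add_nonneg N.cast_nonneg (div_nonneg hX h.pos.le))
  refine ⟨X + (N + X / σ), hT₁, fun S φ hφ p hp q hq hpq hstart => ?_⟩
  have hle := hφ.isHybridTimeDomain.le_of_add_le (h.isNonbranching S φ hφ) hp hq
    ((le_add_of_nonneg_left hT₁).trans hpq)
  obtain ⟨b, hb⟩ := exists_add_of_le hle.2
  have hshift := hφ.shift h.jumpMap_subset hp
  have hmem : (q.1 - p.1, b) ∈ shiftDomain S p.1 p.2 :=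
    ⟨sub_nonneg.2 hle.1, by simpa [add_comm b, ← hb] using hq⟩
  have hstart' : Metric.infDist (φ (0 + p.1) (0 + p.2)) A ≤ Δ := by simpa using hstart.trans hRΔ
  have hlate : X + (N + X / σ) ≤ q.1 - p.1 + (b : ℝ) := by
    rw [hb, Nat.cast_add] at hpq
    linarith
  obtain ⟨p', hp', hp'q, hp'r⟩ := h.exists_infDist_le hreach hshift hstart' hmem
    (h.time_ge hshift hstart' hmem hlate)
  have hend := h.infDist_le hbounded hrΔ hshift hp' hmem hp'q hp'r
  rw [sub_add_cancel, add_comm b, ← hb] at hend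
  exact hend.trans hδr'

end RegularSolutions

end Stability

/-! ### Arcs with two time scales -/

section TwoScaleArcs

variable {E : Type*} [NormedAddCommGroup E] [NormedSpace ℝ E] {ℋ : HybridSystem E}
  {V₁ V₂ : E → ℝ} {J j : ℕ} {t : ℕ → ℝ} {φ : ℝ → ℕ → E} {σ : ℝ}

namespace TwoScaleBounds

/-- The conditions on the flow of `ℋ` under which the slow Lyapunov function `V₁` and the fast
Lyapunov function `V₂` satisfy the differential inequalities of `P`. -/
def FlowCondition (P : TwoScaleBounds) (ℋ : HybridSystem E) (V₁ V₂ : E → ℝ) : Prop :=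
  ∀ x ∈ closure ℋ.flowSet ∪ ℋ.jumpSet, V₁ x ≤ P.b₁ + P.ν → V₂ x ≤ P.W → ∀ f ∈ ℋ.flowMap x,
    fderiv ℝ V₁ x f ≤ P.L ∧ (P.ℓ₂ < V₂ x → fderiv ℝ V₂ x f ≤ -P.c₂) ∧
      (V₂ x ≤ P.ℓ₂ → P.ℓ₁ < V₁ x → fderiv ℝ V₁ x f ≤ -P.c)

/-- Jumps that occur after the fast Lyapunov function has settled below `P.ℓ₂` compensate the
increase of the slow Lyapunov function before it has settled. -/
def JumpCondition (P : TwoScaleBounds) (ℋ : HybridSystem E) (V₁ V₂ : E → ℝ) : Prop :=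
  ∀ x ∈ ℋ.jumpSet, V₁ x ≤ P.b₁ + P.ν → V₂ x ≤ P.ℓ₂ → ∀ g ∈ ℋ.jumpMap x,
    V₂ g ≤ P.b₂ ∧ V₁ g ≤ max (V₁ x - (P.c + P.L) * P.κ) P.ℓ₁

/-- The bound on the slow Lyapunov function after a time `s` of flow. -/
def slowBound (P : TwoScaleBounds) (s : ℝ) : ℝ := max (P.b₁ - P.c * s) P.ℓ₁

theorem slowBound_zero (P : TwoScaleBounds) : P.slowBound 0 = P.b₁ := by
  simp [slowBound, P.ℓ₁_le]

theorem slowBound_le (P : TwoScaleBounds) {s : ℝ} (hs : 0 ≤ s) : P.slowBound s ≤ P.b₁ :=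
  max_le (sub_le_self _ (mul_nonneg P.c_nonneg hs)) P.ℓ₁_le

theorem slowBound_sub_le (P : TwoScaleBounds) (s r : ℝ) (hr : 0 ≤ r) :
    max (P.slowBound s - P.c * r) P.ℓ₁ ≤ P.slowBound (s + r) := by
  have hcr := mul_nonneg P.c_nonneg hr
  refine max_le ?_ (le_max_right _ _)
  rw [slowBound, ← max_sub_sub_right, sub_sub, ← mul_add]
  exact max_le_max_left _ (sub_le_self _ hcr)

variable {P : TwoScaleBounds}

theorem FlowCondition.ae_decayAt (hV₁ : ContDiff ℝ 1 V₁) (hV₂ : ContDiff ℝ 1 V₂)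
    (hflow : P.FlowCondition ℋ V₁ V₂) (h : IsArc ℋ J t φ) (hj : j ≤ J) :
    ∀ᵐ s : ℝ, s ∈ Ioo (t j) (t (j + 1)) → V₁ (φ s j) ≤ P.b₁ + P.ν → V₂ (φ s j) ≤ P.W →
      P.DecayAt (fun s => V₁ (φ s j)) (fun s => V₂ (φ s j)) s := by
  filter_upwards [h.flow j hj] with s hs hmem h₁ h₂
  obtain ⟨f, hf, hderiv⟩ := hs hmem
  exact ⟨_, _, (hV₁.differentiable one_ne_zero _).hasFDerivAt.comp_hasDerivAt s hderiv,
    (hV₂.differentiable one_ne_zero _).hasFDerivAt.comp_hasDerivAt s hderiv,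
    hflow _ (h.mem j hj s (Ioo_subset_Icc_self hmem)) h₁ h₂ f hf⟩

theorem FlowCondition.level_bounds (hV₁ : ContDiff ℝ 1 V₁) (hV₂ : ContDiff ℝ 1 V₂)
    (hflow : P.FlowCondition ℋ V₁ V₂) (h : IsArc ℋ J t φ) (hj : j ≤ J)
    (h₁ : V₁ (φ (t j) j) ≤ P.slowBound (t j - t 0)) (h₂ : V₂ (φ (t j) j) ≤ P.b₂) :
    V₂ (φ (t (j + 1)) j) ≤ P.b₂ ∧ (t j + P.κ ≤ t (j + 1) → V₂ (φ (t (j + 1)) j) ≤ P.ℓ₂) ∧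
      V₁ (φ (t (j + 1)) j) ≤ P.slowBound (t (j + 1) - t 0) + (P.c + P.L) * P.κ := by
  have hle := h.le j hj
  obtain ⟨hfast, hsettled, hslow⟩ := P.bounds_of_ae_decayAt hle
    (absolutelyContinuousOnInterval_comp_contDiff hV₁ (h.absCont j hj))
    (absolutelyContinuousOnInterval_comp_contDiff hV₂ (h.absCont j hj))
    (P.slowBound_le (sub_nonneg.2 (h.monotone j.zero_le (by omega)))) h₁ h₂
    (hflow.ae_decayAt hV₁ hV₂ h hj)
  refine ⟨hfast, hsettled, hslow.trans (add_le_add_left ?_ _)⟩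
  exact (P.slowBound_sub_le _ _ (sub_nonneg.2 hle)).trans_eq (by rw [add_comm, sub_add_sub_cancel])

theorem bounds_level_start (hV₁ : ContDiff ℝ 1 V₁) (hV₂ : ContDiff ℝ 1 V₂)
    (hflow : P.FlowCondition ℋ V₁ V₂) (hjump : P.JumpCondition ℋ V₁ V₂) (hκ : P.κ ≤ σ)
    (h : IsArc ℋ J t φ) (hreg : shortLevels J t σ = ∅)
    (h₁ : V₁ (φ (t 0) 0) ≤ P.b₁) (h₂ : V₂ (φ (t 0) 0) ≤ P.b₂) (hj : j ≤ J) :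
    V₁ (φ (t j) j) ≤ P.slowBound (t j - t 0) ∧ V₂ (φ (t j) j) ≤ P.b₂ := by
  induction j with
  | zero => simpa [slowBound_zero] using ⟨h₁, h₂⟩
  | succ j ih =>
    obtain ⟨hslow, hfast⟩ := ih (by omega)
    obtain ⟨-, hsettled, hend⟩ := hflow.level_bounds hV₁ hV₂ h (by omega) hslow hfast
    have hlong : t j + P.κ ≤ t (j + 1) := by
      have : j ∉ shortLevels J t σ := by simp [hreg]
      simp only [mem_shortLevels, not_and, not_lt] at this
      linarith [this hj]
    have hb := P.slowBound_le (sub_nonneg.2 (h.monotone (j + 1).zero_le (by omega)))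
    obtain ⟨hjump_fast, hjump_slow⟩ := hjump _ (h.jump j hj).1
      (hend.trans (add_le_add hb P.delay_lt.le)) (hsettled hlong) _ (h.jump j hj).2
    exact ⟨hjump_slow.trans (max_le (by linarith) (le_max_right _ _)), hjump_fast⟩

theorem arc_bounds (hV₁ : ContDiff ℝ 1 V₁) (hV₂ : ContDiff ℝ 1 V₂)
    (hflow : P.FlowCondition ℋ V₁ V₂) (hjump : P.JumpCondition ℋ V₁ V₂) (hκ : P.κ ≤ σ)
    (h : IsArc ℋ J t φ) (hreg : shortLevels J t σ = ∅)
    (h₁ : V₁ (φ (t 0) 0) ≤ P.b₁) (h₂ : V₂ (φ (t 0) 0) ≤ P.b₂) :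
    V₂ (φ (t (J + 1)) J) ≤ P.b₂ ∧ (t J + P.κ ≤ t (J + 1) → V₂ (φ (t (J + 1)) J) ≤ P.ℓ₂) ∧
      V₁ (φ (t (J + 1)) J) ≤ P.slowBound (t (J + 1) - t 0) + P.ν := by
  obtain ⟨hslow, hfast⟩ := bounds_level_start hV₁ hV₂ hflow hjump hκ h hreg h₁ h₂ le_rfl
  obtain ⟨hfast', hsettled, hslow'⟩ := hflow.level_bounds hV₁ hV₂ h le_rfl hslow hfast
  exact ⟨hfast', hsettled, hslow'.trans (add_le_add_right P.delay_lt.le _)⟩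

end TwoScaleBounds

end TwoScaleArcs

section Slow

variable {E₁ E₂ : Type*} [NormedAddCommGroup E₁] [NormedSpace ℝ E₁] [NormedAddCommGroup E₂]
  [NormedSpace ℝ E₂] {V : E₁ → ℝ}

theorem contDiff_comp_fst (hV : ContDiff ℝ 1 V) :
    ContDiff ℝ 1 fun x : WithLp 2 (E₁ × E₂) => V x.fst :=
  hV.comp (WithLp.fstL 2 ℝ E₁ E₂).contDiff

theorem fderiv_comp_fst (hV : Differentiable ℝ V) (x f : WithLp 2 (E₁ × E₂)) :
    fderiv ℝ (fun x : WithLp 2 (E₁ × E₂) => V x.fst) x f = fderiv ℝ V x.fst f.fst := by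
  have hfst : HasFDerivAt (fun x : WithLp 2 (E₁ × E₂) => x.fst) (WithLp.fstL 2 ℝ E₁ E₂) x :=
    (WithLp.fstL 2 ℝ E₁ E₂).hasFDerivAt
  have hcomp : fderiv ℝ (fun x : WithLp 2 (E₁ × E₂) => V x.fst) x = _ :=
    ((hV x.fst).hasFDerivAt.comp x hfst).fderiv
  rw [hcomp]
  rfl

end Slow

/-! ### Neighbourhoods of compact sets -/

section Neighbourhoods

variable {X Y Z : Type*} [MetricSpace Z] {K T T' : Set Z}

theorem mem_of_infDist_le_zero (hK : IsCompact K) (hne : K.Nonempty) {x : Z}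
    (hx : Metric.infDist x K ≤ 0) : x ∈ K :=
  (hK.isClosed.mem_iff_infDist_zero hne).2 (hx.antisymm Metric.infDist_nonneg)

variable [ProperSpace Z]

theorem isCompact_infDist_le (hK : IsCompact K) (hne : K.Nonempty) (r : ℝ) :
    IsCompact {x | Metric.infDist x K ≤ r} := by
  refine Metric.isCompact_of_isClosed_isBounded
    (isClosed_le (Metric.continuous_infDist_pt K) continuous_const) ?_
  refine (hK.isBounded.thickening (δ := r + 1)).subset fun x hx => ?_
  rw [Metric.mem_thickening_iff_infDist_lt hne]
  exact hx.trans_lt (lt_add_one r)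

variable [MetricSpace X] [MetricSpace Y] {Φ : X × Z → Set Y} {P S : Set X}

theorem isBounded_iUnion_infDist_le (hbdd : LocallyBoundedOn Φ (S ×ˢ T)) (hP : IsCompact P)
    (hPS : P ⊆ S) (hT : IsClosed T) (hK : IsCompact K) (hne : K.Nonempty) (r : ℝ) :
    Bornology.IsBounded (⋃ q ∈ P ×ˢ ({x | Metric.infDist x K ≤ r} ∩ T), Φ q) :=
  hbdd.isBounded_iUnion (hP.prod ((isCompact_infDist_le hK hne r).inter_right hT))
    (prod_mono hPS inter_subset_right)

theorem exists_pos_forall_of_infDist_le [ProperSpace Y] (hosc : OuterSemicontOn Φ (S ×ˢ T))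
    (hbdd : LocallyBoundedOn Φ (S ×ˢ T)) (hP : IsCompact P) (hPS : P ⊆ S) (hT' : IsClosed T')
    (hTT' : T' ⊆ T) (hK : IsCompact K) (hne : K.Nonempty) {h : (X × Z) × Y → ℝ}
    (hh : Continuous h) (hlt : ∀ p ∈ P, ∀ x ∈ K ∩ T', ∀ y ∈ Φ (p, x), h ((p, x), y) < 0) :
    ∃ η > 0, ∀ p ∈ P, ∀ x ∈ T', Metric.infDist x K ≤ η → ∀ y ∈ Φ (p, x), h ((p, x), y) < 0 := by
  obtain ⟨η, hη, hnear⟩ := exists_pos_forall_of_outerSemicontOn hosc hbdd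
    (hP.prod ((isCompact_infDist_le hK hne 1).inter_right hT'))
    (prod_mono hPS (inter_subset_right.trans hTT'))
    (f := fun q => Metric.infDist q.2 K) ((Metric.continuous_infDist_pt K).comp continuous_snd) hh
    fun q hq hqK => hlt q.1 hq.1 q.2 ⟨mem_of_infDist_le_zero hK hne hqK, hq.2.2⟩
  exact ⟨min η 1, lt_min hη one_pos, fun p hp x hx hxK =>
    hnear (p, x) ⟨hp, hxK.trans (min_le_right _ _), hx⟩ (hxK.trans (min_le_left _ _))⟩

end Neighbourhoods

/-! ### Geometry of the boundary layer manifold -/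

namespace SPSystem

variable {n m l : ℕ} {Sys : SPSystem n m l} {A K : Set (Slow n)}
  {H₁ : Slow n → Set (EuclideanSpace ℝ (Fin m))} {β₀ γ₀ θ₀ ρ : ℝ}

theorem dist_boundedPart_le (x y : State n m l) :
    dist (boundedPart x) (boundedPart y) ≤ dist x y := by
  have hsnd : ‖(x - y).snd‖ ≤ ‖x - y‖ := WithLp.norm_snd_le _ _
  have hsnd_fst : ‖(x - y).snd.fst‖ ≤ ‖(x - y).snd‖ := WithLp.norm_fst_le _ _
  rw [Prod.dist_eq, dist_eq_norm, dist_eq_norm, dist_eq_norm]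
  exact max_le (WithLp.norm_fst_le _ (x - y)) (hsnd_fst.trans hsnd)

/-- The state obtained from `x` by replacing its components `(x₁, x₂')` by `p`. -/
def withBoundedPart (x : State n m l) (p : Slow n × EuclideanSpace ℝ (Fin m)) : State n m l :=
  WithLp.toLp 2 (p.1, WithLp.toLp 2 (p.2, x.snd.snd))

theorem dist_withBoundedPart_le (x : State n m l) (p : Slow n × EuclideanSpace ℝ (Fin m)) :
    dist x (withBoundedPart x p) ≤ 2 * dist (boundedPart x) p := by
  have hfst : dist x.fst p.1 ^ 2 ≤ dist (boundedPart x) p ^ 2 := by gcongr; exact le_max_left _ _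
  have hsnd : dist x.snd.fst p.2 ^ 2 ≤ dist (boundedPart x) p ^ 2 := by
    gcongr; exact le_max_right _ _
  have hfast : dist x.snd (withBoundedPart x p).snd = dist x.snd.fst p.2 := by
    rw [WithLp.prod_dist_eq_of_L2]
    simp [withBoundedPart, Real.sqrt_sq dist_nonneg]
  rw [WithLp.prod_dist_eq_of_L2, hfast]
  change √(dist x.fst p.1 ^ 2 + _) ≤ _
  exact Real.sqrt_le_iff.2 ⟨by positivity, by nlinarith⟩

/-- The graph of `H₁` over `K`. The fast variables `x₂''` do not occur in it, so it is compact for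
compact `K`, unlike the set of steady states over `K`. -/
def equilibriumGraph (H₁ : Slow n → Set (EuclideanSpace ℝ (Fin m))) (K : Set (Slow n)) :
    Set (Slow n × EuclideanSpace ℝ (Fin m)) := {p | p.1 ∈ K ∧ p.2 ∈ H₁ p.1}

theorem manifold_eq_attractor (ρ : ℝ) :
    Sys.manifold A H₁ ρ = Sys.attractor (Sys.tube A ρ) H₁ := rfl

theorem infDist_equilibriumGraph_le (hne : (Sys.attractor K H₁).Nonempty) (x : State n m l) :
    Metric.infDist (boundedPart x) (equilibriumGraph H₁ K) ≤
      Metric.infDist x (Sys.attractor K H₁) :=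
  (Metric.le_infDist hne).2 fun {y} hy =>
    have hmem : boundedPart y ∈ equilibriumGraph H₁ K := ⟨hy.1, hy.2.1⟩
    (Metric.infDist_le_dist_of_mem hmem).trans (dist_boundedPart_le x y)

theorem infDist_fst_le (hne : (Sys.attractor K H₁).Nonempty) (x : State n m l) :
    Metric.infDist x.fst K ≤ Metric.infDist x (Sys.attractor K H₁) :=
  (Metric.le_infDist hne).2 fun {y} hy => (Metric.infDist_le_dist_of_mem hy.1).trans
    ((le_max_left _ _).trans (dist_boundedPart_le x y))

theorem infDist_attractor_le_two_mul (hne : (equilibriumGraph H₁ K).Nonempty) {x : State n m l}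
    (hx : x.snd.snd ∈ Sys.X₂'') : Metric.infDist x (Sys.attractor K H₁) ≤
      2 * Metric.infDist (boundedPart x) (equilibriumGraph H₁ K) := by
  rw [← div_le_iff₀' two_pos]
  refine (Metric.le_infDist hne).2 fun {p} hp => ?_
  rw [div_le_iff₀' two_pos]
  have hmem : withBoundedPart x p ∈ Sys.attractor K H₁ := ⟨hp.1, hp.2, hx⟩
  exact (Metric.infDist_le_dist_of_mem hmem).trans (dist_withBoundedPart_le x p)

theorem mem_slowVelocities {β γ θ : ℝ} {x f : State n m l} (hx : x ∈ Sys.C)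
    (hf : f ∈ Sys.F β γ θ x) : f.fst ∈ Sys.slowVelocities γ θ (β, boundedPart x) :=
  ⟨x, hx, rfl, f, hf, rfl⟩

/-- The assumptions on the system other than those on the Lyapunov functions and on the regularity
of the jumps. -/
structure Standing (Sys : SPSystem n m l) (A : Set (Slow n))
    (H₁ : Slow n → Set (EuclideanSpace ℝ (Fin m))) (β₀ γ₀ θ₀ : ℝ) : Prop where
  β₀_pos : 0 < β₀
  γ₀_pos : 0 < γ₀
  θ₀_pos : 0 < θ₀
  isCompact : IsCompact A
  nonempty : A.Nonempty
  subset : A ⊆ Sys.X₁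
  isClosed_C : IsClosed Sys.C
  isClosed_D' : IsClosed Sys.D'
  D_subset_C : Sys.D ⊆ Sys.C
  complete : ∀ β ∈ Ioc 0 β₀, ∀ γ ∈ Ioc 0 γ₀, ∀ θ ∈ Ioc 0 θ₀, ∀ ε > 0,
    SolutionsComplete (Sys.full β γ θ ε)
  slowVelocities_regular : ∀ γ ∈ Ioc 0 γ₀, ∀ θ ∈ Ioc 0 θ₀,
    OuterSemicontOn (Sys.slowVelocities γ θ) (Icc 0 β₀ ×ˢ (Sys.X₁ ×ˢ Sys.X₂')) ∧
    LocallyBoundedOn (Sys.slowVelocities γ θ) (Icc 0 β₀ ×ˢ (Sys.X₁ ×ˢ Sys.X₂'))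
  jumpMap : ∀ β ∈ Icc 0 β₀, ∀ γ ∈ Icc 0 γ₀, ∀ θ ∈ Icc 0 θ₀, ∀ x ∈ Sys.D,
    (Sys.G β γ θ x).Nonempty ∧ Sys.G β γ θ x ⊆ Sys.C
  G₁_regular :
    OuterSemicontOn (fun p : (ℝ × ℝ × ℝ) × (Slow n × EuclideanSpace ℝ (Fin m)) =>
      Sys.G₁ p.1.1 p.1.2.1 p.1.2.2 p.2) ((Icc 0 β₀ ×ˢ (Icc 0 γ₀ ×ˢ Icc 0 θ₀)) ×ˢ Sys.D') ∧
    LocallyBoundedOn (fun p : (ℝ × ℝ × ℝ) × (Slow n × EuclideanSpace ℝ (Fin m)) =>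
      Sys.G₁ p.1.1 p.1.2.1 p.1.2.2 p.2) ((Icc 0 β₀ ×ˢ (Icc 0 γ₀ ×ˢ Icc 0 θ₀)) ×ˢ Sys.D')
  H_nonempty : ∀ x₁ ∈ Sys.X₁, (Sys.H H₁ x₁).Nonempty
  H_subset : ∀ x₁ ∈ Sys.X₁, Sys.H H₁ x₁ ⊆ Sys.X₂
  outerSemicont : OuterSemicontOn H₁ Sys.X₁
  locallyBounded : LocallyBoundedOn H₁ Sys.X₁
  invariant : Sys.JumpInvarianceAssumption A H₁ β₀ γ₀ θ₀

namespace Standing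

variable (h : Standing Sys A H₁ β₀ γ₀ θ₀)

include h

theorem attractor_nonempty (hAK : A ⊆ K) : (Sys.attractor K H₁).Nonempty := by
  obtain ⟨x₁, hx₁⟩ := h.nonempty
  obtain ⟨x₂, hx₂⟩ := h.H_nonempty x₁ (h.subset hx₁)
  exact ⟨WithLp.toLp 2 (x₁, x₂), hAK hx₁, hx₂⟩

theorem attractor_subset_C (hKX : K ⊆ Sys.X₁) : Sys.attractor K H₁ ⊆ Sys.C :=
  fun _ hx => ⟨hKX hx.1, h.H_subset _ (hKX hx.1) hx.2⟩

theorem C_nonempty : Sys.C.Nonempty :=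
  (h.attractor_nonempty subset_rfl).mono (h.attractor_subset_C h.subset)

theorem isClosed_X₁_prod_X₂' : IsClosed (Sys.X₁ ×ˢ Sys.X₂') := by
  obtain ⟨x, hx⟩ := h.C_nonempty
  have hcont : Continuous (withBoundedPart x) := by unfold withBoundedPart; fun_prop
  convert h.isClosed_C.preimage hcont using 1
  exact Set.ext fun p => ⟨fun hp => ⟨hp.1, hp.2, hx.2.2⟩, fun hp => ⟨hp.1, hp.2.1⟩⟩

theorem isClosed_X₁ : IsClosed Sys.X₁ := by
  obtain ⟨x, hx⟩ := h.C_nonempty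
  convert h.isClosed_X₁_prod_X₂'.preimage (Continuous.prodMk_left x.snd.fst) using 1
  exact Set.ext fun x₁ => ⟨fun hx₁ => ⟨hx₁, hx.2.1⟩, fun hx₁ => hx₁.1⟩

theorem isCompact_tube (ρ : ℝ) : IsCompact (Sys.tube A ρ) :=
  (isCompact_infDist_le h.isCompact h.nonempty ρ).inter_left h.isClosed_X₁

theorem subset_tube (hρ : 0 ≤ ρ) : A ⊆ Sys.tube A ρ :=
  fun _ hx => ⟨h.subset hx, (Metric.infDist_zero_of_mem hx).trans_le hρ⟩

theorem isCompact_equilibriumGraph (hK : IsCompact K) (hKX : K ⊆ Sys.X₁) :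
    IsCompact (equilibriumGraph H₁ K) :=
  isCompact_graph h.outerSemicont h.locallyBounded hK hKX

theorem equilibriumGraph_nonempty (hAK : A ⊆ K) : (equilibriumGraph H₁ K).Nonempty := by
  obtain ⟨x, hx⟩ := h.attractor_nonempty hAK
  exact ⟨boundedPart x, hx.1, hx.2.1⟩

theorem isCompact_graph_attractor : IsCompact (equilibriumGraph H₁ A) :=
  h.isCompact_equilibriumGraph h.isCompact h.subset

theorem isCompact_graph_tube (ρ : ℝ) : IsCompact (equilibriumGraph H₁ (Sys.tube A ρ)) :=
  h.isCompact_equilibriumGraph (h.isCompact_tube ρ) fun _ hx => hx.1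

theorem infDist_graph_tube_le (hρ : 0 ≤ ρ) (x : State n m l) :
    Metric.infDist (boundedPart x) (equilibriumGraph H₁ (Sys.tube A ρ)) ≤
      Metric.infDist x (Sys.manifold A H₁ ρ) :=
  manifold_eq_attractor (Sys := Sys) ρ ▸
    infDist_equilibriumGraph_le (h.attractor_nonempty (h.subset_tube hρ)) x

theorem infDist_manifold_le (hρ : 0 ≤ ρ) (x : State n m l) :
    Metric.infDist x (Sys.manifold A H₁ ρ) ≤ Metric.infDist x (Sys.attractor A H₁) :=
  Metric.infDist_le_infDist_of_subset (fun _ hx => ⟨h.subset_tube hρ hx.1, hx.2⟩)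
    (h.attractor_nonempty subset_rfl)

theorem exists_infDist_attractor_le {ν : ℝ} (hρ : 0 ≤ ρ) (hν : 0 < ν) :
    ∃ η > 0, ∀ x ∈ Sys.C, Metric.infDist x.fst A ≤ η →
      Metric.infDist x (Sys.manifold A H₁ ρ) ≤ η → Metric.infDist x (Sys.attractor A H₁) ≤ ν := by
  have hA_ne := h.equilibriumGraph_nonempty (subset_refl A)
  have hρ_ne := h.equilibriumGraph_nonempty (h.subset_tube hρ)
  obtain ⟨η, hη, hlt⟩ := exists_pos_forall_of_isCompact
    (isCompact_infDist_le (h.isCompact_graph_tube ρ) hρ_ne 1)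
    (f := fun p => max (Metric.infDist p.1 A)
      (Metric.infDist p (equilibriumGraph H₁ (Sys.tube A ρ))))
    (g := fun p => 2 * Metric.infDist p (equilibriumGraph H₁ A) - ν)
    (((Metric.continuous_infDist_pt A).comp continuous_fst).max (Metric.continuous_infDist_pt _))
    ((continuous_const.mul (Metric.continuous_infDist_pt _)).sub continuous_const)
    fun p _ hp => by
      obtain ⟨hpA, hpρ⟩ := max_le_iff.1 hp
      have hmem : p ∈ equilibriumGraph H₁ A :=
        ⟨mem_of_infDist_le_zero h.isCompact h.nonempty hpA,
          (mem_of_infDist_le_zero (h.isCompact_graph_tube ρ) hρ_ne hpρ).2⟩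
      rw [Metric.infDist_zero_of_mem hmem]
      linarith
  refine ⟨min η 1, lt_min hη one_pos, fun x hx hxA hxM => ?_⟩
  have hgraph := (h.infDist_graph_tube_le hρ x).trans hxM
  have := hlt (boundedPart x) (hgraph.trans (min_le_right _ _))
    (max_le (hxA.trans (min_le_left _ _)) (hgraph.trans (min_le_left _ _)))
  linarith [infDist_attractor_le_two_mul hA_ne hx.2.2]

theorem exists_infDist_attractor_le_of_isBounded
    {B : Set (Slow n × EuclideanSpace ℝ (Fin m))} (hB : Bornology.IsBounded B) :
    ∃ R, ∀ x ∈ Sys.C, boundedPart x ∈ B → Metric.infDist x (Sys.attractor A H₁) ≤ R := by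
  have hne := h.equilibriumGraph_nonempty (subset_refl A)
  obtain ⟨p₀, hp₀⟩ := hne
  obtain ⟨R, hR⟩ := hB.subset_closedBall p₀
  refine ⟨2 * R, fun x hx hxB => (infDist_attractor_le_two_mul ⟨p₀, hp₀⟩ hx.2.2).trans ?_⟩
  have hdist : dist (boundedPart x) p₀ ≤ R := hR hxB
  linarith [Metric.infDist_le_dist_of_mem (x := boundedPart x) hp₀]

theorem exists_infDist_attractor_le_of_manifold (hρ : 0 ≤ ρ) (r : ℝ) :
    ∃ R, ∀ x ∈ Sys.C, Metric.infDist x (Sys.manifold A H₁ ρ) ≤ r →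
      Metric.infDist x (Sys.attractor A H₁) ≤ R := by
  obtain ⟨R, hR⟩ := h.exists_infDist_attractor_le_of_isBounded
    (isCompact_infDist_le (h.isCompact_graph_tube ρ)
      (h.equilibriumGraph_nonempty (h.subset_tube hρ)) r).isBounded
  exact ⟨R, fun x hx hxr => hR x hx ((h.infDist_graph_tube_le hρ x).trans hxr)⟩

/-! ### The jump map near compact sets -/

theorem exists_infDist_jump_le (R : ℝ) :
    ∃ R', ∀ β ∈ Icc 0 β₀, ∀ γ ∈ Icc 0 γ₀, ∀ θ ∈ Icc 0 θ₀, ∀ x ∈ Sys.D,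
      Metric.infDist x (Sys.attractor A H₁) ≤ R → ∀ g ∈ Sys.G β γ θ x,
        Metric.infDist g (Sys.attractor A H₁) ≤ R' := by
  obtain ⟨R', hR'⟩ := h.exists_infDist_attractor_le_of_isBounded
    (isBounded_iUnion_infDist_le h.G₁_regular.2
      (isCompact_Icc.prod (isCompact_Icc.prod isCompact_Icc)) subset_rfl h.isClosed_D'
      h.isCompact_graph_attractor (h.equilibriumGraph_nonempty subset_rfl) R)
  exact ⟨R', fun β hβ γ hγ θ hθ x hx hxR g hg => hR' g ((h.jumpMap β hβ γ hγ θ hθ x hx).2 hg)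
    (mem_biUnion (x := ((β, γ, θ), boundedPart x)) ⟨⟨hβ, hγ, hθ⟩,
      (infDist_equilibriumGraph_le (h.attractor_nonempty subset_rfl) x).trans hxR,
      mem_image_of_mem _ hx⟩ hg.1)⟩

theorem mem_G_of_mem_G₁ {β γ θ : ℝ} (hβ : β ∈ Icc 0 β₀) (hγ : γ ∈ Icc 0 γ₀) (hθ : θ ∈ Icc 0 θ₀)
    {x : State n m l} (hx : x ∈ Sys.D) {p : Slow n × EuclideanSpace ℝ (Fin m)}
    (hp : p ∈ Sys.G₁ β γ θ (boundedPart x)) : ∃ g ∈ Sys.G β γ θ x, boundedPart g = p := by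
  obtain ⟨g, hg⟩ := (h.jumpMap β hβ γ hγ θ hθ x hx).1
  exact ⟨withBoundedPart g p, ⟨hp, hg.2⟩, rfl⟩

theorem exists_infDist_jump_le_of_infDist_le {ν : ℝ} (hν : 0 < ν) :
    ∃ η > 0, ∀ β ∈ Icc 0 β₀, ∀ γ ∈ Icc 0 γ₀, ∀ θ ∈ Icc 0 θ₀, ∀ x ∈ Sys.D,
      Metric.infDist x (Sys.attractor A H₁) ≤ η → ∀ g ∈ Sys.G β γ θ x,
        Metric.infDist g (Sys.attractor A H₁) ≤ ν := by
  have hne := h.equilibriumGraph_nonempty (subset_refl A)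
  obtain ⟨η, hη, hnear⟩ := exists_pos_forall_of_infDist_le h.G₁_regular.1 h.G₁_regular.2
    (isCompact_Icc.prod (isCompact_Icc.prod isCompact_Icc)) subset_rfl h.isClosed_D' subset_rfl
    h.isCompact_graph_attractor hne
    (h := fun q => 2 * Metric.infDist q.2 (equilibriumGraph H₁ A) - ν)
    ((continuous_const.mul ((Metric.continuous_infDist_pt _).comp continuous_snd)).sub
      continuous_const) (by
      rintro ⟨β, γ, θ⟩ ⟨hβ, hγ, hθ⟩ _ ⟨hpA, x, hx, rfl⟩ g' hg'
      obtain ⟨g, hg, rfl⟩ := h.mem_G_of_mem_G₁ hβ hγ hθ hx hg'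
      have hgA := h.invariant β hβ γ hγ θ hθ x
        ⟨⟨hpA.1, hpA.2, (h.D_subset_C hx).2.2⟩, hx⟩ hg
      simp only [Metric.infDist_zero_of_mem (show boundedPart g ∈ equilibriumGraph H₁ A from
        ⟨hgA.1, hgA.2.1⟩)]
      linarith)
  refine ⟨η, hη, fun β hβ γ hγ θ hθ x hx hxη g hg => ?_⟩
  have hg_near := hnear (β, γ, θ) ⟨hβ, hγ, hθ⟩ (boundedPart x) (mem_image_of_mem _ hx)
    ((infDist_equilibriumGraph_le (h.attractor_nonempty subset_rfl) x).trans hxη)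
    (boundedPart g) hg.1
  linarith [infDist_attractor_le_two_mul hne ((h.jumpMap β hβ γ hγ θ hθ x hx).2 hg).2.2]

/-! ### The slow dynamics near the boundary layer manifold -/

theorem exists_norm_fst_le {γ θ : ℝ} (hγ : γ ∈ Ioc 0 γ₀) (hθ : θ ∈ Ioc 0 θ₀) (hρ : 0 ≤ ρ)
    (r : ℝ) : ∃ L > 0, ∀ β ∈ Icc 0 β₀, ∀ x ∈ Sys.C,
      Metric.infDist x (Sys.manifold A H₁ ρ) ≤ r → ∀ f ∈ Sys.F β γ θ x, ‖f.fst‖ ≤ L := by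
  obtain ⟨L, hL, hbound⟩ := (isBounded_iUnion_infDist_le (h.slowVelocities_regular γ hγ θ hθ).2
    isCompact_Icc subset_rfl h.isClosed_X₁_prod_X₂' (h.isCompact_graph_tube ρ)
    (h.equilibriumGraph_nonempty (h.subset_tube hρ)) r).exists_pos_norm_le
  exact ⟨L, hL, fun β hβ x hx hxr f hf => hbound _ (mem_biUnion (x := (β, boundedPart x))
    ⟨hβ, (h.infDist_graph_tube_le hρ x).trans hxr, hx.1, hx.2.1⟩ (mem_slowVelocities hx hf))⟩

theorem exists_flow_decrease {γ θ μ r c : ℝ} (hγ : γ ∈ Ioc 0 γ₀) (hθ : θ ∈ Ioc 0 θ₀)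
    (hρ : 0 ≤ ρ) (hc : 0 < c) {V : Slow n → ℝ} (hV : ContDiff ℝ 1 V)
    (hdec : ∀ β ∈ Icc 0 β₀, ∀ x₁ ∈ Sys.X₁, Metric.infDist x₁ A ∈ Icc μ r →
      ∀ f₁ ∈ Sys.Fr H₁ β γ θ x₁, fderiv ℝ V x₁ f₁ ≤ -c) :
    ∃ η > 0, ∀ β ∈ Icc 0 β₀, ∀ x ∈ Sys.C, Metric.infDist x.fst A ∈ Icc μ r →
      Metric.infDist x (Sys.manifold A H₁ ρ) ≤ η →
      ∀ f ∈ Sys.F β γ θ x, fderiv ℝ V x.fst f.fst ≤ -(c / 2) := by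
  have hreg := h.slowVelocities_regular γ hγ θ hθ
  have hderiv : Continuous fun q : (ℝ × (Slow n × EuclideanSpace ℝ (Fin m))) × Slow n =>
      fderiv ℝ V q.1.2.1 q.2 :=
    (hV.continuous_fderiv_apply one_ne_zero).comp (g := fun p : Slow n × Slow n =>
      fderiv ℝ V p.1 p.2) (by fun_prop : Continuous fun q : (ℝ × (Slow n ×
        EuclideanSpace ℝ (Fin m))) × Slow n => (q.1.2.1, q.2))
  obtain ⟨η, hη, hnear⟩ := exists_pos_forall_of_infDist_le hreg.1 hreg.2 isCompact_Icc subset_rfl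
    (h.isClosed_X₁_prod_X₂'.inter (isClosed_Icc.preimage
      ((Metric.continuous_infDist_pt A).comp continuous_fst))) inter_subset_left
    (h.isCompact_graph_tube ρ) (h.equilibriumGraph_nonempty (h.subset_tube hρ))
    (hderiv.add_const (c / 2)) (by
      rintro β hβ _ ⟨hp, -, hμr⟩ _ ⟨x, hx, rfl, f, hf, rfl⟩
      have := hdec β hβ x.fst hx.1 hμr f.fst
        (subset_closedConvexHull ⟨x.snd, ⟨hp.2, hx.2.2⟩, f, hf, rfl⟩)
      simp only [boundedPart]
      linarith)
  refine ⟨η, hη, fun β hβ x hx hμr hxη f hf => ?_⟩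
  have := hnear β hβ (boundedPart x) ⟨⟨hx.1, hx.2.1⟩, hμr⟩
    ((h.infDist_graph_tube_le hρ x).trans hxη) f.fst (mem_slowVelocities hx hf)
  simp only [boundedPart] at this
  linarith

theorem exists_jump_decrease {γ θ μ r c : ℝ} (hγ : γ ∈ Icc 0 γ₀) (hθ : θ ∈ Icc 0 θ₀)
    (hρ : 0 ≤ ρ) (hc : 0 < c) {V : Slow n → ℝ} (hV : Continuous V)
    (hdec : ∀ β ∈ Icc 0 β₀, ∀ x₁ ∈ Sys.D₁, Metric.infDist x₁ A ∈ Icc μ r →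
      ∀ g₁ ∈ Sys.Gr H₁ β γ θ x₁, V g₁ - V x₁ ≤ -c) :
    ∃ η > 0, ∀ β ∈ Icc 0 β₀, ∀ x ∈ Sys.D, Metric.infDist x.fst A ∈ Icc μ r →
      Metric.infDist x (Sys.manifold A H₁ ρ) ≤ η →
      ∀ g ∈ Sys.G β γ θ x, V g.fst - V x.fst ≤ -(c / 2) := by
  obtain ⟨η, hη, hnear⟩ := exists_pos_forall_of_infDist_le h.G₁_regular.1 h.G₁_regular.2
    (P := Icc 0 β₀ ×ˢ ({γ} ×ˢ {θ}))
    (isCompact_Icc.prod (isCompact_singleton.prod isCompact_singleton))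
    (prod_mono subset_rfl (prod_mono (singleton_subset_iff.2 hγ) (singleton_subset_iff.2 hθ)))
    (h.isClosed_D'.inter (isClosed_Icc.preimage
      ((Metric.continuous_infDist_pt A).comp continuous_fst))) inter_subset_left
    (h.isCompact_graph_tube ρ) (h.equilibriumGraph_nonempty (h.subset_tube hρ))
    (h := fun q => V q.2.1 - V q.1.2.1 + c / 2) (by fun_prop) (by
      rintro ⟨β, _, _⟩ ⟨hβ, rfl, rfl⟩ _ ⟨hp, ⟨x, hx, rfl⟩, hμr⟩ g' hg'
      obtain ⟨g, hg, rfl⟩ := h.mem_G_of_mem_G₁ hβ hγ hθ hx hg'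
      have := hdec β hβ x.fst hx.1 hμr g.fst
        ⟨x.snd, ⟨hp.2, (h.D_subset_C hx).2.2⟩, hx, g, hg, rfl⟩
      simp only [boundedPart]
      linarith)
  refine ⟨η, hη, fun β hβ x hx hμr hxη g hg => ?_⟩
  have := hnear (β, γ, θ) ⟨hβ, rfl, rfl⟩ (boundedPart x) ⟨mem_image_of_mem _ hx, hμr⟩
    ((h.infDist_graph_tube_le hρ x).trans hxη) (boundedPart g) hg.1
  simp only [boundedPart] at this
  linarith

end Standing

end SPSystem

/-! ### Lyapunov functions of the reduced system and of the boundary layer -/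

namespace SPSystem

variable {n m l : ℕ} {Sys : SPSystem n m l} {A : Set (Slow n)}
  {H₁ : Slow n → Set (EuclideanSpace ℝ (Fin m))} {β₀ γ₀ θ₀ ρ Δ : ℝ}

/-- A Lyapunov function of the reduced system on the points within `Δ` of `A`, with lower bound `a`
and upper bound `a'`. The rate of decrease is uniform in `β`, but may depend on `γ` and `θ`. -/
structure IsReducedLyapunov (Sys : SPSystem n m l) (A : Set (Slow n))
    (H₁ : Slow n → Set (EuclideanSpace ℝ (Fin m))) (β₀ θ₀ Δ : ℝ) (a a' : ℝ → ℝ)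
    (V : Slow n → ℝ) : Prop where
  contDiff : ContDiff ℝ 1 V
  le_apply : ∀ x₁ ∈ Sys.X₁, a (Metric.infDist x₁ A) ≤ V x₁
  apply_le : ∀ x₁ ∈ Sys.X₁, V x₁ ≤ a' (Metric.infDist x₁ A)
  decrease : ∀ μ > 0, ∀ᶠ γ in 𝓝[>] (0 : ℝ), ∀ θ ∈ Ioc 0 θ₀, ∃ c > 0, ∀ β ∈ Icc 0 β₀,
    ∀ x₁ ∈ Sys.X₁, Metric.infDist x₁ A ∈ Icc μ Δ →
      (∀ f₁ ∈ Sys.Fr H₁ β γ θ x₁, fderiv ℝ V x₁ f₁ ≤ -c) ∧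
      (x₁ ∈ Sys.D₁ → ∀ g₁ ∈ Sys.Gr H₁ β γ θ x₁, V g₁ - V x₁ ≤ -c)

/-- A Lyapunov function of the boundary layer on the points within `Δ` of `M_ρ`, with lower bound
`a` and upper bound `a'`. The last field bounds the effect of the slow motion, uniformly in
`x₂''`. -/
structure IsLayerLyapunov (Sys : SPSystem n m l) (A : Set (Slow n))
    (H₁ : Slow n → Set (EuclideanSpace ℝ (Fin m))) (γ₀ θ₀ ρ Δ : ℝ) (a a' : ℝ → ℝ)
    (V : State n m l → ℝ) : Prop where
  contDiff : ContDiff ℝ 1 V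
  le_apply : ∀ x ∈ Sys.C, Metric.infDist x.fst A ≤ ρ →
    a (Metric.infDist x (Sys.manifold A H₁ ρ)) ≤ V x
  apply_le : ∀ x ∈ Sys.C, Metric.infDist x.fst A ≤ ρ →
    V x ≤ a' (Metric.infDist x (Sys.manifold A H₁ ρ))
  decrease : ∀ ζ > 0, ∃ α > 0, ∀ᶠ β in 𝓝[>] (0 : ℝ), ∀ γ ∈ Ioc 0 γ₀, ∀ θ ∈ Ioc 0 θ₀,
    ∀ x ∈ Sys.C, Metric.infDist x.fst A ≤ ρ →
      Metric.infDist x (Sys.manifold A H₁ ρ) ∈ Icc ζ Δ → ∀ f ∈ Sys.F β γ θ x,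
        fderiv ℝ V x (WithLp.toLp 2 (0, f.snd)) ≤ -α
  exists_fderiv_fst_le : ∀ K : Set (Slow n × EuclideanSpace ℝ (Fin m)), IsCompact K →
    K ⊆ Sys.tube A ρ ×ˢ Sys.X₂' → ∃ M > 0, ∀ x : State n m l, boundedPart x ∈ K →
      x.snd.snd ∈ Sys.X₂'' → ∀ f₁ : Slow n, fderiv ℝ V x (WithLp.toLp 2 (f₁, 0)) ≤ M * ‖f₁‖

/-- The reduced system has Lyapunov functions on all bounded sets, with common bounds. -/
def HasReducedLyapunov (Sys : SPSystem n m l) (A : Set (Slow n))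
    (H₁ : Slow n → Set (EuclideanSpace ℝ (Fin m))) (β₀ θ₀ : ℝ) : Prop :=
  ∃ a a', IsClassKInfty a ∧ IsClassK a' ∧ ∀ Δ > 0, ∃ V, IsReducedLyapunov Sys A H₁ β₀ θ₀ Δ a a' V

/-- The boundary layer over the points within `ρ` of `A` has Lyapunov functions at all finite
distances from `M_ρ`, with common bounds. -/
def HasLayerLyapunov (Sys : SPSystem n m l) (A : Set (Slow n))
    (H₁ : Slow n → Set (EuclideanSpace ℝ (Fin m))) (γ₀ θ₀ ρ : ℝ) : Prop :=
  ∃ a a', IsClassKInfty a ∧ IsClassK a' ∧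
    ∀ Δ > 0, ∃ V, IsLayerLyapunov Sys A H₁ γ₀ θ₀ ρ Δ a a' V

theorem ReducedAssumption.hasReducedLyapunov (h : Sys.ReducedAssumption A H₁ β₀ γ₀ θ₀)
    (hγ₀ : 0 < γ₀) : HasReducedLyapunov Sys A H₁ β₀ θ₀ := by
  obtain ⟨-, a, a', αγhat, σhat, ha, ha', hαγhat, hσhat, hex⟩ := h
  refine ⟨a, a', ha, ha', fun Δ hΔ => ?_⟩
  obtain ⟨V, α, αγ, hV, hα, hαγ, hbounds, hdec⟩ := hex Δ hΔ
  refine ⟨V, hV, fun x₁ hx₁ => (hbounds x₁ hx₁).1, fun x₁ hx₁ => (hbounds x₁ hx₁).2,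
    fun μ hμ => ?_⟩
  obtain ⟨γs, hγs, hle⟩ := hαγ.exists_forall_le hμ
  filter_upwards [Ioc_mem_nhdsGT (lt_min hγ₀ hγs)] with γ hγ θ hθ
  have hσ_pos : 0 < σhat θ⁻¹ := hσhat θ⁻¹ (inv_pos.2 hθ.1)
  have hγ_pos : 0 < αγhat γ := hαγhat.pos hγ.1
  have hμ_pos : 0 < α μ := hα.pos hμ
  refine ⟨min (σhat θ⁻¹) 1 * (αγhat γ * α μ), by positivity, fun β hβ x₁ hx₁ hμx => ?_⟩
  obtain ⟨hflow, hjump⟩ := hdec β hβ γ ⟨hγ.1, hγ.2.trans (min_le_left _ _)⟩ θ hθ x₁ hx₁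
    ((hle γ hγ.1.le (hγ.2.trans (min_le_right _ _))).trans hμx.1) hμx.2
  have hα_le : α μ ≤ α (Metric.infDist x₁ A) := (hα.le_iff hμ.le Metric.infDist_nonneg).2 hμx.1
  refine ⟨fun f₁ hf₁ => ?_, fun hD g₁ hg₁ => (hjump hD g₁ hg₁).trans (neg_le_neg ?_)⟩
  · rw [← inner_gradient_left]
    refine (hflow f₁ hf₁).trans (neg_le_neg ?_)
    rw [mul_assoc]
    gcongr
    exact min_le_left _ _
  · rw [← one_mul (αγhat γ * α (Metric.infDist x₁ A))]
    gcongr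
    exact min_le_right _ _

theorem BoundaryLayerAssumption.hasLayerLyapunov
    (h : Sys.BoundaryLayerAssumption A H₁ β₀ γ₀ θ₀) (hβ₀ : 0 < β₀) (hρ : 0 < ρ) :
    HasLayerLyapunov Sys A H₁ γ₀ θ₀ ρ := by
  obtain ⟨-, a, a', αβhat, ha, ha', -, hex⟩ := h ρ hρ
  refine ⟨a, a', ha, ha', fun Δ hΔ => ?_⟩
  obtain ⟨V, α, αβ, hV, hα, hαβ, hbounds, hdec, -, hgrad⟩ := hex Δ hΔ
  refine ⟨V, hV, fun x hx hxρ => (hbounds x ⟨hx.1, hxρ⟩ hx.2).1,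
    fun x hx hxρ => (hbounds x ⟨hx.1, hxρ⟩ hx.2).2, fun ζ hζ => ⟨α ζ, hα.pos hζ, ?_⟩,
    fun K hK hKX => ?_⟩
  · obtain ⟨βs, hβs, hle⟩ := hαβ.exists_forall_le hζ
    filter_upwards [Ioc_mem_nhdsGT (lt_min hβ₀ hβs)] with β hβ γ hγ θ hθ x hx hxρ hζx f hf
    rw [← inner_gradient_left]
    refine ((hdec β ⟨hβ.1, hβ.2.trans (min_le_left _ _)⟩ γ hγ θ hθ x ⟨hx.1, hxρ⟩ hx.2 hζx.2 f
      hf).1 ((hle β hβ.1.le (hβ.2.trans (min_le_right _ _))).trans hζx.1)).trans (neg_le_neg ?_)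
    exact (hα.le_iff hζ.le Metric.infDist_nonneg).2 hζx.1
  · obtain ⟨M, hM, hbound⟩ := hgrad K hK hKX
    refine ⟨M, hM, fun x hx hx₂ f₁ => ?_⟩
    have hnorm : ‖(gradient V x).fst‖ ≤ M := by linarith [hbound x hx hx₂, abs_nonneg (V x)]
    rw [← inner_gradient_left, WithLp.prod_inner_apply]
    simp only [WithLp.ofLp_fst, WithLp.ofLp_snd, inner_zero_right, add_zero]
    exact (real_inner_le_norm _ _).trans (by gcongr)

end SPSystem

/-! ### Confinement of the arcs without short levels -/

namespace SPSystem

variable {n m l : ℕ} {Sys : SPSystem n m l} {A : Set (Slow n)}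
  {H₁ : Slow n → Set (EuclideanSpace ℝ (Fin m))} {β₀ γ₀ θ₀ ρ Δ : ℝ} {a₁ a₁' a₂ a₂' : ℝ → ℝ}

namespace IsReducedLyapunov

variable {V : Slow n → ℝ} {x₁ : Slow n} {r μ : ℝ}

theorem infDist_le (h : IsReducedLyapunov Sys A H₁ β₀ θ₀ Δ a₁ a₁' V) (ha₁ : IsClassK a₁)
    (hx₁ : x₁ ∈ Sys.X₁) (hr : 0 ≤ r) (hle : V x₁ ≤ a₁ r) : Metric.infDist x₁ A ≤ r :=
  (ha₁.le_iff Metric.infDist_nonneg hr).1 ((h.le_apply x₁ hx₁).trans hle)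

theorem le_infDist (h : IsReducedLyapunov Sys A H₁ β₀ θ₀ Δ a₁ a₁' V) (ha₁' : IsClassK a₁')
    (hx₁ : x₁ ∈ Sys.X₁) (hμ : 0 ≤ μ) (hlt : a₁' μ < V x₁) : μ ≤ Metric.infDist x₁ A := by
  contrapose! hlt
  exact (h.apply_le x₁ hx₁).trans ((ha₁'.le_iff Metric.infDist_nonneg hμ).2 hlt.le)

end IsReducedLyapunov

namespace IsLayerLyapunov

variable {V : State n m l → ℝ} {x : State n m l} {r ζ : ℝ}

theorem infDist_le (h : IsLayerLyapunov Sys A H₁ γ₀ θ₀ ρ Δ a₂ a₂' V) (ha₂ : IsClassK a₂)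
    (hx : x ∈ Sys.C) (hxρ : Metric.infDist x.fst A ≤ ρ) (hr : 0 ≤ r) (hle : V x ≤ a₂ r) :
    Metric.infDist x (Sys.manifold A H₁ ρ) ≤ r :=
  (ha₂.le_iff Metric.infDist_nonneg hr).1 ((h.le_apply x hx hxρ).trans hle)

theorem le_infDist (h : IsLayerLyapunov Sys A H₁ γ₀ θ₀ ρ Δ a₂ a₂' V) (ha₂' : IsClassK a₂')
    (hx : x ∈ Sys.C) (hxρ : Metric.infDist x.fst A ≤ ρ) (hζ : 0 ≤ ζ) (hlt : a₂' ζ < V x) :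
    ζ ≤ Metric.infDist x (Sys.manifold A H₁ ρ) := by
  contrapose! hlt
  exact (h.apply_le x hx hxρ).trans ((ha₂'.le_iff Metric.infDist_nonneg hζ).2 hlt.le)

end IsLayerLyapunov

/-- Levels for the two Lyapunov functions. Arcs start at slow level `b₁` and fast level `b₂`; they
stay within `r₁` of `A` and within `r₂` of `M_ρ`. Jumps out of the `η₀`-neighbourhood of `M_ρ`
preserve the fast level `b₂`, and do not exceed the slow level `ℓ₁` when they start within `μ`
of `A`. The slow level may be exceeded by `ν` during the transients of the fast variable. -/
structure Levels (Sys : SPSystem n m l) (A : Set (Slow n))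
    (H₁ : Slow n → Set (EuclideanSpace ℝ (Fin m))) (β₀ γ₀ θ₀ ρ : ℝ) (a₁ a₁' a₂ a₂' : ℝ → ℝ) where
  (b₁ ν r₁ b₂ r₂ η₀ μ ℓ₁ : ℝ)
  ν_pos : 0 < ν
  r₁_pos : 0 < r₁
  r₁_le : r₁ ≤ ρ
  add_le : b₁ + ν ≤ a₁ r₁
  b₂_pos : 0 < b₂
  r₂_pos : 0 < r₂
  b₂_lt : b₂ < a₂ r₂
  η₀_pos : 0 < η₀
  μ_pos : 0 < μ
  apply_μ_le : a₁' μ ≤ ℓ₁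
  ℓ₁_le : ℓ₁ ≤ b₁
  fast_jump : ∀ β ∈ Icc 0 β₀, ∀ γ ∈ Icc 0 γ₀, ∀ θ ∈ Icc 0 θ₀, ∀ x ∈ Sys.D,
    Metric.infDist x.fst A ≤ r₁ → Metric.infDist x (Sys.manifold A H₁ ρ) ≤ η₀ →
      ∀ g ∈ Sys.G β γ θ x, a₂' (Metric.infDist g (Sys.manifold A H₁ ρ)) ≤ b₂
  slow_jump : ∀ β ∈ Icc 0 β₀, ∀ γ ∈ Icc 0 γ₀, ∀ θ ∈ Icc 0 θ₀, ∀ x ∈ Sys.D,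
    Metric.infDist x.fst A ≤ μ → Metric.infDist x (Sys.manifold A H₁ ρ) ≤ η₀ →
      ∀ g ∈ Sys.G β γ θ x, a₁' (Metric.infDist g.fst A) ≤ ℓ₁

/-- Rates of the slow Lyapunov function `V₁` at fixed `γ` and `θ`, uniformly in `β`: it grows at
most at rate `L`, and it decreases at rate `c` along the flow and by `c` at the jumps within `η` of
`M_ρ`, away from the `μ`-neighbourhood of `A`. The settling time `κ` of the fast variable is at most
the minimal flow length `σ`. -/
structure SlowRates (lev : Levels Sys A H₁ β₀ γ₀ θ₀ ρ a₁ a₁' a₂ a₂') (V₁ : Slow n → ℝ)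
    (γ θ σ : ℝ) where
  (L c κ η : ℝ)
  L_nonneg : 0 ≤ L
  c_pos : 0 < c
  κ_pos : 0 < κ
  κ_le_one : κ ≤ 1
  κ_le : κ ≤ σ
  delay_lt : (c + L) * κ < lev.ν
  delay_le : (c + L) * κ ≤ c
  η_pos : 0 < η
  η_le : η ≤ lev.η₀
  growth : ∀ β ∈ Icc 0 β₀, ∀ x ∈ Sys.C, Metric.infDist x.fst A ≤ ρ →
    Metric.infDist x (Sys.manifold A H₁ ρ) ≤ lev.r₂ →
      ∀ f ∈ Sys.F β γ θ x, fderiv ℝ V₁ x.fst f.fst ≤ L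
  flow : ∀ β ∈ Icc 0 β₀, ∀ x ∈ Sys.C, Metric.infDist x.fst A ∈ Icc lev.μ lev.r₁ →
    Metric.infDist x (Sys.manifold A H₁ ρ) ≤ η →
      ∀ f ∈ Sys.F β γ θ x, fderiv ℝ V₁ x.fst f.fst ≤ -c
  jump : ∀ β ∈ Icc 0 β₀, ∀ x ∈ Sys.D, Metric.infDist x.fst A ∈ Icc lev.μ lev.r₁ →
    Metric.infDist x (Sys.manifold A H₁ ρ) ≤ η →
      ∀ g ∈ Sys.G β γ θ x, V₁ g.fst - V₁ x.fst ≤ -c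

namespace Standing

variable (h : Standing Sys A H₁ β₀ γ₀ θ₀)
include h

theorem exists_fderiv_slow_le {γ θ : ℝ} (hγ : γ ∈ Ioc 0 γ₀) (hθ : θ ∈ Ioc 0 θ₀) (hρ : 0 ≤ ρ)
    (r : ℝ) {V₁ : Slow n → ℝ} (hV₁ : ContDiff ℝ 1 V₁) :
    ∃ L ≥ 0, ∀ β ∈ Icc 0 β₀, ∀ x ∈ Sys.C, Metric.infDist x.fst A ≤ ρ →
      Metric.infDist x (Sys.manifold A H₁ ρ) ≤ r →
        ∀ f ∈ Sys.F β γ θ x, fderiv ℝ V₁ x.fst f.fst ≤ L := by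
  obtain ⟨L, hL, hnorm⟩ := h.exists_norm_fst_le hγ hθ hρ r
  obtain ⟨M, hM⟩ := (h.isCompact_tube ρ).exists_bound_of_continuousOn
    (hV₁.continuous_fderiv one_ne_zero).continuousOn
  refine ⟨|M| * L, by positivity, fun β hβ x hx hxρ hxr f hf => ?_⟩
  have hM_le : ‖fderiv ℝ V₁ x.fst‖ ≤ |M| := (hM x.fst ⟨hx.1, hxρ⟩).trans (le_abs_self M)
  exact (le_abs_self _).trans
    ((fderiv ℝ V₁ x.fst).le_of_opNorm_le_of_le hM_le (hnorm β hβ x hx hxr f hf))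

theorem eventually_nonempty_slowRates (lev : Levels Sys A H₁ β₀ γ₀ θ₀ ρ a₁ a₁' a₂ a₂')
    {V₁ : Slow n → ℝ} (hV₁ : IsReducedLyapunov Sys A H₁ β₀ θ₀ lev.r₁ a₁ a₁' V₁) :
    ∀ᶠ γ in 𝓝[>] (0 : ℝ), ∀ θ ∈ Ioc 0 θ₀, ∀ σ > 0, Nonempty (SlowRates lev V₁ γ θ σ) := by
  have hρ : 0 ≤ ρ := lev.r₁_pos.le.trans lev.r₁_le
  filter_upwards [Ioc_mem_nhdsGT h.γ₀_pos, hV₁.decrease lev.μ lev.μ_pos]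
    with γ hγ hdec θ hθ σ hσ
  obtain ⟨c, hc, hdec⟩ := hdec θ hθ
  obtain ⟨η₁, hη₁, hflow⟩ := h.exists_flow_decrease hγ hθ hρ hc hV₁.contDiff
    fun β hβ x₁ hx₁ hμx => (hdec β hβ x₁ hx₁ hμx).1
  obtain ⟨η₂, hη₂, hjump⟩ := h.exists_jump_decrease (Ioc_subset_Icc_self hγ)
    (Ioc_subset_Icc_self hθ) hρ hc hV₁.contDiff.continuous
    fun β hβ x₁ hx₁ hμx g₁ ⟨x₂, hx₂, hD, hg₁⟩ =>
      (hdec β hβ x₁ (h.D_subset_C hD).1 hμx).2 hx₁ g₁ ⟨x₂, hx₂, hD, hg₁⟩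
  obtain ⟨L, hL, hgrowth⟩ := h.exists_fderiv_slow_le hγ hθ hρ lev.r₂ hV₁.contDiff
  obtain ⟨κ, hκ, hκ_lt⟩ := exists_pos_mul_lt (lt_min lev.ν_pos (half_pos hc)) (c / 2 + L)
  have hdelay : (c / 2 + L) * min κ (min 1 σ) ≤ (c / 2 + L) * κ := by gcongr; exact min_le_left _ _
  have hlt := hdelay.trans_lt hκ_lt
  exact ⟨{ L := L, c := c / 2, κ := min κ (min 1 σ), η := min lev.η₀ (min η₁ η₂)
           L_nonneg := hL
           c_pos := half_pos hc
           κ_pos := by positivity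
           κ_le_one := (min_le_right _ _).trans (min_le_left _ _)
           κ_le := (min_le_right _ _).trans (min_le_right _ _)
           delay_lt := hlt.trans_le (min_le_left _ _)
           delay_le := hlt.le.trans (min_le_right _ _)
           η_pos := lt_min lev.η₀_pos (lt_min hη₁ hη₂)
           η_le := min_le_left _ _
           growth := hgrowth
           flow := fun β hβ x hx hμx hxη => hflow β hβ x hx hμx
             (hxη.trans ((min_le_right _ _).trans (min_le_left _ _)))
           jump := fun β hβ x hx hμx hxη => hjump β hβ x hx hμx
             (hxη.trans ((min_le_right _ _).trans (min_le_right _ _))) }⟩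

end Standing

namespace Standing

variable (h : Standing Sys A H₁ β₀ γ₀ θ₀)
include h

theorem closure_flowSet_union_jumpSet_subset (β γ θ ε : ℝ) :
    closure (Sys.full β γ θ ε).flowSet ∪ (Sys.full β γ θ ε).jumpSet ⊆ Sys.C :=
  union_subset h.isClosed_C.closure_eq.subset h.D_subset_C

theorem exists_fderiv_layer_le {γ θ : ℝ} (hγ : γ ∈ Ioc 0 γ₀) (hθ : θ ∈ Ioc 0 θ₀) (hρ : 0 ≤ ρ)
    {V₂ : State n m l → ℝ} (hV₂ : IsLayerLyapunov Sys A H₁ γ₀ θ₀ ρ Δ a₂ a₂' V₂) :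
    ∃ M, ∀ β ∈ Icc 0 β₀, ∀ x ∈ Sys.C, Metric.infDist x.fst A ≤ ρ →
      Metric.infDist x (Sys.manifold A H₁ ρ) ≤ Δ →
        ∀ f ∈ Sys.F β γ θ x, fderiv ℝ V₂ x (WithLp.toLp 2 (f.fst, 0)) ≤ M := by
  obtain ⟨L, -, hnorm⟩ := h.exists_norm_fst_le hγ hθ hρ Δ
  have hne := h.equilibriumGraph_nonempty (h.subset_tube hρ)
  obtain ⟨M, hM, hderiv⟩ := hV₂.exists_fderiv_fst_le
    ({p | Metric.infDist p (equilibriumGraph H₁ (Sys.tube A ρ)) ≤ Δ} ∩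
      (Sys.X₁ ×ˢ Sys.X₂' ∩ {p | Metric.infDist p.1 A ≤ ρ}))
    ((isCompact_infDist_le (h.isCompact_graph_tube ρ) hne Δ).inter_right
      (h.isClosed_X₁_prod_X₂'.inter (isClosed_Iic.preimage
        ((Metric.continuous_infDist_pt A).comp continuous_fst))))
    fun p hp => ⟨⟨hp.2.1.1, hp.2.2⟩, hp.2.1.2⟩
  refine ⟨M * L, fun β hβ x hx hxρ hxΔ f hf => (hderiv x
    ⟨(h.infDist_graph_tube_le hρ x).trans hxΔ, ⟨hx.1, hx.2.1⟩, hxρ⟩ hx.2.2 f.fst).trans ?_⟩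
  gcongr
  exact hnorm β hβ x hx hxΔ f hf

/-- The fast motion is scaled by `ε⁻¹`, so that its decrease dominates the bounded effect of the
slow motion. -/
theorem eventually_fderiv_layer_le {γ θ ζ : ℝ} (hγ : γ ∈ Ioc 0 γ₀) (hθ : θ ∈ Ioc 0 θ₀)
    (hρ : 0 ≤ ρ) {V₂ : State n m l → ℝ}
    (hV₂ : IsLayerLyapunov Sys A H₁ γ₀ θ₀ ρ Δ a₂ a₂' V₂) (hζ : 0 < ζ) (c : ℝ) :
    ∀ᶠ ε in 𝓝[>] (0 : ℝ), ∀ᶠ β in 𝓝[>] (0 : ℝ), ∀ x ∈ Sys.C, Metric.infDist x.fst A ≤ ρ →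
      Metric.infDist x (Sys.manifold A H₁ ρ) ∈ Icc ζ Δ →
        ∀ v ∈ (Sys.full β γ θ ε).flowMap x, fderiv ℝ V₂ x v ≤ -c := by
  obtain ⟨M, hslow⟩ := h.exists_fderiv_layer_le hγ hθ hρ hV₂
  obtain ⟨α, hα, hdec⟩ := hV₂.decrease ζ hζ
  filter_upwards [self_mem_nhdsWithin,
    (tendsto_inv_nhdsGT_zero.atTop_mul_const hα).eventually_ge_atTop (M + c)] with ε hε hεα
  filter_upwards [Ioc_mem_nhdsGT h.β₀_pos, hdec] with β hβ hdec x hx hxρ hxζ v hv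
  obtain ⟨f, hf, rfl⟩ := hv
  have hsplit : (WithLp.toLp 2 (f.fst, ε⁻¹ • f.snd) : State n m l) =
      WithLp.toLp 2 (f.fst, 0) + ε⁻¹ • WithLp.toLp 2 (0, f.snd) := by
    rw [← WithLp.toLp_smul, ← WithLp.toLp_add]
    simp
  rw [hsplit, map_add, map_smul, smul_eq_mul]
  have hslow_le := hslow β (Ioc_subset_Icc_self hβ) x hx hxρ hxζ.2 f hf
  have hfast_le := mul_le_mul_of_nonneg_left (hdec γ hγ θ hθ x hx hxρ hxζ f hf) (inv_pos.2 hε).le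
  linarith

end Standing

namespace SlowRates

variable {lev : Levels Sys A H₁ β₀ γ₀ θ₀ ρ a₁ a₁' a₂ a₂'} {V₁ : Slow n → ℝ}
  {V₂ : State n m l → ℝ} {β γ θ ε σ ζ : ℝ} (rates : SlowRates lev V₁ γ θ σ)

/-- The two-scale bounds determined by the levels and the slow rates. The rate of the fast variable
is such that it settles within the time `κ`. -/
noncomputable def bounds (ha₂ : IsClassK a₂) : TwoScaleBounds where
  L := rates.L
  c := rates.c
  c₂ := lev.b₂ / rates.κ
  κ := rates.κ
  ℓ₁ := lev.ℓ₁
  ℓ₂ := min (a₂ rates.η) lev.b₂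
  b₁ := lev.b₁
  ν := lev.ν
  b₂ := lev.b₂
  W := a₂ lev.r₂
  L_nonneg := rates.L_nonneg
  c_nonneg := rates.c_pos.le
  c₂_nonneg := (div_pos lev.b₂_pos rates.κ_pos).le
  κ_nonneg := rates.κ_pos.le
  delay_lt := rates.delay_lt
  ℓ₁_le := lev.ℓ₁_le
  ℓ₂_le := min_le_right _ _
  b₂_lt := lev.b₂_lt
  settle := by
    rw [div_mul_cancel₀ _ rates.κ_pos.ne', sub_self]
    exact le_min (ha₂.nonneg rates.η_pos.le) lev.b₂_pos.le

theorem flowCondition (h : Standing Sys A H₁ β₀ γ₀ θ₀) (ha₁ : IsClassK a₁) (ha₁' : IsClassK a₁')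
    (ha₂ : IsClassK a₂) (ha₂' : IsClassK a₂')
    (hV₁ : IsReducedLyapunov Sys A H₁ β₀ θ₀ lev.r₁ a₁ a₁' V₁)
    (hV₂ : IsLayerLyapunov Sys A H₁ γ₀ θ₀ ρ lev.r₂ a₂ a₂' V₂) (hβ : β ∈ Icc 0 β₀)
    (hζ : 0 ≤ ζ) (hζ_le : a₂' ζ ≤ min (a₂ rates.η) lev.b₂)
    (hfast : ∀ x ∈ Sys.C, Metric.infDist x.fst A ≤ ρ →
      Metric.infDist x (Sys.manifold A H₁ ρ) ∈ Icc ζ lev.r₂ →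
        ∀ v ∈ (Sys.full β γ θ ε).flowMap x, fderiv ℝ V₂ x v ≤ -(lev.b₂ / rates.κ)) :
    (rates.bounds ha₂).FlowCondition (Sys.full β γ θ ε) (fun x => V₁ x.fst) V₂ := by
  intro x hx h₁ h₂ v hv
  have hxC := h.closure_flowSet_union_jumpSet_subset β γ θ ε hx
  have hxr₁ := hV₁.infDist_le ha₁ hxC.1 lev.r₁_pos.le (h₁.trans lev.add_le)
  have hxρ := hxr₁.trans lev.r₁_le
  have hxr₂ := hV₂.infDist_le ha₂ hxC hxρ lev.r₂_pos.le h₂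
  refine ⟨?_, fun hlt => hfast x hxC hxρ
    ⟨hV₂.le_infDist ha₂' hxC hxρ hζ (hζ_le.trans_lt hlt), hxr₂⟩ v hv, fun hle hlt => ?_⟩
  all_goals
    obtain ⟨f, hf, rfl⟩ := hv
    rw [fderiv_comp_fst (hV₁.contDiff.differentiable one_ne_zero)]
  · exact rates.growth β hβ x hxC hxρ hxr₂ f hf
  · exact rates.flow β hβ x hxC
      ⟨hV₁.le_infDist ha₁' hxC.1 lev.μ_pos.le (lev.apply_μ_le.trans_lt hlt), hxr₁⟩
      (hV₂.infDist_le ha₂ hxC hxρ rates.η_pos.le (hle.trans (min_le_left _ _))) f hf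

theorem jumpCondition (h : Standing Sys A H₁ β₀ γ₀ θ₀) (ha₁ : IsClassK a₁) (ha₂ : IsClassK a₂)
    (hV₁ : IsReducedLyapunov Sys A H₁ β₀ θ₀ lev.r₁ a₁ a₁' V₁)
    (hV₂ : IsLayerLyapunov Sys A H₁ γ₀ θ₀ ρ lev.r₂ a₂ a₂' V₂) (hβ : β ∈ Icc 0 β₀)
    (hγ : γ ∈ Icc 0 γ₀) (hθ : θ ∈ Icc 0 θ₀) :
    (rates.bounds ha₂).JumpCondition (Sys.full β γ θ ε) (fun x => V₁ x.fst) V₂ := by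
  intro x hx h₁ h₂ g hg
  have hxC := h.D_subset_C hx
  have hgC := (h.jumpMap β hβ γ hγ θ hθ x hx).2 hg
  have hxr₁ := hV₁.infDist_le ha₁ hxC.1 lev.r₁_pos.le (h₁.trans lev.add_le)
  have hxη := hV₂.infDist_le ha₂ hxC (hxr₁.trans lev.r₁_le) rates.η_pos.le
    (h₂.trans (min_le_left _ _))
  have hxη₀ := hxη.trans rates.η_le
  have hslow : V₁ g.fst ≤ max (V₁ x.fst - rates.c) lev.ℓ₁ := by
    rcases le_total lev.μ (Metric.infDist x.fst A) with hμ | hμ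
    · exact le_max_of_le_left (by linarith [rates.jump β hβ x hx ⟨hμ, hxr₁⟩ hxη g hg])
    · exact le_max_of_le_right ((hV₁.apply_le _ hgC.1).trans
        (lev.slow_jump β hβ γ hγ θ hθ x hx hμ hxη₀ g hg))
  have hslow_le : V₁ g.fst ≤ lev.b₁ + lev.ν :=
    hslow.trans (max_le ((sub_le_self _ rates.c_pos.le).trans h₁)
      (lev.ℓ₁_le.trans (le_add_of_nonneg_right lev.ν_pos.le)))
  have hgρ := (hV₁.infDist_le ha₁ hgC.1 lev.r₁_pos.le (hslow_le.trans lev.add_le)).trans lev.r₁_le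
  exact ⟨(hV₂.apply_le g hgC hgρ).trans (lev.fast_jump β hβ γ hγ θ hθ x hx hxr₁ hxη₀ g hg),
    hslow.trans (max_le_max_right _ (sub_le_sub_left rates.delay_le _))⟩

end SlowRates

/-- The arcs of `ℋ` without levels shorter than `σ` that start at the levels `b₁` and `b₂` are
confined to the levels `lev`. Up to the transient `ν`, the slow level decreases at rate `c` down to
`ℓ₁`, and the fast variable is near `M_ρ` after flowing for the time `κ`. -/
def Levels.Confines (lev : Levels Sys A H₁ β₀ γ₀ θ₀ ρ a₁ a₁' a₂ a₂')
    (ℋ : HybridSystem (State n m l)) (σ c κ : ℝ) : Prop :=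
  ∀ J t φ, IsArc ℋ J t φ → shortLevels J t σ = ∅ →
    a₁' (Metric.infDist (φ (t 0) 0).fst A) ≤ lev.b₁ →
    a₂' (Metric.infDist (φ (t 0) 0) (Sys.manifold A H₁ ρ)) ≤ lev.b₂ →
    Metric.infDist (φ (t (J + 1)) J).fst A ≤ lev.r₁ ∧
    Metric.infDist (φ (t (J + 1)) J) (Sys.manifold A H₁ ρ) ≤ lev.r₂ ∧
    a₁ (Metric.infDist (φ (t (J + 1)) J).fst A) ≤
      max (lev.b₁ - c * (t (J + 1) - t 0)) lev.ℓ₁ + lev.ν ∧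
    (t J + κ ≤ t (J + 1) →
      Metric.infDist (φ (t (J + 1)) J) (Sys.manifold A H₁ ρ) ≤ lev.η₀)

theorem SlowRates.confines {lev : Levels Sys A H₁ β₀ γ₀ θ₀ ρ a₁ a₁' a₂ a₂'} {V₁ : Slow n → ℝ}
    {V₂ : State n m l → ℝ} {β γ θ ε σ : ℝ} (rates : SlowRates lev V₁ γ θ σ)
    (h : Standing Sys A H₁ β₀ γ₀ θ₀) (ha₁ : IsClassK a₁) (ha₂ : IsClassK a₂)
    (hV₁ : IsReducedLyapunov Sys A H₁ β₀ θ₀ lev.r₁ a₁ a₁' V₁)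
    (hV₂ : IsLayerLyapunov Sys A H₁ γ₀ θ₀ ρ lev.r₂ a₂ a₂' V₂)
    (hflow : (rates.bounds ha₂).FlowCondition (Sys.full β γ θ ε) (fun x => V₁ x.fst) V₂)
    (hjump : (rates.bounds ha₂).JumpCondition (Sys.full β γ θ ε) (fun x => V₁ x.fst) V₂) :
    lev.Confines (Sys.full β γ θ ε) σ rates.c rates.κ := by
  intro J t φ harc hreg hstart₁ hstart₂
  have hC := h.closure_flowSet_union_jumpSet_subset β γ θ ε
  have hstartC := hC (harc.mem 0 J.zero_le _ ⟨le_rfl, harc.le 0 J.zero_le⟩)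
  have hendC := hC (harc.mem J le_rfl _ ⟨harc.le J le_rfl, le_rfl⟩)
  have hle_r₁ : ∀ x ∈ Sys.C, V₁ x.fst ≤ lev.b₁ + lev.ν → Metric.infDist x.fst A ≤ lev.r₁ :=
    fun x hx hle => hV₁.infDist_le ha₁ hx.1 lev.r₁_pos.le (hle.trans lev.add_le)
  have hstartV₁ := (hV₁.apply_le _ hstartC.1).trans hstart₁
  have hstartρ := (hle_r₁ _ hstartC
    (hstartV₁.trans (le_add_of_nonneg_right lev.ν_pos.le))).trans lev.r₁_le
  obtain ⟨hfast, hsettled, hslow⟩ := TwoScaleBounds.arc_bounds (contDiff_comp_fst hV₁.contDiff)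
    hV₂.contDiff hflow hjump rates.κ_le harc hreg hstartV₁
    ((hV₂.apply_le _ hstartC hstartρ).trans hstart₂)
  have hend₁ := hle_r₁ _ hendC (hslow.trans (add_le_add_left ((rates.bounds ha₂).slowBound_le
    (sub_nonneg.2 (harc.monotone (J + 1).zero_le le_rfl))) _))
  have hendρ := hend₁.trans lev.r₁_le
  exact ⟨hend₁, hV₂.infDist_le ha₂ hendC hendρ lev.r₂_pos.le (hfast.trans lev.b₂_lt.le),
    (hV₁.le_apply _ hendC.1).trans hslow, fun hlong => (hV₂.infDist_le ha₂ hendC hendρ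
      rates.η_pos.le ((hsettled hlong).trans (min_le_left _ _))).trans rates.η_le⟩

theorem Standing.eventuallySmall_confines (h : Standing Sys A H₁ β₀ γ₀ θ₀)
    (lev : Levels Sys A H₁ β₀ γ₀ θ₀ ρ a₁ a₁' a₂ a₂') (ha₁ : IsClassK a₁) (ha₁' : IsClassK a₁')
    (ha₂ : IsClassK a₂) (ha₂' : IsClassK a₂') {V₁ : Slow n → ℝ} {V₂ : State n m l → ℝ}
    (hV₁ : IsReducedLyapunov Sys A H₁ β₀ θ₀ lev.r₁ a₁ a₁' V₁)
    (hV₂ : IsLayerLyapunov Sys A H₁ γ₀ θ₀ ρ lev.r₂ a₂ a₂' V₂)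
    {σ : ℝ → ℝ} (hσ : ∀ τ > 0, 0 < σ τ) :
    EventuallySmall fun γ θ ε β => ∃ c > 0, ∃ κ ≤ 1, κ ≤ σ θ⁻¹ ∧
      lev.Confines (Sys.full β γ θ ε) (σ θ⁻¹) c κ := by
  unfold EventuallySmall
  filter_upwards [Ioc_mem_nhdsGT h.γ₀_pos, h.eventually_nonempty_slowRates lev hV₁]
    with γ hγ hrates
  filter_upwards [Ioc_mem_nhdsGT h.θ₀_pos] with θ hθ
  obtain ⟨rates⟩ := hrates θ hθ (σ θ⁻¹) (hσ θ⁻¹ (inv_pos.2 hθ.1))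
  obtain ⟨ζ, hζ, hζ_le⟩ := ha₂'.exists_forall_le (lt_min (ha₂.pos rates.η_pos) lev.b₂_pos)
  filter_upwards [h.eventually_fderiv_layer_le hγ hθ (lev.r₁_pos.le.trans lev.r₁_le) hV₂ hζ
    (lev.b₂ / rates.κ)] with ε hfast
  filter_upwards [Ioc_mem_nhdsGT h.β₀_pos, hfast] with β hβ hfast
  have hβ' := Ioc_subset_Icc_self hβ
  exact ⟨rates.c, rates.c_pos, rates.κ, rates.κ_le_one, rates.κ_le,
    rates.confines h ha₁ ha₂ hV₁ hV₂
      (rates.flowCondition h ha₁ ha₁' ha₂ ha₂' hV₁ hV₂ hβ' hζ.le (hζ_le ζ hζ.le le_rfl) hfast)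
      (rates.jumpCondition h ha₁ ha₂ hV₁ hV₂ hβ' (Ioc_subset_Icc_self hγ)
        (Ioc_subset_Icc_self hθ))⟩

end SPSystem

/-! ### Bounds on the arcs with few short levels -/

namespace SPSystem

variable {n m l : ℕ} {Sys : SPSystem n m l} {A : Set (Slow n)}
  {H₁ : Slow n → Set (EuclideanSpace ℝ (Fin m))} {β₀ γ₀ θ₀ ρ β γ θ ε : ℝ}

namespace Levels

variable {a₁ a₁' a₂ a₂' : ℝ → ℝ} {lev : Levels Sys A H₁ β₀ γ₀ θ₀ ρ a₁ a₁' a₂ a₂'}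
  {σ c κ r R : ℝ}

/-- Points within `r` of the attractor are below the initial levels `b₁` and `b₂`. -/
def Admits (lev : Levels Sys A H₁ β₀ γ₀ θ₀ ρ a₁ a₁' a₂ a₂') (r : ℝ) : Prop :=
  ∀ x, Metric.infDist x (Sys.attractor A H₁) ≤ r → a₁' (Metric.infDist x.fst A) ≤ lev.b₁ ∧
    a₂' (Metric.infDist x (Sys.manifold A H₁ ρ)) ≤ lev.b₂

/-- The region to which arcs are confined by `lev` is within `R` of the attractor. -/
def ConfinesWithin (lev : Levels Sys A H₁ β₀ γ₀ θ₀ ρ a₁ a₁' a₂ a₂') (R : ℝ) : Prop :=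
  ∀ x ∈ Sys.C, Metric.infDist x.fst A ≤ lev.r₁ →
    Metric.infDist x (Sys.manifold A H₁ ρ) ≤ lev.r₂ → Metric.infDist x (Sys.attractor A H₁) ≤ R

/-- The region in which arcs settle, once both Lyapunov functions have decreased, is within `r` of
the attractor. -/
def SettlesWithin (lev : Levels Sys A H₁ β₀ γ₀ θ₀ ρ a₁ a₁' a₂ a₂') (r : ℝ) : Prop :=
  ∀ x ∈ Sys.C, a₁ (Metric.infDist x.fst A) ≤ lev.ℓ₁ + lev.ν →
    Metric.infDist x (Sys.manifold A H₁ ρ) ≤ lev.η₀ → Metric.infDist x (Sys.attractor A H₁) ≤ r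

theorem admits_of_le (h : Standing Sys A H₁ β₀ γ₀ θ₀) (hρ : 0 ≤ ρ)
    (h₁ : ∀ s, 0 ≤ s → s ≤ r → a₁' s ≤ lev.b₁) (h₂ : ∀ s, 0 ≤ s → s ≤ r → a₂' s ≤ lev.b₂) :
    lev.Admits r := fun x hx =>
  ⟨h₁ _ Metric.infDist_nonneg ((infDist_fst_le (h.attractor_nonempty subset_rfl) x).trans hx),
    h₂ _ Metric.infDist_nonneg ((h.infDist_manifold_le hρ x).trans hx)⟩

theorem Confines.arcsBounded (h : Standing Sys A H₁ β₀ γ₀ θ₀)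
    (hconf : lev.Confines (Sys.full β γ θ ε) σ c κ) (hr : lev.Admits r)
    (hR : lev.ConfinesWithin R) :
    ArcsBounded (Sys.full β γ θ ε) (Sys.attractor A H₁) σ 0 r R := by
  intro J t φ harc hcard hstart
  obtain ⟨hstart₁, hstart₂⟩ := hr _ hstart
  obtain ⟨hend₁, hend₂, -⟩ := hconf J t φ harc (Finset.card_eq_zero.1 (Nat.le_zero.1 hcard))
    hstart₁ hstart₂
  exact hR _ (h.closure_flowSet_union_jumpSet_subset β γ θ ε
    (harc.mem J le_rfl _ ⟨harc.le J le_rfl, le_rfl⟩)) hend₁ hend₂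

theorem Confines.infDist_le_of_late (h : Standing Sys A H₁ β₀ γ₀ θ₀) (hc : 0 < c)
    (hconf : lev.Confines (Sys.full β γ θ ε) σ c κ) (hR : lev.Admits R)
    (hr : lev.SettlesWithin r) (hℓ₁ : 0 ≤ lev.ℓ₁) {J : ℕ} {t : ℕ → ℝ}
    {φ : ℝ → ℕ → State n m l} (harc : IsArc (Sys.full β γ θ ε) J t φ)
    (hempty : shortLevels J t σ = ∅)
    (hstart : Metric.infDist (φ (t 0) 0) (Sys.attractor A H₁) ≤ R)
    (hlong : t J + κ ≤ t (J + 1)) (hlate : lev.b₁ / c ≤ t (J + 1) - t 0) :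
    Metric.infDist (φ (t (J + 1)) J) (Sys.attractor A H₁) ≤ r := by
  obtain ⟨hstart₁, hstart₂⟩ := hR _ hstart
  obtain ⟨-, -, hslow, hsettled⟩ := hconf J t φ harc hempty hstart₁ hstart₂
  refine hr _ (h.closure_flowSet_union_jumpSet_subset β γ θ ε
    (harc.mem J le_rfl _ ⟨harc.le J le_rfl, le_rfl⟩)) ?_ (hsettled hlong)
  rw [div_le_iff₀' hc] at hlate
  rwa [max_eq_right ((sub_nonpos.2 hlate).trans hℓ₁)] at hslow

/-- The last level may be too short for the fast variable to settle, but then the level before it is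
long enough. -/
theorem Confines.arcsReach (h : Standing Sys A H₁ β₀ γ₀ θ₀) (hc : 0 < c) (hκ₁ : κ ≤ 1)
    (hκσ : κ ≤ σ) (hconf : lev.Confines (Sys.full β γ θ ε) σ c κ) (hR : lev.Admits R)
    (hr : lev.SettlesWithin r) (hℓ₁ : 0 ≤ lev.ℓ₁) :
    ArcsReach (Sys.full β γ θ ε) (Sys.attractor A H₁) σ 0 R r (1 + lev.b₁ / c) := by
  intro J t φ harc hcard hstart T' hT' _ hlate
  have hempty := Finset.card_eq_zero.1 (Nat.le_zero.1 hcard)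
  have hb₁ : 0 ≤ lev.b₁ / c := div_nonneg (hℓ₁.trans lev.ℓ₁_le) hc.le
  by_cases hlong : t J + κ ≤ t (J + 1)
  · exact ⟨J, le_rfl, _, ⟨harc.le J le_rfl, le_rfl⟩,
      hconf.infDist_le_of_late h hc hR hr hℓ₁ harc hempty hstart hlong (by linarith)⟩
  · obtain _ | J := J
    · exact absurd hlong (by push Not; linarith)
    have hJ := J.le_succ
    have hnotMem : J ∉ shortLevels (J + 1) t σ := by simp [hempty]
    simp only [mem_shortLevels, J.lt_succ_self, true_and, not_lt] at hnotMem
    exact ⟨J, hJ, _, ⟨harc.le J hJ, le_rfl⟩, hconf.infDist_le_of_late h hc hR hr hℓ₁ (harc.take hJ)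
      (Finset.subset_empty.1 (hempty ▸ shortLevels_subset hJ)) hstart (by linarith)
      (by linarith)⟩

end Levels

namespace Standing

variable {a₁ a₁' a₂ a₂' σ : ℝ → ℝ} {δ r R : ℝ} (h : Standing Sys A H₁ β₀ γ₀ θ₀)

include h

theorem exists_infDist_jump_le_of_manifold {ν : ℝ} (hρ : 0 ≤ ρ) (hν : 0 < ν) :
    ∃ η > 0, ∀ β ∈ Icc 0 β₀, ∀ γ ∈ Icc 0 γ₀, ∀ θ ∈ Icc 0 θ₀, ∀ x ∈ Sys.D,
      Metric.infDist x.fst A ≤ η → Metric.infDist x (Sys.manifold A H₁ ρ) ≤ η →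
        ∀ g ∈ Sys.G β γ θ x, Metric.infDist g (Sys.attractor A H₁) ≤ ν := by
  obtain ⟨ζ, hζ, hjump⟩ := h.exists_infDist_jump_le_of_infDist_le hν
  obtain ⟨η, hη, hnear⟩ := h.exists_infDist_attractor_le hρ hζ
  exact ⟨η, hη, fun β hβ γ hγ θ hθ x hx hxA hxM =>
    hjump β hβ γ hγ θ hθ x hx (hnear x (h.D_subset_C hx) hxA hxM)⟩

theorem exists_apply_infDist_fst_jump_le (hρ : 0 ≤ ρ) {a : ℝ → ℝ} (ha : IsClassK a) {c : ℝ}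
    (hc : 0 < c) :
    ∃ η > 0, ∀ β ∈ Icc 0 β₀, ∀ γ ∈ Icc 0 γ₀, ∀ θ ∈ Icc 0 θ₀, ∀ x ∈ Sys.D,
      Metric.infDist x.fst A ≤ η → Metric.infDist x (Sys.manifold A H₁ ρ) ≤ η →
        ∀ g ∈ Sys.G β γ θ x, a (Metric.infDist g.fst A) ≤ c := by
  obtain ⟨s, hs, hle⟩ := ha.exists_forall_le hc
  obtain ⟨η, hη, hjump⟩ := h.exists_infDist_jump_le_of_manifold hρ hs
  exact ⟨η, hη, fun β hβ γ hγ θ hθ x hx hxA hxM g hg => hle _ Metric.infDist_nonneg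
    ((infDist_fst_le (h.attractor_nonempty subset_rfl) g).trans
      (hjump β hβ γ hγ θ hθ x hx hxA hxM g hg))⟩

theorem exists_apply_infDist_manifold_jump_le (hρ : 0 ≤ ρ) {a : ℝ → ℝ} (ha : IsClassK a) {c : ℝ}
    (hc : 0 < c) :
    ∃ η > 0, ∀ β ∈ Icc 0 β₀, ∀ γ ∈ Icc 0 γ₀, ∀ θ ∈ Icc 0 θ₀, ∀ x ∈ Sys.D,
      Metric.infDist x.fst A ≤ η → Metric.infDist x (Sys.manifold A H₁ ρ) ≤ η →
        ∀ g ∈ Sys.G β γ θ x, a (Metric.infDist g (Sys.manifold A H₁ ρ)) ≤ c := by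
  obtain ⟨s, hs, hle⟩ := ha.exists_forall_le hc
  obtain ⟨η, hη, hjump⟩ := h.exists_infDist_jump_le_of_manifold hρ hs
  exact ⟨η, hη, fun β hβ γ hγ θ hθ x hx hxA hxM g hg => hle _ Metric.infDist_nonneg
    ((h.infDist_manifold_le hρ g).trans (hjump β hβ γ hγ θ hθ x hx hxA hxM g hg))⟩

/-- Near the attractor the jumps are controlled by the invariance of `M_A`. -/
theorem exists_levels_near (ha₁ : IsClassK a₁) (ha₁' : IsClassK a₁') (ha₂ : IsClassK a₂)
    (ha₂' : IsClassK a₂') (hδ : 0 < δ) :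
    ∃ lev : Levels Sys A H₁ β₀ γ₀ θ₀ 1 a₁ a₁' a₂ a₂', ∃ r > 0,
      lev.Admits r ∧ lev.ConfinesWithin δ := by
  obtain ⟨r₂, hr₂, hfin⟩ := h.exists_infDist_attractor_le zero_le_one hδ
  have hb₂ : 0 < a₂ r₂ / 2 := half_pos (ha₂.pos hr₂)
  obtain ⟨η₁, hη₁, hfast⟩ := h.exists_apply_infDist_manifold_jump_le zero_le_one ha₂' hb₂
  obtain ⟨r₁, hr₁, hr₁_le⟩ : ∃ r₁ > 0, r₁ ≤ min (min r₂ η₁) 1 :=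
    ⟨_, lt_min (lt_min hr₂ hη₁) one_pos, le_rfl⟩
  obtain ⟨⟨hr₁r₂, hr₁η₁⟩, hr₁_one⟩ : (r₁ ≤ r₂ ∧ r₁ ≤ η₁) ∧ r₁ ≤ 1 := by simpa using hr₁_le
  have hb₁ : 0 < a₁ r₁ / 2 := half_pos (ha₁.pos hr₁)
  obtain ⟨η₂, hη₂, hslow⟩ := h.exists_apply_infDist_fst_jump_le zero_le_one ha₁' hb₁
  obtain ⟨s₁, hs₁, hle₁⟩ := ha₁'.exists_forall_le hb₁
  obtain ⟨s₂, hs₂, hle₂⟩ := ha₂'.exists_forall_le hb₂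
  have hμ : 0 < min s₁ η₂ := lt_min hs₁ hη₂
  refine ⟨{ b₁ := a₁ r₁ / 2, ν := a₁ r₁ / 2, r₁ := r₁, b₂ := a₂ r₂ / 2, r₂ := r₂,
            η₀ := min η₁ η₂, μ := min s₁ η₂, ℓ₁ := a₁ r₁ / 2,
            ν_pos := hb₁, r₁_pos := hr₁, r₁_le := hr₁_one, add_le := (add_halves _).le,
            b₂_pos := hb₂, r₂_pos := hr₂, b₂_lt := half_lt_self (ha₂.pos hr₂),
            η₀_pos := lt_min hη₁ hη₂, μ_pos := hμ,
            apply_μ_le := hle₁ _ hμ.le (min_le_left _ _), ℓ₁_le := le_rfl,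
            fast_jump := fun β hβ γ hγ θ hθ x hx hxA hxM => hfast β hβ γ hγ θ hθ x hx
              (hxA.trans hr₁η₁) (hxM.trans (min_le_left _ _)),
            slow_jump := fun β hβ γ hγ θ hθ x hx hxA hxM => hslow β hβ γ hγ θ hθ x hx
              (hxA.trans (min_le_right _ _)) (hxM.trans (min_le_right _ _)) },
    min s₁ s₂, lt_min hs₁ hs₂, Levels.admits_of_le h zero_le_one
      (fun s hs hle => hle₁ s hs (hle.trans (min_le_left _ _)))
      fun s hs hle => hle₂ s hs (hle.trans (min_le_right _ _)),
    fun x hx hxA => hfin x hx (hxA.trans hr₁r₂)⟩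

/-- Far from the attractor the jumps are controlled by local boundedness of the jump map only. -/
theorem exists_fast_level_bounded (hρ : 0 ≤ ρ) {α : ℝ → ℝ} (hα : IsClassK α) (hR : 0 ≤ R) :
    ∃ b > 0, (∀ s, 0 ≤ s → s ≤ R → α s ≤ b) ∧ ∀ β ∈ Icc 0 β₀, ∀ γ ∈ Icc 0 γ₀, ∀ θ ∈ Icc 0 θ₀,
      ∀ x ∈ Sys.D, Metric.infDist x (Sys.manifold A H₁ ρ) ≤ 1 →
        ∀ g ∈ Sys.G β γ θ x, α (Metric.infDist g (Sys.manifold A H₁ ρ)) ≤ b := by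
  obtain ⟨R₁, hR₁⟩ := h.exists_infDist_attractor_le_of_manifold hρ 1
  obtain ⟨R₂, hR₂⟩ := h.exists_infDist_jump_le R₁
  have hmax : 0 ≤ max R R₂ := hR.trans (le_max_left _ _)
  have hle : ∀ s, 0 ≤ s → s ≤ max R R₂ → α s ≤ α (max R R₂) + 1 := fun s hs hsR =>
    ((hα.le_iff hs hmax).2 hsR).trans (le_add_of_nonneg_right zero_le_one)
  refine ⟨α (max R R₂) + 1, add_pos_of_nonneg_of_pos (hα.nonneg hmax) one_pos,
    fun s hs hsR => hle s hs (hsR.trans (le_max_left _ _)), ?_⟩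
  intro β hβ γ hγ θ hθ x hx hxM g hg
  have hjump := hR₂ β hβ γ hγ θ hθ x hx (hR₁ x (h.D_subset_C hx) hxM) g hg
  exact hle _ Metric.infDist_nonneg
    ((h.infDist_manifold_le hρ g).trans (hjump.trans (le_max_right _ _)))

theorem exists_levels_bounded (ha₁ : IsClassK a₁) (ha₁' : IsClassK a₁') (ha₂ : IsClassKInfty a₂)
    (ha₂' : IsClassK a₂') (hR : 0 < R) (hr : 0 < r) (hρ : 0 < ρ) (hρR : a₁' R + 2 ≤ a₁ ρ) :
    ∃ lev : Levels Sys A H₁ β₀ γ₀ θ₀ ρ a₁ a₁' a₂ a₂',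
      lev.Admits R ∧ (∃ R', lev.ConfinesWithin R') ∧ lev.SettlesWithin r ∧ 0 ≤ lev.ℓ₁ := by
  obtain ⟨b₂, hb₂, hle₂, hfast⟩ := h.exists_fast_level_bounded hρ.le ha₂' hR.le
  obtain ⟨r₂, hr₂, hle_r₂⟩ := ha₂.exists_le (b₂ + 1)
  obtain ⟨R', hR'⟩ := h.exists_infDist_attractor_le_of_manifold hρ.le r₂
  obtain ⟨η, hη, hfin⟩ := h.exists_infDist_attractor_le hρ.le hr
  have hb₁ : 0 < a₁' R + 1 := add_pos_of_nonneg_of_pos (ha₁'.nonneg hR.le) one_pos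
  have hη_half : 0 < a₁ η / 2 := half_pos (ha₁.pos hη)
  have hℓ₁ := lt_min hη_half hb₁
  obtain ⟨s, hs, hle⟩ := ha₁'.exists_forall_le hℓ₁
  obtain ⟨η₂, hη₂, hslow⟩ := h.exists_apply_infDist_fst_jump_le hρ.le ha₁' hℓ₁
  have hμ : 0 < min s η₂ := lt_min hs hη₂
  refine ⟨{ b₁ := a₁' R + 1, ν := min (a₁ η / 2) 1, r₁ := ρ, b₂ := b₂,
            r₂ := r₂, η₀ := min (min 1 η₂) η, μ := min s η₂, ℓ₁ := min (a₁ η / 2) (a₁' R + 1),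
            ν_pos := lt_min hη_half one_pos, r₁_pos := hρ, r₁_le := le_rfl,
            add_le := by linarith [min_le_right (a₁ η / 2) 1],
            b₂_pos := hb₂, r₂_pos := hr₂, b₂_lt := by linarith,
            η₀_pos := lt_min (lt_min one_pos hη₂) hη, μ_pos := hμ,
            apply_μ_le := hle _ hμ.le (min_le_left _ _), ℓ₁_le := min_le_right _ _,
            fast_jump := fun β hβ γ hγ θ hθ x hx _ hxM => hfast β hβ γ hγ θ hθ x hx
              (hxM.trans ((min_le_left _ _).trans (min_le_left _ _))),
            slow_jump := fun β hβ γ hγ θ hθ x hx hxA hxM => hslow β hβ γ hγ θ hθ x hx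
              (hxA.trans (min_le_right _ _))
              (hxM.trans ((min_le_left _ _).trans (min_le_right _ _))) },
    Levels.admits_of_le h hρ.le
      (fun s hs hsR => ((ha₁'.le_iff hs hR.le).2 hsR).trans (le_add_of_nonneg_right zero_le_one))
      hle₂,
    ⟨R', fun x hx _ => hR' x hx⟩, fun x hx hxA hxM => hfin x hx ?_ (hxM.trans (min_le_right _ _)),
    hℓ₁.le⟩
  refine (ha₁.le_iff Metric.infDist_nonneg hη.le).1 (hxA.trans ?_)
  exact (add_le_add (min_le_left _ _) (min_le_left _ _)).trans_eq (add_halves _)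

theorem exists_eventuallySmall_arcsBounded_zero (hreduced : HasReducedLyapunov Sys A H₁ β₀ θ₀)
    (hlayer : ∀ ρ > 0, HasLayerLyapunov Sys A H₁ γ₀ θ₀ ρ) (hσ : ∀ τ > 0, 0 < σ τ) (hδ : 0 < δ) :
    ∃ r > 0, EventuallySmall fun γ θ ε β =>
      ArcsBounded (Sys.full β γ θ ε) (Sys.attractor A H₁) (σ θ⁻¹) 0 r δ := by
  obtain ⟨a₁, a₁', ha₁, ha₁', hV₁⟩ := hreduced
  obtain ⟨a₂, a₂', ha₂, ha₂', hV₂⟩ := hlayer 1 one_pos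
  obtain ⟨lev, r, hr, hstart, hend⟩ :=
    h.exists_levels_near ha₁.toIsClassK ha₁' ha₂.toIsClassK ha₂' hδ
  obtain ⟨V₁, hV₁⟩ := hV₁ lev.r₁ lev.r₁_pos
  obtain ⟨V₂, hV₂⟩ := hV₂ lev.r₂ lev.r₂_pos
  refine ⟨r, hr, (h.eventuallySmall_confines lev ha₁.toIsClassK ha₁' ha₂.toIsClassK ha₂' hV₁ hV₂
    hσ).mono ?_⟩
  rintro γ θ ε β ⟨c, -, κ, -, -, hconf⟩
  exact hconf.arcsBounded h hstart hend

theorem exists_eventuallySmall_arcsReach_zero (hreduced : HasReducedLyapunov Sys A H₁ β₀ θ₀)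
    (hlayer : ∀ ρ > 0, HasLayerLyapunov Sys A H₁ γ₀ θ₀ ρ) (hσ : ∀ τ > 0, 0 < σ τ) (hR : 0 < R)
    (hr : 0 < r) :
    ∃ R', EventuallySmall fun γ θ ε β =>
      ArcsBounded (Sys.full β γ θ ε) (Sys.attractor A H₁) (σ θ⁻¹) 0 R R' ∧
      ∃ T ≥ 0, ArcsReach (Sys.full β γ θ ε) (Sys.attractor A H₁) (σ θ⁻¹) 0 R r T := by
  obtain ⟨a₁, a₁', ha₁, ha₁', hV₁⟩ := hreduced
  obtain ⟨ρ, hρ, hρR⟩ := ha₁.exists_le (a₁' R + 2)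
  obtain ⟨a₂, a₂', ha₂, ha₂', hV₂⟩ := hlayer ρ hρ
  obtain ⟨lev, hstart, ⟨R', hend⟩, hsettled, hℓ₁⟩ :=
    h.exists_levels_bounded ha₁.toIsClassK ha₁' ha₂ ha₂' hR hr hρ hρR
  obtain ⟨V₁, hV₁⟩ := hV₁ lev.r₁ lev.r₁_pos
  obtain ⟨V₂, hV₂⟩ := hV₂ lev.r₂ lev.r₂_pos
  refine ⟨R', (h.eventuallySmall_confines lev ha₁.toIsClassK ha₁' ha₂.toIsClassK ha₂' hV₁ hV₂
    hσ).mono ?_⟩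
  rintro γ θ ε β ⟨c, hc, κ, hκ₁, hκσ, hconf⟩
  exact ⟨hconf.arcsBounded h hstart hend, 1 + lev.b₁ / c,
    add_nonneg zero_le_one (div_nonneg (hℓ₁.trans lev.ℓ₁_le) hc.le),
    hconf.arcsReach h hc hκ₁ hκσ hstart hsettled hℓ₁⟩

theorem exists_eventuallySmall_jumpsBounded_near (hδ : 0 < δ) :
    ∃ r > 0, EventuallySmall fun γ θ ε β =>
      JumpsBounded (Sys.full β γ θ ε) (Sys.attractor A H₁) r δ := by
  obtain ⟨r, hr, hjump⟩ := h.exists_infDist_jump_le_of_infDist_le hδ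
  refine ⟨r, hr, (eventuallySmall_mem_Ioc h.β₀_pos h.γ₀_pos h.θ₀_pos).mono ?_⟩
  rintro γ θ ε β ⟨hγ, hθ, -, hβ⟩
  exact hjump β (Ioc_subset_Icc_self hβ) γ (Ioc_subset_Icc_self hγ) θ (Ioc_subset_Icc_self hθ)

theorem exists_eventuallySmall_jumpsBounded (r : ℝ) :
    ∃ R > 0, EventuallySmall fun γ θ ε β =>
      JumpsBounded (Sys.full β γ θ ε) (Sys.attractor A H₁) r R := by
  obtain ⟨R, hjump⟩ := h.exists_infDist_jump_le r
  refine ⟨max R 1, lt_max_of_lt_right one_pos,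
    (eventuallySmall_mem_Ioc h.β₀_pos h.γ₀_pos h.θ₀_pos).mono ?_⟩
  rintro γ θ ε β ⟨hγ, hθ, -, hβ⟩ x hx hxr g hg
  exact (hjump β (Ioc_subset_Icc_self hβ) γ (Ioc_subset_Icc_self hγ) θ (Ioc_subset_Icc_self hθ) x
    hx hxr g hg).trans (le_max_left _ _)

theorem exists_eventuallySmall_arcsBounded (hreduced : HasReducedLyapunov Sys A H₁ β₀ θ₀)
    (hlayer : ∀ ρ > 0, HasLayerLyapunov Sys A H₁ γ₀ θ₀ ρ) (hσ : ∀ τ > 0, 0 < σ τ) (hδ : 0 < δ)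
    (k : ℕ) :
    ∃ r > 0, EventuallySmall fun γ θ ε β =>
      ArcsBounded (Sys.full β γ θ ε) (Sys.attractor A H₁) (σ θ⁻¹) k r δ := by
  induction k with
  | zero => exact h.exists_eventuallySmall_arcsBounded_zero hreduced hlayer hσ hδ
  | succ k ih =>
    obtain ⟨R', hR', htail⟩ := ih
    obtain ⟨r', hr', hjump⟩ := h.exists_eventuallySmall_jumpsBounded_near hR'
    obtain ⟨r, hr, hhead⟩ :=
      h.exists_eventuallySmall_arcsBounded_zero hreduced hlayer hσ (lt_min hδ hr')
    exact ⟨r, hr, ((hhead.and hjump).and htail).mono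
      fun γ θ ε β ⟨⟨hhead, hjump⟩, htail⟩ => hhead.succ hjump htail⟩

theorem eventuallySmall_arcsReach (hreduced : HasReducedLyapunov Sys A H₁ β₀ θ₀)
    (hlayer : ∀ ρ > 0, HasLayerLyapunov Sys A H₁ γ₀ θ₀ ρ) (hσ : ∀ τ > 0, 0 < σ τ) (hr : 0 < r)
    (k : ℕ) {R : ℝ} (hR : 0 < R) :
    EventuallySmall fun γ θ ε β => ∃ T ≥ 0,
      ArcsReach (Sys.full β γ θ ε) (Sys.attractor A H₁) (σ θ⁻¹) k R r T := by
  induction k generalizing R with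
  | zero =>
    obtain ⟨_, hhead⟩ := h.exists_eventuallySmall_arcsReach_zero hreduced hlayer hσ hR hr
    exact hhead.mono fun _ _ _ _ => And.right
  | succ k ih =>
    obtain ⟨r', hhead⟩ := h.exists_eventuallySmall_arcsReach_zero hreduced hlayer hσ hR hr
    obtain ⟨R', hR', hjump⟩ := h.exists_eventuallySmall_jumpsBounded r'
    refine ((hhead.and hjump).and (ih hR')).mono ?_
    rintro γ θ ε β ⟨⟨⟨hbound, T, hT, hhead⟩, hjump⟩, T', -, htail⟩
    exact ⟨max T T', hT.trans (le_max_left _ _), hhead.succ hbound hjump htail⟩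

theorem exists_regularSolutions (hregular : Sys.JumpRegularityAssumption A β₀ γ₀ θ₀) :
    ∃ σ : ℝ → ℝ, (∀ τ > 0, 0 < σ τ) ∧ ∀ Δ > 0, ∃ N : ℕ, ∀ β ∈ Ioc 0 β₀, ∀ γ ∈ Ioc 0 γ₀,
      ∀ θ ∈ Ioc 0 θ₀, ∀ ε > 0, ∃ T₀,
        RegularSolutions (Sys.full β γ θ ε) (Sys.attractor A H₁) (σ θ⁻¹) Δ N T₀ := by
  obtain ⟨σ, hσ, hregular⟩ := hregular
  refine ⟨σ, hσ, fun Δ hΔ => ?_⟩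
  obtain ⟨N, hN⟩ := hregular Δ hΔ
  refine ⟨N, fun β hβ γ hγ θ hθ ε hε => ?_⟩
  obtain ⟨T₀, hT₀⟩ := hN β hβ γ hγ θ hθ ε hε
  have hσθ := hσ θ⁻¹ (inv_pos.2 hθ.1)
  have hsub : Sys.attractor A H₁ ⊆ {x : State n m l | x.fst ∈ A ∧ x.snd ∈ Sys.X₂} :=
    fun x hx => ⟨hx.1, h.H_subset _ (h.subset hx.1) hx.2⟩
  have hle : ∀ x, Metric.infDist x (Sys.attractor A H₁) ≤ Δ →
      Metric.infDist x {x : State n m l | x.fst ∈ A ∧ x.snd ∈ Sys.X₂} ≤ Δ := fun x =>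
    (Metric.infDist_le_infDist_of_subset hsub (h.attractor_nonempty subset_rfl)).trans
  refine ⟨T₀, hσθ, fun x hx => (h.jumpMap β (Ioc_subset_Icc_self hβ) γ (Ioc_subset_Icc_self hγ) θ
    (Ioc_subset_Icc_self hθ) x hx).2, fun S φ hφ => ?_, fun S φ hφ hφΔ =>
    (hT₀ S φ hφ (hle _ hφΔ)).1, fun S φ hφ hφΔ => (hT₀ S φ hφ (hle _ hφΔ)).2⟩
  refine hφ.isNonbranching (h.complete β hβ γ hγ θ hθ ε hε) hσθ fun S φ hφ => ?_
  obtain ⟨N', hN'⟩ := hregular (max 1 (Metric.infDist (φ 0 0)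
    {x : State n m l | x.fst ∈ A ∧ x.snd ∈ Sys.X₂})) (lt_max_of_lt_left one_pos)
  obtain ⟨T, hT⟩ := hN' β hβ γ hγ θ hθ ε hε
  obtain ⟨hcard, htime⟩ := hT S φ hφ (le_max_right _ _)
  exact ⟨T, finite_of_encard_le_coe hcard, htime⟩

end Standing

theorem BasicAssumptions.standing (hbasic : Sys.BasicAssumptions β₀ γ₀ θ₀) (hβ₀ : 0 < β₀)
    (hγ₀ : 0 < γ₀) (hθ₀ : 0 < θ₀) (hA : IsCompact A) (hA_nonempty : A.Nonempty) (hAX : A ⊆ Sys.X₁)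
    (hsteady : Sys.SteadyStateAssumptions H₁ β₀ γ₀ θ₀)
    (hinvariant : Sys.JumpInvarianceAssumption A H₁ β₀ γ₀ θ₀) :
    Standing Sys A H₁ β₀ γ₀ θ₀ where
  β₀_pos := hβ₀
  γ₀_pos := hγ₀
  θ₀_pos := hθ₀
  isCompact := hA
  nonempty := hA_nonempty
  subset := hAX
  isClosed_C := hbasic.isClosed_flowSet
  isClosed_D' := hbasic.isClosed_D'
  D_subset_C := fun _ hx => ⟨hbasic.D₁_subset hx.1, hbasic.D₂_subset hx.2⟩
  complete := hbasic.complete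
  slowVelocities_regular := hbasic.slowVelocities_regular
  jumpMap := fun β hβ γ hγ θ hθ => (hbasic.jumpMap β hβ γ hγ θ hθ).2.2
  G₁_regular := hbasic.G₁_regular
  H_nonempty := hsteady.nonempty
  H_subset := hsteady.subset
  outerSemicont := hsteady.outerSemicont
  locallyBounded := hsteady.locallyBounded
  invariant := hinvariant

end SPSystem

end SingPert

open SPSystem in
theorem theorem2_general {n m l : ℕ} {Sys : SPSystem n m l} {A : Set (Slow n)}
    {H₁ : Slow n → Set (EuclideanSpace ℝ (Fin m))} {β₀ γ₀ θ₀ : ℝ}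
    (h : Standing Sys A H₁ β₀ γ₀ θ₀) (hlayer : ∀ ρ > 0, HasLayerLyapunov Sys A H₁ γ₀ θ₀ ρ)
    (hregular : Sys.JumpRegularityAssumption A β₀ γ₀ θ₀)
    (hreduced : HasReducedLyapunov Sys A H₁ β₀ θ₀) :
    SGPAS 4 (fun p : Fin 4 → ℝ => Sys.full (p 3) (p 0) (p 1) (p 2)) (Sys.attractor A H₁) := by
  obtain ⟨σ, hσ, hregular⟩ := h.exists_regularSolutions hregular
  intro δ Δ hδ hδΔ
  have hΔ : 0 < Δ := hδ.trans hδΔ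
  obtain ⟨N, hregular⟩ := hregular Δ hΔ
  obtain ⟨r₀, hr₀, hbounded⟩ := h.exists_eventuallySmall_arcsBounded hreduced hlayer hσ hδ N
  have hr : 0 < min r₀ Δ := lt_min hr₀ hΔ
  have hreach := h.eventuallySmall_arcsReach hreduced hlayer hσ hr N hΔ
  rw [successivelySmall_four]
  refine ((hbounded.and hreach).and (eventuallySmall_mem_Ioc h.β₀_pos h.γ₀_pos h.θ₀_pos)).mono ?_
  rintro γ θ ε β ⟨⟨hbounded, T, hT, hreach⟩, hγ, hθ, hε, hβ⟩
  obtain ⟨T₀, hsol⟩ := hregular β hβ γ hγ θ hθ ε hε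
  have hbounded' : ArcsBounded (Sys.full β γ θ ε) (Sys.attractor A H₁) (σ θ⁻¹) N (min r₀ Δ) δ :=
    fun _ _ _ harc hcard hstart => hbounded harc hcard (hstart.trans (min_le_left _ _))
  exact ⟨hsol.semiGlobalStable hbounded' hr (min_le_right _ _),
    hsol.practicallyAttractive hbounded' (min_le_right _ _) hreach hT⟩

theorem theorem2 {n m l : ℕ} (Sys : SPSystem n m l) (A : Set (Slow n))
    (H₁ : Slow n → Set (EuclideanSpace ℝ (Fin m))) (β₀ γ₀ θ₀ : ℝ)
    (hβ₀ : 0 < β₀) (hγ₀ : 0 < γ₀) (hθ₀ : 0 < θ₀)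
    (hA : IsCompact A) (hA_nonempty : A.Nonempty) (hAX : A ⊆ Sys.X₁)
    (h_basic : Sys.BasicAssumptions β₀ γ₀ θ₀)
    (h_steady : Sys.SteadyStateAssumptions H₁ β₀ γ₀ θ₀)
    (h_layer : Sys.BoundaryLayerAssumption A H₁ β₀ γ₀ θ₀)
    (h_regular : Sys.JumpRegularityAssumption A β₀ γ₀ θ₀)
    (h_reduced : Sys.ReducedAssumption A H₁ β₀ γ₀ θ₀)
    (h_invariant : Sys.JumpInvarianceAssumption A H₁ β₀ γ₀ θ₀) :
    -- the parameters are `p = (γ, 1/τ, ε, β)`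
    SGPAS 4 (fun p : Fin 4 → ℝ => Sys.full (p 3) (p 0) (p 1) (p 2)) (Sys.attractor A H₁) := by
  exact theorem2_general (h_basic.standing hβ₀ hγ₀ hθ₀ hA hA_nonempty hAX h_steady h_invariant)
    (fun _ => h_layer.hasLayerLyapunov hβ₀) h_regular (h_reduced.hasReducedLyapunov hγ₀)
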